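/- **Definitions.** A *virtual network* (VN) is a finite connected undirected graph $S=(V_S,E_S)$ with a demand $w_x\in\mathbb N$ on every edge $x\in E_S$. A *physical network* (PN) is a finite connected undirected graph $G=(V_G,E_G)$ with a capacity $c_e\in\mathbb N$ and a cost $t_e\in\mathbb Q_{\ge 0}$ on every edge $e\in E_G$; always $|V_S|=|V_G|=n$. An *embedding* $f$ of $S$ into $G$ consists of a bijection $f_V\colon V_S\to V_G$ and, for every edge $x=\{i,j\}\in E_S$, a simple path $f(x)$ of $G$ between $f_V(i)$ and $f_V(j)$. It *respects the capacities* if $\sum_{x\in E_S,\ e\in f(x)} w_x\le c_e$ for all $e\in E_G$, and its *cost* is $\mathrm{Cost}(f)=\sum_{x\in E_S} w_x\sum_{e\in f(x)}t_e$. The VN $S$ is an *oversubscribed 2-star* if it is a tree of depth two consisting of a root, $g\ge 1$ group heads adjacent to the root, and $s\ge 1$ leaves adjacent to each group head, such that every edge between a group head and a leaf has demand $1$ and every edge between the root and a group head has demand $s/o$, for some rational oversubscription factor $o>0$ (with $s/o\in\mathbb N$). Networks on $n$ numbered vertices are given to an algorithm by $n$ and their adjacency matrices, with the demands, capacities and costs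 in binary (a rational as numerator and denominator); time is measured on a random access machine with logarithmic cost, as a function of the bit length of the input. **Theorem.** Consider instances that consist of an oversubscribed 2-star VN $S$ and a PN $G$ that is a tree, with $|V_S|=|V_G|$. 1. The decision problem "given $S$, $G$ and $\theta\in\mathbb Q$, is there an embedding $f$ of $S$ into $G$ that respects the capacities and has $\mathrm{Cost}(f)\le\theta$?" is in P. 2. There is a polynomial-time algorithm that, given $S$ and $G$, decides whether some embedding respects the capacities and, if so, outputs the minimal cost of such an embedding. -/

import Mathlib

/-! ### A random access machine with logarithmic cost

Programs are structured (`if`, `while`) and work on finitely many named arrays of natural numbers,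
each with indirect addressing. Every operation is charged the bit length of the numbers it
handles, so that polynomial time on this machine is polynomial time on a Turing machine. -/

namespace RAM

/-- A memory: `σ a i` is the content of cell `i` of array `a`. -/
abbrev Mem : Type := ℕ → ℕ → ℕ

/-- Expressions. `read a e` is the content of the cell of array `a` whose index is the value
of `e`; `sub` is truncated subtraction, `div` is division with rounding down. -/
inductive Expr : Type
  | lit (k : ℕ) : Expr
  | read (a : ℕ) (i : Expr) : Expr
  | add (x y : Expr) : Expr
  | sub (x y : Expr) : Expr
  | mul (x y : Expr) : Expr
  | div (x y : Expr) : Expr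

/-- The value of an expression. -/
def Expr.eval (σ : Mem) : Expr → ℕ
  | .lit k => k
  | .read a i => σ a (i.eval σ)
  | .add x y => x.eval σ + y.eval σ
  | .sub x y => x.eval σ - y.eval σ
  | .mul x y => x.eval σ * y.eval σ
  | .div x y => x.eval σ / y.eval σ

/-- The time to evaluate an expression: every node of its syntax tree costs one plus the number
of bits of its value (the operands, and the index of a `read`, are charged at their own nodes). -/
def Expr.time (σ : Mem) : Expr → ℕ
  | .lit k => 1 + Nat.size k
  | .read a i => i.time σ + (1 + Nat.size (Expr.eval σ (.read a i)))
  | .add x y => x.time σ + y.time σ + (1 + Nat.size (Expr.eval σ (.add x y)))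
  | .sub x y => x.time σ + y.time σ + (1 + Nat.size (Expr.eval σ (.sub x y)))
  | .mul x y => x.time σ + y.time σ + (1 + Nat.size (Expr.eval σ (.mul x y)))
  | .div x y => x.time σ + y.time σ + (1 + Nat.size (Expr.eval σ (.div x y)))

/-- Programs. `assign a i e` writes the value of `e` into cell `i` of array `a`; a condition
holds when its value is not zero. -/
inductive Prog : Type
  | skip : Prog
  | assign (a : ℕ) (i e : Expr) : Prog
  | seq (p q : Prog) : Prog
  | ite (b : Expr) (p q : Prog) : Prog
  | loop (b : Expr) (p : Prog) : Prog

/-- The memory after writing `v` into cell `i` of array `a`. -/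
def Mem.write (σ : Mem) (a i v : ℕ) : Mem :=
  Function.update σ a (Function.update (σ a) i v)

/-- `Exec p σ τ t`: started on the memory `σ`, the program `p` halts with the memory `τ` after
time `t`. -/
inductive Exec : Prog → Mem → Mem → ℕ → Prop
  | skip (σ : Mem) : Exec .skip σ σ 1
  | assign (σ : Mem) (a : ℕ) (i e : Expr) :
      Exec (.assign a i e) σ (σ.write a (i.eval σ) (e.eval σ)) (i.time σ + e.time σ + 1)
  | seq {p q : Prog} {σ τ ρ : Mem} {t u : ℕ} :
      Exec p σ τ t → Exec q τ ρ u → Exec (.seq p q) σ ρ (t + u)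
  | ite_true {b : Expr} {p q : Prog} {σ τ : Mem} {t : ℕ} :
      b.eval σ ≠ 0 → Exec p σ τ t → Exec (.ite b p q) σ τ (b.time σ + 1 + t)
  | ite_false {b : Expr} {p q : Prog} {σ τ : Mem} {t : ℕ} :
      b.eval σ = 0 → Exec q σ τ t → Exec (.ite b p q) σ τ (b.time σ + 1 + t)
  | loop_done {b : Expr} {p : Prog} {σ : Mem} :
      b.eval σ = 0 → Exec (.loop b p) σ σ (b.time σ + 1)
  | loop_step {b : Expr} {p : Prog} {σ τ ρ : Mem} {t u : ℕ} :
      b.eval σ ≠ 0 → Exec p σ τ t → Exec (.loop b p) τ ρ u →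
        Exec (.loop b p) σ ρ (b.time σ + 1 + t + u)

/-- The initial memory: the input list in array `0`, its length in cell `0` of array `1`, and
zeros everywhere else. -/
def initMem (l : List ℕ) : Mem := fun a i =>
  if a = 0 then l.getD i 0 else if a = 1 ∧ i = 0 then l.length else 0

/-- The memory `σ` presents the list `out` as output, in the format of the input. -/
def Outputs (σ : Mem) (out : List ℕ) : Prop :=
  σ 1 0 = out.length ∧ ∀ i (h : i < out.length), σ 0 i = out[i]

/-- The size of a list of numbers: the total number of bits, plus one for each entry. -/
def inputSize (l : List ℕ) : ℕ := (l.map fun x => Nat.size x + 1).sum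

/-- Some program, on (the code of) every instance `x`, halts within a time that is polynomial in
the size of the code and outputs a list that is related to `x` by `R`. -/
def SolvableInPolyTime {α : Type*} (enc : α ↪ List ℕ) (R : α → List ℕ → Prop) : Prop :=
  ∃ (p : Prog) (b : Polynomial ℕ), ∀ x : α, ∃ (σ : Mem) (t : ℕ) (out : List ℕ),
    Exec p (initMem (enc x)) σ t ∧ t ≤ b.eval (inputSize (enc x)) ∧ Outputs σ out ∧ R x out

/-- The decision problem "given an instance `x`, does `Q x` hold?" is in P (the answers
"yes" and "no" are output as `1` and `0`). -/
def InP {α : Type*} (enc : α ↪ List ℕ) (Q : α → Prop) : Prop :=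
  SolvableInPolyTime enc fun x out => (Q x ∧ out = [1]) ∨ (¬ Q x ∧ out = [0])

end RAM

/-! ### Networks and embeddings -/

namespace VNE

/-- A virtual network: a connected graph with a demand on every edge. -/
structure VirtualNetwork (V : Type*) where
  graph : SimpleGraph V
  connected : graph.Connected
  demand : graph.edgeSet → ℕ

/-- A physical network: a connected graph with a capacity and a cost (per unit of demand) on
every edge. Costs are rational, so that an instance has a finite description. -/
structure PhysicalNetwork (V : Type*) where
  graph : SimpleGraph V
  connected : graph.Connected
  capacity : graph.edgeSet → ℕ
  cost : graph.edgeSet → ℚ≥0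

/-- A (simple) path of a graph, with its end points. -/
structure PathIn {V : Type*} (G : SimpleGraph V) where
  source : V
  target : V
  path : G.Path source target

/-- `P.Uses e`: the edge `e` lies on the path `P`. -/
def PathIn.Uses {V : Type*} {G : SimpleGraph V} (P : PathIn G) (e : G.edgeSet) : Prop :=
  (e : Sym2 V) ∈ P.path.1.edges

/-- An embedding of a graph `S` into a graph `G`: a bijection of the vertices, and for every edge
of `S` a path of `G` that joins the images of the two ends of that edge. -/
structure Embedding {V V' : Type*} (S : SimpleGraph V) (G : SimpleGraph V') where
  node : V ≃ V'
  route : S.edgeSet → PathIn G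
  route_ends : ∀ e : S.edgeSet,
    s((route e).source, (route e).target) = Sym2.map node (e : Sym2 V)

section

variable {V V' : Type*} [Fintype V] [Fintype V'] (S : VirtualNetwork V) (G : PhysicalNetwork V')

open scoped Classical in
/-- The length of a path: the sum of the costs of its edges. -/
noncomputable def PhysicalNetwork.length (P : PathIn G.graph) : ℚ≥0 :=
  ∑ e : G.graph.edgeSet with P.Uses e, G.cost e

open scoped Classical in
/-- The cost of an embedding: every edge of the virtual network contributes its demand times the
length of its path. -/
noncomputable def embeddingCost (f : Embedding S.graph G.graph) : ℚ≥0 :=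
  ∑ x : S.graph.edgeSet, (S.demand x : ℚ≥0) * G.length (f.route x)

open scoped Classical in
/-- The capacity constraints: for every physical edge, the total demand of the virtual edges
that are routed through it is at most its capacity. -/
def RespectsCapacities (f : Embedding S.graph G.graph) : Prop :=
  ∀ e : G.graph.edgeSet,
    ∑ x : S.graph.edgeSet with (f.route x).Uses e, S.demand x ≤ G.capacity e

end

/-! ### Oversubscribed 2-stars -/

/-- The vertices of a 2-star with `g` groups of `s` leaves each. -/
inductive TwoStarVertex (g s : ℕ) : Type
  | root : TwoStarVertex g s
  | head (j : Fin g) : TwoStarVertex g s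
  | leaf (j : Fin g) (i : Fin s) : TwoStarVertex g s

/-- The relation "`a` is the parent of `b`" in the 2-star. -/
def TwoStarVertex.IsParent {g s : ℕ} : TwoStarVertex g s → TwoStarVertex g s → Prop
  | .root, .head _ => True
  | .head j, .leaf j' _ => j = j'
  | _, _ => False

/-- The 2-star with `g` groups of `s` leaves each: the root is joined to the `g` group heads, and
each group head is joined to the `s` leaves of its group. -/
def twoStar (g s : ℕ) : SimpleGraph (TwoStarVertex g s) :=
  SimpleGraph.fromRel TwoStarVertex.IsParent

/-- A virtual network is an oversubscribed 2-star if it is a tree of depth two in which all groups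
have the same number `s` of leaves, the edges inside the groups have demand `1`, and the edges at
the root have demand `s / o`, where `o` is the oversubscription factor. -/
def VirtualNetwork.IsOversubscribedTwoStar {V : Type*} (S : VirtualNetwork V) : Prop :=
  ∃ (g s : ℕ) (o : ℚ) (φ : twoStar g s ≃g S.graph), 1 ≤ g ∧ 1 ≤ s ∧ 0 < o ∧
    (∀ (j : Fin g) (e : S.graph.edgeSet), (e : Sym2 V) = s(φ .root, φ (.head j)) →
      (S.demand e : ℚ) = s / o) ∧
    (∀ (j : Fin g) (i : Fin s) (e : S.graph.edgeSet),
      (e : Sym2 V) = s(φ (.head j), φ (.leaf j i)) → S.demand e = 1)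

/-- A physical network is a tree. -/
def PhysicalNetwork.IsTree {V : Type*} (G : PhysicalNetwork V) : Prop := G.graph.IsTree

/-! ### The problem, and the encoding of its instances -/

/-- The networks of an instance of the variant "topology `𝒮` on topology `𝒢`", with the same
number `n` of vertices; the vertices are numbered. -/
structure Networks (𝒮 : ∀ ⦃n : ℕ⦄, VirtualNetwork (Fin n) → Prop)
    (𝒢 : ∀ ⦃n : ℕ⦄, PhysicalNetwork (Fin n) → Prop) where
  n : ℕ
  vn : VirtualNetwork (Fin n)
  pn : PhysicalNetwork (Fin n)
  vn_mem : 𝒮 vn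
  pn_mem : 𝒢 pn

section

variable {n : ℕ} (S : VirtualNetwork (Fin n)) (G : PhysicalNetwork (Fin n))

open scoped Classical in
/-- The entry of the adjacency matrix of a virtual network: an adjacency bit and the demand. -/
noncomputable def vnEntry (i j : Fin n) : List ℕ :=
  if h : S.graph.Adj i j then [1, S.demand ⟨s(i, j), h⟩] else [0, 0]

open scoped Classical in
/-- The entry of the adjacency matrix of a physical network: an adjacency bit, the capacity, and
the numerator and the denominator of the cost. -/
noncomputable def pnEntry (i j : Fin n) : List ℕ :=
  if h : G.graph.Adj i j then
    [1, G.capacity ⟨s(i, j), h⟩, (G.cost ⟨s(i, j), h⟩).num, (G.cost ⟨s(i, j), h⟩).den]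
  else [0, 0, 0, 0]

/-- The entries of a matrix, row by row. -/
def listMatrix (m : Fin n → Fin n → List ℕ) : List ℕ :=
  (List.finRange n).flatMap fun i => (List.finRange n).flatMap fun j => m i j

/-- The code of a pair of networks: the number of vertices and the two adjacency matrices. -/
noncomputable def networksCode : List ℕ :=
  n :: (listMatrix (vnEntry S) ++ listMatrix (pnEntry G))

end

theorem length_vnEntry {n : ℕ} (S : VirtualNetwork (Fin n)) (i j : Fin n) :
    (vnEntry S i j).length = 2 := by
  unfold vnEntry; split <;> rfl

theorem length_pnEntry {n : ℕ} (G : PhysicalNetwork (Fin n)) (i j : Fin n) :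
    (pnEntry G i j).length = 4 := by
  unfold pnEntry; split <;> rfl

theorem flatMap_inj {α β : Type*} {k : ℕ} {f g : α → List β} (l : List α)
    (hf : ∀ a, (f a).length = k) (hg : ∀ a, (g a).length = k)
    (h : l.flatMap f = l.flatMap g) : ∀ a ∈ l, f a = g a := by
  induction l with
  | nil => simp
  | cons b l ih =>
    simp only [List.flatMap_cons] at h
    obtain ⟨h1, h2⟩ := List.append_inj h (by rw [hf, hg])
    simpa [h1] using ih h2

theorem length_flatMap_finRange {n k : ℕ} {f : Fin n → List ℕ} (hf : ∀ a, (f a).length = k) :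
    ((List.finRange n).flatMap f).length = n * k := by
  simp [List.length_flatMap, hf]

theorem listMatrix_inj {n k : ℕ} {f g : Fin n → Fin n → List ℕ}
    (hf : ∀ i j, (f i j).length = k) (hg : ∀ i j, (g i j).length = k)
    (h : listMatrix f = listMatrix g) (i j : Fin n) : f i j = g i j :=
  flatMap_inj _ (hf i) (hg i)
    (flatMap_inj (k := n * k) _ (fun i => length_flatMap_finRange (hf i))
      (fun i => length_flatMap_finRange (hg i)) h i (List.mem_finRange i)) j (List.mem_finRange j)

theorem eq_of_vnEntry_eq {n : ℕ} {S S' : VirtualNetwork (Fin n)}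
    (h : ∀ i j, vnEntry S i j = vnEntry S' i j) : S = S' := by
  obtain ⟨G, c, w⟩ := S
  obtain ⟨G', c', w'⟩ := S'
  have hG : G = G' := by
    ext i j
    have := h i j
    simp only [vnEntry] at this
    split_ifs at this with h1 h2 h2 <;> simp_all
  subst hG
  congr 1
  funext ⟨e, he⟩
  induction e using Sym2.ind with
  | _ i j =>
    have := h i j
    have he' : G.Adj i j := he
    simpa [vnEntry, he'] using this

theorem eq_of_pnEntry_eq {n : ℕ} {S S' : PhysicalNetwork (Fin n)}
    (h : ∀ i j, pnEntry S i j = pnEntry S' i j) : S = S' := by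
  obtain ⟨G, c, w, t⟩ := S
  obtain ⟨G', c', w', t'⟩ := S'
  have hG : G = G' := by
    ext i j
    have := h i j
    simp only [pnEntry] at this
    split_ifs at this with h1 h2 h2 <;> simp_all
  subst hG
  have key : ∀ e : G.edgeSet, w e = w' e ∧ t e = t' e := by
    rintro ⟨e, he⟩
    induction e using Sym2.ind with
    | _ i j =>
      have := h i j
      have he' : G.Adj i j := he
      simp only [pnEntry, he', dite_true, List.cons.injEq, and_true, true_and] at this
      exact ⟨this.1, NNRat.ext_num_den this.2.1 this.2.2⟩
  obtain rfl : w = w' := funext fun e => (key e).1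
  obtain rfl : t = t' := funext fun e => (key e).2
  rfl

section

variable (𝒮 : ∀ ⦃n : ℕ⦄, VirtualNetwork (Fin n) → Prop)
  (𝒢 : ∀ ⦃n : ℕ⦄, PhysicalNetwork (Fin n) → Prop)

/-- The encoding of the inputs of the optimization problem. -/
noncomputable def networksEncoding : Networks 𝒮 𝒢 ↪ List ℕ where
  toFun N := networksCode N.vn N.pn
  inj' := by
    rintro ⟨n, S, G, hS, hG⟩ ⟨n', S', G', hS', hG'⟩ h
    simp only [networksCode, List.cons.injEq] at h
    obtain ⟨rfl, h⟩ := h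
    obtain ⟨h1, h2⟩ := List.append_inj h (by
      simp [listMatrix, List.length_flatMap, length_vnEntry])
    obtain rfl := eq_of_vnEntry_eq (listMatrix_inj (length_vnEntry S) (length_vnEntry S') h1)
    obtain rfl := eq_of_pnEntry_eq (listMatrix_inj (length_pnEntry G) (length_pnEntry G') h2)
    rfl

/-- The encoding of the inputs of the decision problem, which consist of the networks and the
desired cost `θ`: the sign, the numerator and the denominator of `θ`, and the networks. -/
noncomputable def decisionEncoding : Networks 𝒮 𝒢 × ℚ ↪ List ℕ where
  toFun I := (if I.2 < 0 then 1 else 0) :: I.2.num.natAbs :: I.2.den :: networksEncoding 𝒮 𝒢 I.1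
  inj' := by
    rintro ⟨N, q⟩ ⟨N', q'⟩ h
    simp only [List.cons.injEq] at h
    obtain ⟨h1, h2, h3, h4⟩ := h
    obtain rfl := (networksEncoding 𝒮 𝒢).injective h4
    have hq : q.num = q'.num := by
      have a := @Rat.num_neg q
      have b := @Rat.num_neg q'
      split_ifs at h1 with c d d <;> simp only [c, d, iff_true, iff_false] at a b <;> omega
    rw [Rat.ext hq h3]

variable {𝒮 𝒢}

/-- The decision problem: is there an embedding that respects the capacities and whose cost is
at most `θ`? -/
def HasEmbedding (I : Networks 𝒮 𝒢 × ℚ) : Prop :=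
  ∃ f : Embedding I.1.vn.graph I.1.pn.graph,
    RespectsCapacities I.1.vn I.1.pn f ∧ (embeddingCost I.1.vn I.1.pn f : ℚ) ≤ I.2

/-- The list `out` describes the minimal cost of an embedding that respects the capacities: it is
`[0]` if there is no such embedding, and `[1, a, b]` if the minimal cost is `a / b`. -/
def IsMinimalCost (N : Networks 𝒮 𝒢) (out : List ℕ) : Prop :=
  ((¬ ∃ f, RespectsCapacities N.vn N.pn f) ∧ out = [0]) ∨
    ∃ a b : ℕ, 0 < b ∧ out = [1, a, b] ∧
      IsLeast {c | ∃ f, RespectsCapacities N.vn N.pn f ∧ embeddingCost N.vn N.pn f = c}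
        ((a : ℚ≥0) / (b : ℚ≥0))

end

end VNE

/-!
# Embedding oversubscribed 2-stars into trees in polynomial time

Removing an edge of the tree `G` leaves two sides. Fix the image `ρ` of the root and the set `H` of
the images of the group heads, and direct all edges away from `ρ`. The far side of an edge is a
branch with, say, `m` vertices, `h` of them in `H`. The edge carries the demand `D` of each of these
`h` heads, and one unit for every leaf that it separates from its head. The `h` heads need `h * s`
leaves and the branch has room for `m - h`, so that at least `|h * (s + 1) - m|` leaves are separated:
the load is at least `minLoad D s m h` (`minLoad_le`).

All these lower bounds are attained at the same time (`exists_optimal_placement`). If an edge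
separates more leaves than necessary, then it separates a leaf outside the branch from a head inside
and a leaf inside from a head outside (`minLoad_eq`). Exchanging the two leaves lowers the load of
this edge, and it raises no other load, since the branches that avoid `ρ` form a laminar family
(`separated_swap`, `side_laminar`). So a placement with the least total number of separated leaves
attains all the bounds.

Hence the minimal cost is the minimum, over `ρ` and `H`, of a sum over the arcs directed away from
`ρ`, in which the term of an arc depends only on the number of heads in its branch
(`exists_arcLoad_le`, `exists_embedding_arcLoad`); the term is infinite if the least load exceeds the
capacity. This minimum is computed by recursion over branches: the children of a vertex are taken
one after the other, and the heads are split between the last child and the others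
(`isWeight_succ`). A branch is given by a directed edge `(u, v)`, and the whole tree, rooted at `ρ`,
by the pair `(ρ, ρ)`. Instead of ordering the branches by inclusion, the recursion proceeds in
rounds: round `k` is correct for the branches with at most `k` vertices (`table_eq_card`,
`table_minVal`). The costs are made integral by a common denominator, and the numbers `g`, `s` and
`D` are found from the number of vertices of degree one and the sum of all demands, without an
isomorphism of the virtual network to a 2-star.

The algorithm is a list of arrays, each given by one expression for its cells that may refer to
earlier cells and earlier arrays. All values are truncated at a number `B` whose bit length is linear
in that of the input and which exceeds every finite cost. A fixed expression over numbers below `B`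
is evaluated in time linear in the bit length of `B` (`Expr.time_le`), and there are polynomially
many cells, so that the polynomial running time holds whatever the expressions are
(`solvable_of_stages`). `Computed.isLeast` says that the arrays contain the minimal cost, from which
the answers of both problems are read off.
-/

/-! ### Running times of straight-line code and of counting loops -/

namespace RAM

/-- Every cell of the memory holds a number of value at most `B`. -/
def Mem.BoundedBy (σ : Mem) (B : ℕ) : Prop := ∀ a i, σ a i ≤ B

theorem Mem.write_apply (σ : Mem) (a i v a' i' : ℕ) :
    σ.write a i v a' i' = if a' = a ∧ i' = i then v else σ a' i' := by
  unfold Mem.write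
  by_cases ha : a' = a
  · subst ha
    by_cases hi : i' = i
    · subst hi; simp
    · simp [hi]
  · simp [ha]

theorem Mem.BoundedBy.write {σ : Mem} {B : ℕ} (h : σ.BoundedBy B) (a i : ℕ) {v : ℕ} (hv : v ≤ B) :
    (σ.write a i v).BoundedBy B := by
  intro a' i'
  rw [Mem.write_apply]
  split_ifs
  · exact hv
  · exact h a' i'

theorem size_add_le (x y : ℕ) : Nat.size (x + y) ≤ Nat.size x + Nat.size y + 1 := by
  rw [Nat.size_le]
  have hx := Nat.lt_size_self x
  have hy := Nat.lt_size_self y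
  have h1 : 2 ^ Nat.size x ≤ 2 ^ (Nat.size x + Nat.size y) := Nat.pow_le_pow_right (by simp) (by simp)
  have h2 : 2 ^ Nat.size y ≤ 2 ^ (Nat.size x + Nat.size y) := Nat.pow_le_pow_right (by simp) (by simp)
  rw [pow_succ]
  omega

theorem size_mul_le (x y : ℕ) : Nat.size (x * y) ≤ Nat.size x + Nat.size y := by
  rw [Nat.size_le, pow_add]
  exact Nat.mul_lt_mul'' (Nat.lt_size_self x) (Nat.lt_size_self y)

theorem size_pow_le (x k : ℕ) : Nat.size (x ^ k) ≤ k * Nat.size x + 1 := by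
  induction k with
  | zero => simp
  | succ k ih =>
    rw [pow_succ, Nat.succ_mul]
    have := size_mul_le (x ^ k) x
    omega

theorem Expr.size_eval_le (e : Expr) :
    ∃ c, ∀ (σ : Mem) (B : ℕ), σ.BoundedBy B → Nat.size (e.eval σ) ≤ c * (Nat.size B + 1) := by
  induction e with
  | lit k => exact ⟨Nat.size k, fun σ B _ => by simp only [Expr.eval]; nlinarith⟩
  | read a i _ =>
    exact ⟨1, fun σ B h => by
      have := Nat.size_le_size (h a (i.eval σ)); simp only [Expr.eval]; omega⟩
  | add x y hx hy =>
    obtain ⟨c, hc⟩ := hx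
    obtain ⟨d, hd⟩ := hy
    refine ⟨c + d + 1, fun σ B h => ?_⟩
    have := size_add_le (x.eval σ) (y.eval σ)
    have := hc σ B h
    have := hd σ B h
    simp only [Expr.eval]
    nlinarith
  | sub x y hx _ =>
    obtain ⟨c, hc⟩ := hx
    exact ⟨c, fun σ B h => (Nat.size_le_size (Nat.sub_le _ _)).trans (hc σ B h)⟩
  | mul x y hx hy =>
    obtain ⟨c, hc⟩ := hx
    obtain ⟨d, hd⟩ := hy
    refine ⟨c + d, fun σ B h => ?_⟩
    have := size_mul_le (x.eval σ) (y.eval σ)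
    have := hc σ B h
    have := hd σ B h
    simp only [Expr.eval]
    nlinarith
  | div x y hx _ =>
    obtain ⟨c, hc⟩ := hx
    exact ⟨c, fun σ B h => (Nat.size_le_size (Nat.div_le_self _ _)).trans (hc σ B h)⟩

/-- The time to evaluate a fixed expression is linear in the bit length of the largest number in
the memory. -/
theorem Expr.time_le (e : Expr) :
    ∃ c, ∀ (σ : Mem) (B : ℕ), σ.BoundedBy B → e.time σ ≤ c * (Nat.size B + 1) := by
  induction e with
  | lit k => exact ⟨Nat.size k + 1, fun σ B _ => by simp only [Expr.time]; nlinarith⟩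
  | read a i ih =>
    obtain ⟨c, hc⟩ := ih
    obtain ⟨d, hd⟩ := Expr.size_eval_le (.read a i)
    refine ⟨c + d + 1, fun σ B h => ?_⟩
    have := hc σ B h
    have := hd σ B h
    simp only [Expr.time]; nlinarith
  | add x y hx hy =>
    obtain ⟨c, hc⟩ := hx
    obtain ⟨c', hc'⟩ := hy
    obtain ⟨d, hd⟩ := Expr.size_eval_le (.add x y)
    refine ⟨c + c' + d + 1, fun σ B h => ?_⟩
    have := hc σ B h
    have := hc' σ B h
    have := hd σ B h
    simp only [Expr.time]; nlinarith
  | sub x y hx hy =>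
    obtain ⟨c, hc⟩ := hx
    obtain ⟨c', hc'⟩ := hy
    obtain ⟨d, hd⟩ := Expr.size_eval_le (.sub x y)
    refine ⟨c + c' + d + 1, fun σ B h => ?_⟩
    have := hc σ B h
    have := hc' σ B h
    have := hd σ B h
    simp only [Expr.time]; nlinarith
  | mul x y hx hy =>
    obtain ⟨c, hc⟩ := hx
    obtain ⟨c', hc'⟩ := hy
    obtain ⟨d, hd⟩ := Expr.size_eval_le (.mul x y)
    refine ⟨c + c' + d + 1, fun σ B h => ?_⟩
    have := hc σ B h
    have := hc' σ B h
    have := hd σ B h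
    simp only [Expr.time]; nlinarith
  | div x y hx hy =>
    obtain ⟨c, hc⟩ := hx
    obtain ⟨c', hc'⟩ := hy
    obtain ⟨d, hd⟩ := Expr.size_eval_le (.div x y)
    refine ⟨c + c' + d + 1, fun σ B h => ?_⟩
    have := hc σ B h
    have := hc' σ B h
    have := hd σ B h
    simp only [Expr.time]; nlinarith

/-- `Runs p σ τ T`: started on `σ`, the program `p` halts with the memory `τ` within time `T`. -/
def Runs (p : Prog) (σ τ : Mem) (T : ℕ) : Prop := ∃ t ≤ T, Exec p σ τ t

theorem Runs.mono {p : Prog} {σ τ : Mem} {T U : ℕ} (h : Runs p σ τ T) (hTU : T ≤ U) :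
    Runs p σ τ U := by
  obtain ⟨t, ht, h⟩ := h
  exact ⟨t, ht.trans hTU, h⟩

theorem Runs.seq {p q : Prog} {σ τ ρ : Mem} {T U : ℕ} (h : Runs p σ τ T) (h' : Runs q τ ρ U) :
    Runs (.seq p q) σ ρ (T + U) := by
  obtain ⟨t, ht, h⟩ := h
  obtain ⟨u, hu, h'⟩ := h'
  exact ⟨t + u, by omega, h.seq h'⟩

theorem Runs.assign (a : ℕ) (i e : Expr) :
    ∃ c, ∀ (σ : Mem) (B : ℕ), σ.BoundedBy B →
      Runs (.assign a i e) σ (σ.write a (i.eval σ) (e.eval σ)) (c * (Nat.size B + 1)) := by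
  obtain ⟨c, hc⟩ := i.time_le
  obtain ⟨d, hd⟩ := e.time_le
  refine ⟨c + d + 1, fun σ B h => ⟨_, ?_, Exec.assign σ a i e⟩⟩
  have := hc σ B h
  have := hd σ B h
  nlinarith

/-- A loop whose condition holds exactly during the first `N` rounds. -/
theorem Runs.loop {b : Expr} {p : Prog} {T U : ℕ} (N : ℕ) (st : ℕ → Mem)
    (hb : ∀ i < N, b.eval (st i) ≠ 0) (hb' : b.eval (st N) = 0)
    (ht : ∀ i ≤ N, b.time (st i) ≤ U) (hp : ∀ i < N, Runs p (st i) (st (i + 1)) T) :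
    Runs (.loop b p) (st 0) (st N) ((N + 1) * (T + U + 1)) := by
  suffices h : ∀ k ≤ N, Runs (.loop b p) (st (N - k)) (st N) ((k + 1) * (T + U + 1)) by
    simpa using h N le_rfl
  intro k
  induction k with
  | zero =>
    intro _
    refine ⟨_, ?_, Exec.loop_done hb'⟩
    have := ht N le_rfl
    simp only [Nat.sub_zero]; nlinarith
  | succ k ih =>
    intro hk
    obtain ⟨t, ht1, h1⟩ := hp (N - (k + 1)) (by omega)
    obtain ⟨u, hu, h2⟩ := ih (by omega)
    rw [show N - (k + 1) + 1 = N - k by omega] at h1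
    refine ⟨_, ?_, Exec.loop_step (hb _ (by omega)) h1 h2⟩
    have := ht (N - (k + 1)) (by omega)
    nlinarith

/-! ### Programs that fill arrays by course-of-values recursion -/

/-- Truncated subtraction twice gives the minimum of two expressions. -/
def Expr.minE (x y : Expr) : Expr := .sub x (.sub x y)

theorem Expr.eval_minE (σ : Mem) (x y : Expr) :
    (Expr.minE x y).eval σ = min (x.eval σ) (y.eval σ) := by
  simp only [Expr.minE, Expr.eval]; omega

/-- The loop counter, held in array `2`. -/
def Expr.ctr : Expr := .read 2 (.lit 0)

/-- The program that fills the cells `0, …, N - 1` of array `k` one after the other with the values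
of `e`, truncated at `B`. The numbers `B` and `N` are in the first two cells of array `3`. -/
def stage (k : ℕ) (e : Expr) : Prog :=
  .seq (.assign 2 (.lit 0) (.lit 0))
    (.loop (.sub (.read 3 (.lit 1)) .ctr)
      (.seq (.assign k .ctr (.minE e (.read 3 (.lit 0))))
        (.assign 2 (.lit 0) (.add .ctr (.lit 1)))))

/-- The memory in which the counter is `i` and the first `i` cells of array `k` agree with `A`;
the other arrays are as in `σ`. -/
def Mem.frame (σ : Mem) (k : ℕ) (A : ℕ → ℕ) (i : ℕ) : Mem := fun a j =>
  if a = 2 then if j = 0 then i else 0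
  else if a = k then if j < i then A j else 0
  else σ a j

/-- The sequence defined by course-of-values recursion with step `F`. -/
def fill (F : ℕ → (ℕ → ℕ) → ℕ) : ℕ → ℕ
  | i => F i fun j => if _h : j < i then fill F j else 0

theorem exists_course_of_values (σ : Mem) (k B : ℕ) (e : Expr) :
    ∃ A : ℕ → ℕ, ∀ i, A i = min (e.eval (σ.frame k A i)) B := by
  refine ⟨fill fun i A => min (e.eval (σ.frame k A i)) B, fun i => ?_⟩
  conv_lhs => rw [fill]
  congr 2
  funext a j
  simp only [Mem.frame]
  split_ifs <;> rfl

theorem stage_runs (k : ℕ) (e : Expr) (hk : 4 ≤ k) :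
    ∃ c, ∀ (σ : Mem) (B N : ℕ), σ 3 0 = B → σ 3 1 = N → N ≤ B → σ.BoundedBy B →
      (∀ j, σ k j = 0) → (∀ j, j ≠ 0 → σ 2 j = 0) →
      ∃ A : ℕ → ℕ, (∀ i, A i = min (e.eval (σ.frame k A i)) B) ∧
        Runs (stage k e) σ (σ.frame k A N) (c * ((N + 1) * (Nat.size B + 1))) := by
  obtain ⟨c0, hc0⟩ := Runs.assign 2 (.lit 0) (.lit 0)
  obtain ⟨c1, hc1⟩ := Runs.assign k .ctr (.minE e (.read 3 (.lit 0)))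
  obtain ⟨c2, hc2⟩ := Runs.assign 2 (.lit 0) (.add .ctr (.lit 1))
  obtain ⟨c3, hc3⟩ := Expr.time_le (.sub (.read 3 (.lit 1)) .ctr)
  refine ⟨c0 + c1 + c2 + c3 + 1, fun σ B N hB hN hNB hσ hσk hσ2 => ?_⟩
  obtain ⟨A, hA⟩ := exists_course_of_values σ k B e
  refine ⟨A, hA, ?_⟩
  have hbd : ∀ i ≤ N, (σ.frame k A i).BoundedBy B := by
    intro i hi a j
    simp only [Mem.frame]
    split_ifs
    · omega
    · omega
    · rw [hA]; exact min_le_right _ _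
    · omega
    · exact hσ a j
  have hctr : ∀ i, Expr.ctr.eval (σ.frame k A i) = i := by
    intro i; simp [Expr.ctr, Expr.eval, Mem.frame]
  have h3 : ∀ i j, σ.frame k A i 3 j = σ 3 j := by
    intro i j; simp [Mem.frame, show 3 ≠ k by omega]
  have hcond : ∀ i, (Expr.sub (.read 3 (.lit 1)) .ctr).eval (σ.frame k A i) = N - i := by
    intro i
    rw [Expr.eval, hctr]; simp only [Expr.eval]; rw [h3, hN]
  have r0 := hc0 σ B hσ
  have e0 : σ.write 2 ((Expr.lit 0).eval σ) ((Expr.lit 0).eval σ) = σ.frame k A 0 := by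
    funext a j
    simp only [Mem.write_apply, Expr.eval, Mem.frame]
    by_cases ha : a = 2
    · subst ha
      by_cases hj : j = 0
      · simp [hj]
      · simp [hj, hσ2]
    · by_cases hak : a = k
      · subst hak
        simp [ha, hσk]
      · simp [ha, hak]
  rw [e0] at r0
  have r1 := Runs.loop (b := .sub (.read 3 (.lit 1)) .ctr)
    (p := .seq (.assign k .ctr (.minE e (.read 3 (.lit 0))))
        (.assign 2 (.lit 0) (.add .ctr (.lit 1))))
    (T := c1 * (Nat.size B + 1) + c2 * (Nat.size B + 1)) (U := c3 * (Nat.size B + 1)) N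
    (fun i => σ.frame k A i)
    (fun i hi => by rw [hcond]; omega) (by rw [hcond]; omega)
    (fun i hi => hc3 _ _ (hbd i hi))
    (fun i hi => by
      have r1 := hc1 _ _ (hbd i hi.le)
      rw [hctr, Expr.eval_minE] at r1
      have hv : min (e.eval (σ.frame k A i)) ((Expr.read 3 (.lit 0)).eval (σ.frame k A i))
          = A i := by
        rw [hA i]; simp only [Expr.eval]; rw [h3, hB]
      rw [hv] at r1
      have hb1 : ((σ.frame k A i).write k i (A i)).BoundedBy B :=
        (hbd i hi.le).write _ _ (by rw [hA]; exact min_le_right _ _)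
      have r2 := hc2 _ _ hb1
      have e2 : ((σ.frame k A i).write k i (A i)).write 2
          ((Expr.lit 0).eval ((σ.frame k A i).write k i (A i)))
          ((Expr.add .ctr (.lit 1)).eval ((σ.frame k A i).write k i (A i)))
          = σ.frame k A (i + 1) := by
        funext a j
        simp only [Mem.write_apply, Expr.eval, Expr.ctr]
        by_cases ha : a = 2
        · subst ha
          by_cases hj : j = 0
          · simp [hj, Mem.frame, show 2 ≠ k by omega]
          · simp [hj, Mem.frame, show 2 ≠ k by omega]
        · by_cases hak : a = k
          · subst hak
            simp only [ha, Mem.frame, false_and, true_and, if_false, if_true]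
            by_cases hj : j = i
            · simp [hj]
            · have : j < i ↔ j < i + 1 := by omega
              simp [hj, this]
          · simp [ha, hak, Mem.frame]
      rw [e2] at r2
      exact r1.seq r2)
  refine (r0.seq r1).mono ?_
  have : 1 ≤ Nat.size B + 1 := by omega
  generalize Nat.size B + 1 = s at *
  nlinarith [Nat.zero_le (N * c0 * s), Nat.zero_le (N * s)]

/-- Stages that fill the arrays `k`, `k + 1`, … -/
def stages : ℕ → List Expr → Prog
  | _, [] => .skip
  | k, e :: es => .seq (stage k e) (stages (k + 1) es)

/-- What is visible of the memory `τ` when cell `i` of array `k` is computed: the counter, the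
arrays before `k`, and the cells of array `k` before `i`. -/
def Mem.view (τ : Mem) (k i : ℕ) : Mem := fun a j =>
  if a = 2 then if j = 0 then i else 0
  else if a < k then τ a j
  else if a = k then if j < i then τ a j else 0
  else 0

theorem stages_runs (es : List Expr) (k : ℕ) (hk : 4 ≤ k) :
    ∃ c, ∀ (σ : Mem) (B N : ℕ), σ 3 0 = B → σ 3 1 = N → N ≤ B → σ.BoundedBy B →
      (∀ a, k ≤ a → ∀ j, σ a j = 0) → (∀ j, j ≠ 0 → σ 2 j = 0) →
      ∃ τ : Mem, Runs (stages k es) σ τ (c * ((N + 1) * (Nat.size B + 1))) ∧ τ.BoundedBy B ∧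
        (∀ a, a < k → a ≠ 2 → τ a = σ a) ∧
        ∀ (m : ℕ) (hm : m < es.length), ∀ i < N,
          τ (k + m) i = min (es[m].eval (τ.view (k + m) i)) B := by
  induction es generalizing k with
  | nil =>
    refine ⟨1, fun σ B N _ _ _ hσ _ _ => ⟨σ, ⟨1, ?_, Exec.skip σ⟩, hσ, fun _ _ _ => rfl, ?_⟩⟩
    · nlinarith [Nat.zero_le (N * (Nat.size B + 1))]
    · simp
  | cons e es ih =>
    obtain ⟨c, hc⟩ := stage_runs k e hk
    obtain ⟨d, hd⟩ := ih (k + 1) (by omega)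
    refine ⟨c + d, fun σ B N hB hN hNB hσ hz h2 => ?_⟩
    obtain ⟨A, hA, r⟩ := hc σ B N hB hN hNB hσ (hz k le_rfl) h2
    have hbd : (σ.frame k A N).BoundedBy B := by
      intro a j
      simp only [Mem.frame]
      split_ifs
      · omega
      · omega
      · rw [hA]; exact min_le_right _ _
      · omega
      · exact hσ a j
    obtain ⟨τ, r', hτ, hle, heq⟩ := hd (σ.frame k A N) B N
      (by simp [Mem.frame, show 3 ≠ k by omega, hB]) (by simp [Mem.frame, show 3 ≠ k by omega, hN])
      hNB hbd
      (fun a ha j => by simp [Mem.frame, show a ≠ 2 by omega, show a ≠ k by omega, hz a (by omega)])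
      (fun j hj => by simp [Mem.frame, hj])
    refine ⟨τ, (r.seq r').mono (add_mul c d _).ge, hτ, fun a ha h2' => ?_, ?_⟩
    · rw [hle a (by omega) h2']
      funext j
      simp [Mem.frame, h2', show a ≠ k by omega]
    · intro m hm i hi
      rcases m with _ | m
      · have h1 : τ k i = A i := by
          rw [hle k (by omega) (by omega)]
          simp [Mem.frame, show k ≠ 2 by omega, hi]
        have h2' : τ.view k i = σ.frame k A i := by
          funext a j
          simp only [Mem.view, Mem.frame]
          by_cases ha : a = 2
          · simp [ha]
          · by_cases hak : a < k
            · simp only [ha, hak, if_false, if_true, show a ≠ k by omega]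
              rw [hle a (by omega) ha]
              simp [Mem.frame, ha, show a ≠ k by omega]
            · by_cases hak' : a = k
              · subst hak'
                simp only [ha, lt_irrefl, if_false, if_true]
                split_ifs with hj
                · rw [hle a (by omega) ha]
                  simp [Mem.frame, ha, show j < N by omega]
                · rfl
              · simp [ha, hak, hak', hz a (by omega)]
        simp only [Nat.add_zero, List.getElem_cons_zero]
        rw [h1, h2', hA i]
      · have := heq m (by simpa using hm) i hi
        rw [show k + 1 + m = k + (m + 1) by omega] at this
        simpa using this

/-! ### From course-of-values recursion to polynomial-time solvability -/

/-- The product of the numbers `x + 2`, for the entries `x` of the list: an upper bound for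
everything that is read off the list, with a bit length linear in the size of the list. -/
def weight (l : List ℕ) : ℕ := (l.map (· + 2)).prod

theorem weight_pos (l : List ℕ) : 0 < weight l := by
  induction l with
  | nil => simp [weight]
  | cons x l ih =>
    have : weight (x :: l) = (x + 2) * weight l := by simp [weight]
    rw [this]; positivity

theorem weight_cons (x : ℕ) (l : List ℕ) : weight (x :: l) = (x + 2) * weight l := by
  simp [weight]

theorem add_two_le_weight {l : List ℕ} {x : ℕ} (hx : x ∈ l) : x + 2 ≤ weight l := by
  induction l with
  | nil => simp at hx
  | cons y l ih =>
    rw [weight_cons]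
    have := weight_pos l
    rcases List.mem_cons.1 hx with rfl | hx
    · nlinarith
    · nlinarith [ih hx]

theorem length_le_weight (l : List ℕ) : l.length + 1 ≤ weight l := by
  induction l with
  | nil => simp [weight]
  | cons y l ih =>
    rw [weight_cons, List.length_cons]
    nlinarith

theorem weight_append (l l' : List ℕ) : weight (l ++ l') = weight l * weight l' := by
  simp [weight]

theorem weight_take_le (l : List ℕ) (i : ℕ) : weight (l.take i) ≤ weight l := by
  conv_rhs => rw [← List.take_append_drop i l, weight_append]
  exact Nat.le_mul_of_pos_right _ (weight_pos _)

theorem getD_le_weight (l : List ℕ) (i : ℕ) : l.getD i 0 ≤ weight l := by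
  by_cases h : i < l.length
  · rw [List.getD_eq_getElem _ _ h]
    exact le_trans (by omega) (add_two_le_weight (List.getElem_mem h))
  · rw [List.getD_eq_default _ _ (by omega)]; exact Nat.zero_le _

theorem weight_eq_prod (l : List ℕ) :
    weight l = ∏ i ∈ Finset.range l.length, (l.getD i 0 + 2) := by
  induction l with
  | nil => simp [weight]
  | cons x l ih => rw [weight_cons, ih, List.length_cons, Finset.prod_range_succ', mul_comm]; simp

theorem prod_getD_le_weight (l : List ℕ) (s : Finset ℕ) :
    ∏ i ∈ s, max 1 (l.getD i 0) ≤ weight l := by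
  classical
  have h1 : ∏ i ∈ s ∩ Finset.range l.length, max 1 (l.getD i 0) = ∏ i ∈ s, max 1 (l.getD i 0) := by
    refine Finset.prod_subset Finset.inter_subset_left fun i hi hi' => ?_
    have : l.length ≤ i := by
      by_contra h
      exact hi' (Finset.mem_inter.2 ⟨hi, by simpa using h⟩)
    rw [List.getD_eq_default _ _ this]
    rfl
  rw [← h1]
  refine (Finset.prod_le_prod' fun i _ => show _ ≤ l.getD i 0 + 2 by omega).trans ?_
  refine Nat.le_of_dvd (weight_pos l) ?_
  rw [weight_eq_prod]
  exact Finset.prod_dvd_prod_of_subset _ _ _ Finset.inter_subset_right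

theorem size_weight_le (l : List ℕ) : Nat.size (weight l) ≤ 3 * inputSize l + 1 := by
  induction l with
  | nil => simp [weight, inputSize]
  | cons x l ih =>
    rw [weight_cons]
    have h1 := size_mul_le (x + 2) (weight l)
    have h2 := size_add_le x 2
    have h3 : Nat.size 2 = 2 := by
      have := @Nat.size_pow 1
      simpa using this
    have h4 : inputSize (x :: l) = Nat.size x + 1 + inputSize l := by simp [inputSize]
    omega

theorem length_le_inputSize (l : List ℕ) : l.length ≤ inputSize l := by
  induction l with
  | nil => simp
  | cons x l ih =>
    have h4 : inputSize (x :: l) = Nat.size x + 1 + inputSize l := by simp [inputSize]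
    rw [List.length_cons]; omega

/-- Iterated multiplication. -/
def Expr.powE (e : Expr) : ℕ → Expr
  | 0 => .lit 1
  | k + 1 => .mul (e.powE k) e

theorem Expr.eval_powE (σ : Mem) (e : Expr) (k : ℕ) : (e.powE k).eval σ = e.eval σ ^ k := by
  induction k with
  | zero => rfl
  | succ k ih => simp [Expr.powE, Expr.eval, ih, pow_succ]

/-- The loop that computes the weight of the input list. -/
def weightLoop : Prog :=
  .loop (.sub (.read 1 (.lit 0)) .ctr)
    (.seq (.assign 3 (.lit 0) (.mul (.read 3 (.lit 0)) (.add (.read 0 .ctr) (.lit 2))))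
      (.assign 2 (.lit 0) (.add .ctr (.lit 1))))

/-- The program that stores the bound `B = weight ^ 6` and the length `N = (n + 1) ^ 6` of the
arrays, where `n` is the entry of the input at position `off`. This length is enough for tables with
six coordinates from `0` to `n`. -/
def setup (off : ℕ) : Prog :=
  .seq (.assign 3 (.lit 0) (.lit 1)) (.seq weightLoop
    (.seq (.assign 3 (.lit 1) ((Expr.add (.read 0 (.lit off)) (.lit 1)).powE 6))
      (.assign 3 (.lit 0) ((Expr.read 3 (.lit 0)).powE 6))))

/-- The initial memory, with other values in the cells used by `setup`. -/
def setupMem (l : List ℕ) (i P N : ℕ) : Mem := fun a j =>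
  if a = 2 ∧ j = 0 then i else if a = 3 ∧ j = 0 then P else if a = 3 ∧ j = 1 then N
  else initMem l a j

theorem initMem_le_weight (l : List ℕ) : (initMem l).BoundedBy (weight l) := by
  intro a j
  unfold initMem
  split_ifs
  · exact getD_le_weight l j
  · exact le_trans (by omega) (length_le_weight l)
  · exact Nat.zero_le _

theorem setupMem_boundedBy {l : List ℕ} {i P N B : ℕ} (hB : weight l ≤ B) (hi : i ≤ B)
    (hP : P ≤ B) (hN : N ≤ B) : (setupMem l i P N).BoundedBy B := by
  intro a j
  unfold setupMem
  split_ifs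
  · exact hi
  · exact hP
  · exact hN
  · exact (initMem_le_weight l a j).trans hB

theorem weightLoop_runs : ∃ c, ∀ l : List ℕ,
    Runs weightLoop (setupMem l 0 1 0) (setupMem l l.length (weight l) 0)
      (c * ((l.length + 1) * (Nat.size (weight l) + 1))) := by
  obtain ⟨c1, hc1⟩ := Runs.assign 3 (.lit 0)
    (.mul (.read 3 (.lit 0)) (.add (.read 0 .ctr) (.lit 2)))
  obtain ⟨c2, hc2⟩ := Runs.assign 2 (.lit 0) (.add .ctr (.lit 1))
  obtain ⟨c3, hc3⟩ := Expr.time_le (.sub (.read 1 (.lit 0)) .ctr)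
  refine ⟨c1 + c2 + c3 + 1, fun l => ?_⟩
  have hbd : ∀ i ≤ l.length, (setupMem l i (weight (l.take i)) 0).BoundedBy (weight l) := by
    intro i hi
    have := length_le_weight l
    exact setupMem_boundedBy le_rfl (by omega) (weight_take_le l i) (Nat.zero_le _)
  have hctr : ∀ i P, Expr.ctr.eval (setupMem l i P 0) = i := by
    intro i P; simp [Expr.ctr, Expr.eval, setupMem]
  have hcond : ∀ i P, (Expr.sub (.read 1 (.lit 0)) .ctr).eval (setupMem l i P 0)
      = l.length - i := by
    intro i P
    rw [Expr.eval, hctr]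
    simp [Expr.eval, setupMem, initMem]
  have r := Runs.loop (b := .sub (.read 1 (.lit 0)) .ctr)
    (p := .seq (.assign 3 (.lit 0) (.mul (.read 3 (.lit 0)) (.add (.read 0 .ctr) (.lit 2))))
      (.assign 2 (.lit 0) (.add .ctr (.lit 1))))
    (T := c1 * (Nat.size (weight l) + 1) + c2 * (Nat.size (weight l) + 1))
    (U := c3 * (Nat.size (weight l) + 1)) l.length
    (fun i => setupMem l i (weight (l.take i)) 0)
    (fun i hi => by rw [hcond]; omega) (by rw [hcond]; omega)
    (fun i hi => hc3 _ _ (hbd i hi))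
    (fun i hi => by
      have hP : weight (l.take (i + 1)) = weight (l.take i) * (l.getD i 0 + 2) := by
        rw [List.take_succ_eq_append_getElem hi, weight_append, List.getD_eq_getElem _ _ hi]
        simp [weight]
      have r1 := hc1 _ _ (hbd i hi.le)
      have e1 : (setupMem l i (weight (l.take i)) 0).write 3
          ((Expr.lit 0).eval (setupMem l i (weight (l.take i)) 0))
          ((Expr.mul (.read 3 (.lit 0)) (.add (.read 0 .ctr) (.lit 2))).eval
            (setupMem l i (weight (l.take i)) 0)) = setupMem l i (weight (l.take (i + 1))) 0 := by
        funext a j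
        rw [Mem.write_apply, hP]
        simp only [Expr.eval, hctr]
        by_cases h : a = 3 ∧ j = 0
        · simp [h, setupMem, initMem]
        · simp [h, setupMem]
      rw [e1] at r1
      have hb : (setupMem l i (weight (l.take (i + 1))) 0).BoundedBy (weight l) :=
        setupMem_boundedBy le_rfl (by have := length_le_weight l; omega) (weight_take_le l _)
          (Nat.zero_le _)
      have r2 := hc2 _ _ hb
      have e2 : (setupMem l i (weight (l.take (i + 1))) 0).write 2
          ((Expr.lit 0).eval (setupMem l i (weight (l.take (i + 1))) 0))
          ((Expr.add .ctr (.lit 1)).eval (setupMem l i (weight (l.take (i + 1))) 0))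
          = setupMem l (i + 1) (weight (l.take (i + 1))) 0 := by
        funext a j
        rw [Mem.write_apply]
        simp only [Expr.eval, hctr]
        by_cases h : a = 2 ∧ j = 0
        · simp [h, setupMem]
        · simp [h, setupMem]
      rw [e2] at r2
      exact r1.seq r2)
  have e : weight (l.take 0) = 1 := by simp [weight]
  rw [e, List.take_length] at r
  refine r.mono ?_
  have : 1 ≤ Nat.size (weight l) + 1 := by omega
  generalize Nat.size (weight l) + 1 = s at *
  nlinarith [Nat.zero_le (l.length * s)]

theorem setup_runs (off : ℕ) : ∃ c, ∀ l : List ℕ, l.getD off 0 ≤ l.length →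
    Runs (setup off) (initMem l)
      (setupMem l l.length (weight l ^ 6) ((l.getD off 0 + 1) ^ 6))
      (c * ((l.length + 1) * (Nat.size (weight l ^ 6) + 1))) := by
  obtain ⟨c0, hc0⟩ := Runs.assign 3 (.lit 0) (.lit 1)
  obtain ⟨c1, hc1⟩ := weightLoop_runs
  obtain ⟨c2, hc2⟩ := Runs.assign 3 (.lit 1) ((Expr.add (.read 0 (.lit off)) (.lit 1)).powE 6)
  obtain ⟨c3, hc3⟩ := Runs.assign 3 (.lit 0) ((Expr.read 3 (.lit 0)).powE 6)
  refine ⟨c0 + c1 + c2 + c3, fun l hl => ?_⟩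
  have hw := length_le_weight l
  have hW : weight l ≤ weight l ^ 6 := Nat.le_self_pow (by norm_num) _
  have hN : (l.getD off 0 + 1) ^ 6 ≤ weight l ^ 6 := Nat.pow_le_pow_left (by omega) _
  have r0 := hc0 _ _ fun a j => (initMem_le_weight l a j).trans hW
  have e0 : (initMem l).write 3 ((Expr.lit 0).eval (initMem l)) ((Expr.lit 1).eval (initMem l))
      = setupMem l 0 1 0 := by
    funext a j
    simp only [Mem.write_apply, Expr.eval, setupMem]
    by_cases h : a = 3 ∧ j = 0
    · simp [h]
    · by_cases h2 : a = 2 ∧ j = 0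
      · simp [h2, initMem]
      · by_cases h3 : a = 3 ∧ j = 1
        · simp [h3, initMem]
        · simp [h, h2, h3]
  rw [e0] at r0
  have r1 := hc1 l
  have r2 := hc2 _ (weight l ^ 6)
    (setupMem_boundedBy (l := l) (i := l.length) (P := weight l) (N := 0) hW (by omega) hW
      (Nat.zero_le _))
  have e2 : (setupMem l l.length (weight l) 0).write 3
      ((Expr.lit 1).eval (setupMem l l.length (weight l) 0))
      (((Expr.add (.read 0 (.lit off)) (.lit 1)).powE 6).eval (setupMem l l.length (weight l) 0))
      = setupMem l l.length (weight l) ((l.getD off 0 + 1) ^ 6) := by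
    funext a j
    rw [Mem.write_apply, Expr.eval_powE]
    simp only [Expr.eval]
    by_cases h : a = 3 ∧ j = 1
    · simp [h, setupMem, initMem]
    · simp [h, setupMem]
  rw [e2] at r2
  have r3 := hc3 _ (weight l ^ 6)
    (setupMem_boundedBy (l := l) (i := l.length) (P := weight l)
      (N := (l.getD off 0 + 1) ^ 6) hW (by omega) hW hN)
  have e3 : (setupMem l l.length (weight l) ((l.getD off 0 + 1) ^ 6)).write 3
      ((Expr.lit 0).eval (setupMem l l.length (weight l) ((l.getD off 0 + 1) ^ 6)))
      (((Expr.read 3 (.lit 0)).powE 6).eval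
        (setupMem l l.length (weight l) ((l.getD off 0 + 1) ^ 6)))
      = setupMem l l.length (weight l ^ 6) ((l.getD off 0 + 1) ^ 6) := by
    funext a j
    rw [Mem.write_apply, Expr.eval_powE]
    simp only [Expr.eval]
    by_cases h : a = 3 ∧ j = 0
    · simp [h, setupMem]
    · simp [h, setupMem]
  rw [e3] at r3
  refine (r0.seq (r1.seq (r2.seq r3))).mono ?_
  have hs : Nat.size (weight l) ≤ Nat.size (weight l ^ 6) := Nat.size_le_size hW
  generalize Nat.size (weight l ^ 6) = s at *
  generalize Nat.size (weight l) = s' at *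
  have h1 : (l.length + 1) * (s' + 1) ≤ (l.length + 1) * (s + 1) := by gcongr
  have h2 : s + 1 ≤ (l.length + 1) * (s + 1) := by nlinarith
  generalize (l.length + 1) * (s' + 1) = u at *
  generalize (l.length + 1) * (s + 1) = v at *
  generalize s + 1 = w at *
  nlinarith

/-- The program that copies the answer, a list of at most three numbers preceded by its length,
from array `q` to the place of the output. -/
def answer (q : ℕ) : Prog :=
  .seq (.assign 1 (.lit 0) (.read q (.lit 0))) (.seq (.assign 0 (.lit 0) (.read q (.lit 1)))
    (.seq (.assign 0 (.lit 1) (.read q (.lit 2))) (.assign 0 (.lit 2) (.read q (.lit 3)))))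

theorem answer_runs (q : ℕ) (hq : 2 ≤ q) : ∃ c, ∀ (σ : Mem) (B : ℕ), σ.BoundedBy B →
    ∃ τ, Runs (answer q) σ τ (c * (Nat.size B + 1)) ∧ τ 1 0 = σ q 0 ∧
      ∀ i < 3, τ 0 i = σ q (i + 1) := by
  obtain ⟨c0, hc0⟩ := Runs.assign 1 (.lit 0) (.read q (.lit 0))
  obtain ⟨c1, hc1⟩ := Runs.assign 0 (.lit 0) (.read q (.lit 1))
  obtain ⟨c2, hc2⟩ := Runs.assign 0 (.lit 1) (.read q (.lit 2))
  obtain ⟨c3, hc3⟩ := Runs.assign 0 (.lit 2) (.read q (.lit 3))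
  have h0 : q ≠ 0 := by omega
  have h1 : q ≠ 1 := by omega
  refine ⟨c0 + c1 + c2 + c3, fun σ B h => ?_⟩
  have r0 := hc0 σ B h
  have b0 := h.write 1 ((Expr.lit 0).eval σ) (h q 0)
  have r1 := hc1 _ B b0
  have b1 := b0.write 0 0 (b0 q 1)
  have r2 := hc2 _ B b1
  have b2 := b1.write 0 1 (b1 q 2)
  have r3 := hc3 _ B b2
  refine ⟨_, (r0.seq (r1.seq (r2.seq r3))).mono (by nlinarith), ?_, ?_⟩
  · simp [Mem.write_apply, Expr.eval]
  · intro i hi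
    interval_cases i <;> simp [Mem.write_apply, Expr.eval, h0, h1]

/-- A problem is solvable in polynomial time if its answers can be read off an array in a list of
arrays that are defined one after the other by course-of-values recursion, each by one expression
for the cell with the number in the counter. The arrays have `(n + 1) ^ 6` cells, where `n` is the
entry of the input at position `off`, and all values are truncated at `weight ^ 6`; the truncation
is what keeps the time polynomial without a look at the expressions. -/
theorem solvable_of_stages {α : Type*} (enc : α ↪ List ℕ) (R : α → List ℕ → Prop) (off : ℕ)
    (es : List Expr)
    (hoff : ∀ x, (enc x).getD off 0 ≤ (enc x).length)
    (h : ∀ (x : α) (τ : Mem), (∀ i, τ 0 i = (enc x).getD i 0) → τ 3 0 = weight (enc x) ^ 6 →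
      (∀ (m : ℕ) (hm : m < es.length), ∀ i < ((enc x).getD off 0 + 1) ^ 6,
        τ (4 + m) i = min (es[m].eval (τ.view (4 + m) i)) (weight (enc x) ^ 6)) →
      ∃ out : List ℕ, out.length ≤ 3 ∧ τ (es.length + 3) 0 = out.length ∧
        (∀ (i : ℕ) (hi : i < out.length), τ (es.length + 3) (i + 1) = out[i]) ∧ R x out) :
    SolvableInPolyTime enc R := by
  obtain ⟨c0, hc0⟩ := setup_runs off
  obtain ⟨c1, hc1⟩ := stages_runs es 4 le_rfl
  obtain ⟨c2, hc2⟩ := answer_runs (es.length + 3) (by omega)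
  -- the last stage fills array `4 + (es.length - 1)`
  refine ⟨.seq (setup off) (.seq (stages 4 es) (answer (es.length + 3))),
    Polynomial.C ((c0 + 2 * c1 + c2) * 18) * (Polynomial.X + 1) ^ 7, fun x => ?_⟩
  set l := enc x with hl
  have hw := length_le_weight l
  have hn : l.getD off 0 ≤ l.length := hoff x
  have hW : weight l ≤ weight l ^ 6 := Nat.le_self_pow (by norm_num) _
  have hN : (l.getD off 0 + 1) ^ 6 ≤ weight l ^ 6 := Nat.pow_le_pow_left (by omega) _
  have r0 := hc0 l hn
  obtain ⟨τ, r1, hτ, hle, heq⟩ := hc1 (setupMem l l.length (weight l ^ 6) ((l.getD off 0 + 1) ^ 6))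
    (weight l ^ 6) ((l.getD off 0 + 1) ^ 6) (by simp [setupMem]) (by simp [setupMem]) hN
    (setupMem_boundedBy hW (by omega) le_rfl hN)
    (fun a ha j => by
      simp [setupMem, initMem, show a ≠ 0 by omega, show a ≠ 1 by omega, show a ≠ 2 by omega,
        show a ≠ 3 by omega])
    (fun j hj => by simp [setupMem, initMem, hj])
  obtain ⟨ρ, r2, h10, h0⟩ := hc2 τ _ hτ
  obtain ⟨out, hout, hlen, hval, hR⟩ := h x τ
    (fun i => by rw [hle 0 (by omega) (by omega)]; simp [setupMem, initMem, hl])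
    (by rw [hle 3 (by omega) (by omega)]; simp [setupMem, hl])
    (fun m hm i hi => heq m hm i hi)
  obtain ⟨t, ht, hE⟩ := r0.seq (r1.seq r2)
  refine ⟨ρ, t, out, hE, ht.trans ?_, ⟨by rw [h10, hlen], fun i hi => ?_⟩, hR⟩
  · have s1 := size_pow_le (weight l) 6
    have s2 := size_weight_le l
    have s3 := length_le_inputSize l
    simp only [Polynomial.eval_mul, Polynomial.eval_C, Polynomial.eval_pow, Polynomial.eval_add,
      Polynomial.eval_X, Polynomial.eval_one]
    set I := inputSize l
    -- `weight l` has at most `3 * I + 1` bits, and its sixth power about six times as many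
    have s4 : Nat.size (weight l ^ 6) + 1 ≤ 18 * (I + 1) := by omega
    have a0 : (l.length + 1) * (Nat.size (weight l ^ 6) + 1) ≤ (I + 1) ^ 6 * (18 * (I + 1)) :=
      Nat.mul_le_mul ((Nat.succ_le_succ s3).trans (Nat.le_self_pow (by norm_num) _)) s4
    have a1 : ((l.getD off 0 + 1) ^ 6 + 1) * (Nat.size (weight l ^ 6) + 1)
        ≤ (2 * (I + 1) ^ 6) * (18 * (I + 1)) := by
      refine Nat.mul_le_mul ?_ s4
      have : (l.getD off 0 + 1) ^ 6 ≤ (I + 1) ^ 6 := Nat.pow_le_pow_left (by omega) _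
      have : 1 ≤ (I + 1) ^ 6 := Nat.one_le_pow _ _ (by omega)
      omega
    have a2 : Nat.size (weight l ^ 6) + 1 ≤ (I + 1) ^ 6 * (18 * (I + 1)) :=
      s4.trans (Nat.le_mul_of_pos_left _ (by positivity))
    calc _ ≤ c0 * ((I + 1) ^ 6 * (18 * (I + 1)))
          + (c1 * ((2 * (I + 1) ^ 6) * (18 * (I + 1))) + c2 * ((I + 1) ^ 6 * (18 * (I + 1)))) := by
            gcongr
      _ = _ := by ring
  · rw [h0 i (by omega), hval i hi]

end RAM

/-! ### The two sides of an edge of a tree -/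

namespace VNE

/-- In a connected graph, an edge leads out of any set of vertices between two given vertices. -/
theorem exists_adj_leaving {V : Type*} {G : SimpleGraph V} (hG : G.Connected)
    {S : Finset V} {x y : V} (hx : x ∈ S) (hy : y ∉ S) :
    ∃ p ∈ S, ∃ q, q ∉ S ∧ G.Adj p q := by
  by_contra! h
  obtain ⟨p⟩ := hG.preconnected x y
  have key : ∀ x y, G.Walk x y → x ∈ S → y ∈ S := by
    intro x y p
    induction p with
    | nil => exact id
    | @cons _ z _ hadj p ih =>
      intro hx
      by_cases hz : z ∈ S
      · exact ih hz
      · exact absurd hadj (h _ hx _ hz)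
  exact hy (key x y p hx)

section Sides

variable {V : Type*} [Fintype V] {G : SimpleGraph V} {a b a' b' c c' u v x y ρ : V}

open scoped Classical in
/-- The vertices that can be reached from `v` without using the edge `uv`. For an edge of a tree
this is the branch at `u` that starts with `v`; in the case `u = v` no edge is deleted, and the
side of a connected graph is everything. -/
noncomputable def side (G : SimpleGraph V) (u v : V) : Finset V :=
  Finset.univ.filter fun x => (G.deleteEdges {s(u, v)}).Reachable v x

open scoped Classical in
/-- The neighbours of `v` other than `u`: the children of `v` in the branch `side G u v`. -/
noncomputable def children (G : SimpleGraph V) (u v : V) : Finset V :=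
  Finset.univ.filter fun c => G.Adj v c ∧ c ≠ u

open scoped Classical in
/-- The edges of the branch `side G u v`, directed away from `v`. -/
noncomputable def arcs (G : SimpleGraph V) (u v : V) : Finset (V × V) :=
  Finset.univ.filter fun p =>
    G.Adj p.1 p.2 ∧ p.1 ∈ side G u v ∧ p.2 ∈ side G u v ∧ v ∉ side G p.1 p.2

theorem mem_side : x ∈ side G u v ↔ (G.deleteEdges {s(u, v)}).Reachable v x := by
  simp [side]

theorem mem_children : c ∈ children G u v ↔ G.Adj v c ∧ c ≠ u := by simp [children]

theorem mem_arcs : (a, b) ∈ arcs G u v ↔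
    G.Adj a b ∧ a ∈ side G u v ∧ b ∈ side G u v ∧ v ∉ side G a b := by simp [arcs]

theorem self_mem_side : v ∈ side G u v := mem_side.2 (SimpleGraph.Reachable.refl _)

theorem mem_side_of_adj (hx : x ∈ side G u v) (h : G.Adj x y) (hne : s(x, y) ≠ s(u, v)) :
    y ∈ side G u v := by
  rw [mem_side] at hx ⊢
  exact hx.trans (SimpleGraph.Adj.reachable (by simpa using ⟨h, by simpa using hne⟩))

theorem side_self (hG : G.Connected) : side G v v = Finset.univ := by
  have h : G.deleteEdges {s(v, v)} = G := by
    ext x y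
    simp only [SimpleGraph.deleteEdges_adj, Set.mem_singleton_iff, and_iff_left_iff_imp]
    intro h h'
    rcases Sym2.eq_iff.1 h' with ⟨rfl, rfl⟩ | ⟨rfl, rfl⟩ <;> exact G.loopless.irrefl _ h
  ext x
  rw [mem_side, h]
  simpa using hG.preconnected v x

theorem notMem_side (hG : G.IsAcyclic) (h : G.Adj u v) : u ∉ side G u v := by
  rw [mem_side]
  intro h'
  exact SimpleGraph.isBridge_iff.1 (SimpleGraph.isAcyclic_iff_forall_adj_isBridge.1 hG h) h'.symm

/-- The only edge that leaves a branch is the one that starts it. -/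
theorem eq_of_leaves_side (hG : G.IsAcyclic) (huv : u = v ∨ G.Adj u v) (hx : x ∈ side G u v)
    (h : G.Adj x y) (hy : y ∉ side G u v) : x = v ∧ y = u := by
  by_cases hne : s(x, y) = s(u, v)
  · rcases Sym2.eq_iff.1 hne with ⟨rfl, rfl⟩ | h'
    · rcases huv with rfl | huv
      · exact absurd self_mem_side hy
      · exact absurd hx (notMem_side hG huv)
    · exact h'
  · exact absurd (mem_side_of_adj hx h hne) hy

/-- Induction along a branch. -/
theorem side_subset {S : Finset V} (hb : b ∈ S)
    (hS : ∀ x ∈ side G a b, x ∈ S → ∀ y ∈ side G a b, G.Adj x y → y ∈ S) : side G a b ⊆ S := by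
  have key : ∀ x y, (G.deleteEdges {s(a, b)}).Walk x y → x ∈ side G a b → x ∈ S → y ∈ S := by
    intro x y p
    induction p with
    | nil => exact fun _ h => h
    | cons h p ih =>
      intro hx hxS
      have hadj := (SimpleGraph.deleteEdges_adj.1 h)
      have hy : _ ∈ side G a b := mem_side.2 ((mem_side.1 hx).trans h.reachable)
      exact ih hy (hS _ hx hxS _ hy hadj.1)
  intro x hx
  obtain ⟨p⟩ := mem_side.1 hx
  exact key b x p self_mem_side hb

theorem side_subset_side (hG : G.IsAcyclic) (huv : u = v ∨ G.Adj u v) (hb : b ∈ side G u v)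
    (hv : v ∉ side G a b) : side G a b ⊆ side G u v := by
  refine side_subset hb fun x hx hxS y _ h => ?_
  by_contra hy
  obtain ⟨rfl, -⟩ := eq_of_leaves_side hG huv hxS h hy
  exact hv hx

theorem child_mem_side (hc : c ∈ children G u v) : c ∈ side G u v := by
  obtain ⟨h, hne⟩ := mem_children.1 hc
  refine mem_side_of_adj self_mem_side h fun h' => ?_
  rcases Sym2.eq_iff.1 h' with ⟨_, rfl⟩ | ⟨_, rfl⟩
  · exact G.loopless.irrefl _ h
  · exact hne rfl

theorem side_child_subset (hG : G.IsAcyclic) (huv : u = v ∨ G.Adj u v)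
    (hc : c ∈ children G u v) : side G v c ⊆ side G u v :=
  side_subset_side hG huv (child_mem_side hc) (notMem_side hG (mem_children.1 hc).1)

/-- A branch consists of its first vertex and the branches of the children. -/
theorem mem_side_iff (hG : G.IsAcyclic) (huv : u = v ∨ G.Adj u v) :
    x ∈ side G u v ↔ x = v ∨ ∃ c ∈ children G u v, x ∈ side G v c := by
  classical
  constructor
  · have : side G u v ⊆ insert v ((children G u v).biUnion fun c => side G v c) := by
      refine side_subset (Finset.mem_insert_self _ _) fun x _ hxS y hy h => ?_
      simp only [Finset.mem_insert, Finset.mem_biUnion] at hxS ⊢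
      rcases hxS with rfl | ⟨c, hc, hxc⟩
      · refine Or.inr ⟨y, mem_children.2 ⟨h, ?_⟩, self_mem_side⟩
        rintro rfl
        rcases huv with rfl | huv
        · exact G.loopless.irrefl _ h
        · exact notMem_side hG huv hy
      · by_cases hyc : y ∈ side G v c
        · exact Or.inr ⟨c, hc, hyc⟩
        · exact Or.inl (eq_of_leaves_side hG (Or.inr (mem_children.1 hc).1) hxc h hyc).2
    intro hx
    simpa using this hx
  · rintro (rfl | ⟨c, hc, hx⟩)
    · exact self_mem_side
    · exact side_child_subset hG huv hc hx

theorem disjoint_sides (hG : G.IsAcyclic) (hc : G.Adj v c) (hc' : G.Adj v c') (hne : c ≠ c') :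
    Disjoint (side G v c) (side G v c') := by
  classical
  have : side G v c ⊆ Finset.univ \ side G v c' := by
    refine side_subset ?_ fun x hx hxS y hy h => ?_
    · simp only [Finset.mem_sdiff, Finset.mem_univ, true_and]
      intro h
      refine notMem_side hG hc' (mem_side_of_adj h hc.symm fun h' => ?_)
      rcases Sym2.eq_iff.1 h' with ⟨rfl, _⟩ | ⟨h1, _⟩
      · exact G.loopless.irrefl _ hc
      · exact hne h1
    · simp only [Finset.mem_sdiff, Finset.mem_univ, true_and] at hxS ⊢
      intro hyS
      obtain ⟨-, rfl⟩ := eq_of_leaves_side hG (Or.inr hc') hyS h.symm hxS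
      exact notMem_side hG hc hx
  rw [Finset.disjoint_left]
  intro x hx hx'
  simpa [hx'] using this hx

/-- The two sides of an edge of a tree are complementary. -/
theorem mem_side_swap (hG : G.IsTree) (h : G.Adj a b) : x ∈ side G b a ↔ x ∉ side G a b := by
  classical
  constructor
  · have : side G b a ⊆ Finset.univ \ side G a b := by
      refine side_subset (by simpa using notMem_side hG.isAcyclic h) fun x hx hxS y hy hxy => ?_
      simp only [Finset.mem_sdiff, Finset.mem_univ, true_and] at hxS ⊢
      intro hyS
      obtain ⟨rfl, rfl⟩ := eq_of_leaves_side hG.isAcyclic (Or.inr h) hyS hxy.symm hxS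
      exact notMem_side hG.isAcyclic h.symm hy
    intro hx
    simpa using this hx
  · intro hx
    by_contra hx'
    obtain ⟨p, hp, q, hq, hpq⟩ := exists_adj_leaving hG.1
      (S := side G a b ∪ side G b a) (x := b) (y := x)
      (by simp [self_mem_side]) (by simp [hx, hx'])
    simp only [Finset.mem_union, not_or] at hp hq
    rcases hp with hp | hp
    · obtain ⟨-, rfl⟩ := eq_of_leaves_side hG.isAcyclic (Or.inr h) hp hpq hq.1
      exact hq.2 self_mem_side
    · obtain ⟨-, rfl⟩ := eq_of_leaves_side hG.isAcyclic (Or.inr h.symm) hp hpq hq.2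
      exact hq.1 self_mem_side

/-- The branches that avoid a given vertex form a laminar family. -/
theorem side_laminar (hG : G.IsTree) (h : G.Adj a b) (h' : G.Adj a' b') (hρ : ρ ∉ side G a b)
    (hρ' : ρ ∉ side G a' b') :
    side G a b ⊆ side G a' b' ∨ side G a' b' ⊆ side G a b ∨
      Disjoint (side G a b) (side G a' b') := by
  classical
  have hA := hG.isAcyclic
  by_cases h1 : b' ∈ side G a b
  · by_cases h2 : b ∈ side G a' b'
    · obtain ⟨p, hp, q, hq, hpq⟩ := exists_adj_leaving hG.1
        (S := side G a b ∪ side G a' b') (x := b) (y := ρ)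
        (by simp [self_mem_side]) (by simp [hρ, hρ'])
      simp only [Finset.mem_union, not_or] at hp hq
      have key : a = a' ∧ b = b' := by
        rcases hp with hp | hp
        · obtain ⟨rfl, rfl⟩ := eq_of_leaves_side hA (Or.inr h) hp hpq hq.1
          obtain ⟨rfl, rfl⟩ := eq_of_leaves_side hA (Or.inr h') h2 hpq hq.2
          exact ⟨rfl, rfl⟩
        · obtain ⟨rfl, rfl⟩ := eq_of_leaves_side hA (Or.inr h') hp hpq hq.2
          obtain ⟨rfl, rfl⟩ := eq_of_leaves_side hA (Or.inr h) h1 hpq hq.1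
          exact ⟨rfl, rfl⟩
      left
      rw [key.1, key.2]
    · exact Or.inr (Or.inl (side_subset_side hA (Or.inr h) h1 h2))
  · by_cases h2 : b ∈ side G a' b'
    · exact Or.inl (side_subset_side hA (Or.inr h') h2 h1)
    · right; right
      have : side G a b ⊆ Finset.univ \ side G a' b' := by
        refine side_subset (by simpa using h2) fun x hx hxS y hy hxy => ?_
        simp only [Finset.mem_sdiff, Finset.mem_univ, true_and] at hxS ⊢
        intro hyS
        obtain ⟨rfl, -⟩ := eq_of_leaves_side hA (Or.inr h') hyS hxy.symm hxS
        exact h1 hy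
      rw [Finset.disjoint_left]
      intro x hx hx'
      simpa [hx'] using this hx

/-- A path of a tree uses exactly the edges that separate its ends. -/
theorem mem_edges_iff_separated (hG : G.IsAcyclic) (h : G.Adj u v) (p : G.Walk x y)
    (hp : p.IsPath) : s(u, v) ∈ p.edges ↔ ¬ (x ∈ side G u v ↔ y ∈ side G u v) := by
  have hstep : ∀ {x y : V}, G.Adj x y → s(x, y) ≠ s(u, v) →
      (x ∈ side G u v ↔ y ∈ side G u v) := fun h hne =>
    ⟨fun hx => mem_side_of_adj hx h hne,
      fun hy => mem_side_of_adj hy h.symm (by rwa [Sym2.eq_swap])⟩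
  induction p with
  | nil => simp
  | @cons x z y hxz p ih =>
    have ht := hp.isTrail
    rw [SimpleGraph.Walk.isTrail_cons] at ht
    have hp' := hp.of_cons
    rw [SimpleGraph.Walk.edges_cons, List.mem_cons]
    have ih := ih hp'
    by_cases he : s(u, v) = s(x, z)
    · have h1 : ¬ (s(u, v) ∈ p.edges) := by rw [he]; exact ht.2
      have h2 : z ∈ side G u v ↔ y ∈ side G u v := by
        by_contra h3
        exact h1 (ih.2 h3)
      have hu := notMem_side hG h
      have hv : v ∈ side G u v := self_mem_side
      rcases Sym2.eq_iff.1 he with ⟨rfl, rfl⟩ | ⟨rfl, rfl⟩ <;> simp_all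
    · rw [hstep hxz (Ne.symm he)]
      simpa [he] using ih

/-- The arcs of a branch are, for every child, the arc to this child and the arcs of its branch. -/
theorem mem_arcs_iff (hG : G.IsAcyclic) (huv : u = v ∨ G.Adj u v) :
    (a, b) ∈ arcs G u v ↔
      ∃ c ∈ children G u v, (a, b) = (v, c) ∨ (a, b) ∈ arcs G v c := by
  rw [mem_arcs]
  constructor
  · rintro ⟨h, ha, hb, hv⟩
    rcases (mem_side_iff hG huv).1 ha with rfl | ⟨c, hc, hac⟩
    · refine ⟨b, mem_children.2 ⟨h, ?_⟩, Or.inl rfl⟩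
      rintro rfl
      rcases huv with rfl | huv
      · exact G.loopless.irrefl _ h
      · exact notMem_side hG huv hb
    · have hvc := (mem_children.1 hc).1
      have hav : a ≠ v := by rintro rfl; exact notMem_side hG hvc hac
      have hbv : b ≠ v := by rintro rfl; exact hv self_mem_side
      refine ⟨c, hc, Or.inr (mem_arcs.2 ⟨h, hac, ?_, ?_⟩)⟩
      · by_contra hbc
        exact hbv (eq_of_leaves_side hG (Or.inr hvc) hac h hbc).2
      · intro hcb
        exact hav (eq_of_leaves_side hG (Or.inr h) hcb hvc.symm hv).2.symm
  · rintro ⟨c, hc, h⟩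
    have hvc := (mem_children.1 hc).1
    rcases h with h | h
    · obtain ⟨rfl, rfl⟩ := Prod.mk.injEq .. ▸ h
      exact ⟨hvc, self_mem_side, child_mem_side hc, notMem_side hG hvc⟩
    · obtain ⟨h, ha, hb, hca⟩ := mem_arcs.1 h
      refine ⟨h, side_child_subset hG huv hc ha, side_child_subset hG huv hc hb, fun hv => ?_⟩
      obtain ⟨rfl, -⟩ := eq_of_leaves_side hG (Or.inr h) hv hvc hca
      exact notMem_side hG hvc hb

theorem side_subset_of_mem_arcs (hG : G.IsAcyclic) (huv : u = v ∨ G.Adj u v)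
    (h : (a, b) ∈ arcs G u v) : side G a b ⊆ side G u v := by
  obtain ⟨_, _, hb, hv⟩ := mem_arcs.1 h
  exact side_subset_side hG huv hb hv

/-- A sum over the edges of a tree, as a sum over the arcs that are directed away from `ρ`. -/
theorem sum_edgeSet_eq_sum_arcs (hG : G.IsTree) (ρ : V) [Fintype G.edgeSet] {M : Type*}
    [AddCommMonoid M] (F : G.edgeSet → M) (F' : V → V → M)
    (hF : ∀ a b (h : G.Adj a b), ρ ∉ side G a b → F ⟨s(a, b), h⟩ = F' a b) :
    ∑ e, F e = ∑ p ∈ arcs G ρ ρ, F' p.1 p.2 := by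
  symm
  refine Finset.sum_bij (fun p hp => ⟨s(p.1, p.2), (mem_arcs.1 hp).1⟩) (fun _ _ => Finset.mem_univ _)
    ?_ ?_ ?_
  · rintro ⟨a, b⟩ h ⟨a', b'⟩ h' he
    obtain ⟨h, -, -, hρ⟩ := mem_arcs.1 h
    obtain ⟨h', -, -, hρ'⟩ := mem_arcs.1 h'
    rcases Sym2.eq_iff.1 (Subtype.ext_iff.1 he) with ⟨h1, h2⟩ | ⟨h1, h2⟩
    · exact Prod.ext h1 h2
    · simp only at h1 h2
      subst h1 h2
      exact absurd ((mem_side_swap hG h).2 hρ) hρ'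
  · rintro ⟨e, he⟩ _
    induction e using Sym2.ind with
    | _ a b =>
      have h : G.Adj a b := he
      by_cases hρ : ρ ∈ side G a b
      · refine ⟨(b, a), mem_arcs.2 ⟨h.symm, ?_, ?_, ?_⟩, Subtype.ext Sym2.eq_swap⟩
        · simp [side_self hG.1]
        · simp [side_self hG.1]
        · rw [mem_side_swap hG h]; simpa using hρ
      · refine ⟨(a, b), mem_arcs.2 ⟨h, ?_, ?_, hρ⟩, rfl⟩
        · simp [side_self hG.1]
        · simp [side_self hG.1]
  · rintro ⟨a, b⟩ hp
    obtain ⟨h, -, -, hρ⟩ := mem_arcs.1 hp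
    exact (hF a b h hρ).symm

end Sides

end VNE

/-! ### Placing a 2-star in a tree -/

namespace VNE

namespace TwoStarVertex

variable {g s : ℕ}

/-- The vertices of a 2-star are the root, the group heads and the leaves. -/
def equivSum (g s : ℕ) : TwoStarVertex g s ≃ Unit ⊕ (Fin g ⊕ Fin g × Fin s) where
  toFun
    | .root => .inl ()
    | .head j => .inr (.inl j)
    | .leaf j i => .inr (.inr (j, i))
  invFun
    | .inl _ => .root
    | .inr (.inl j) => .head j
    | .inr (.inr q) => .leaf q.1 q.2
  left_inv x := by cases x <;> rfl
  right_inv x := by rcases x with x | x | x <;> rfl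

instance : Fintype (TwoStarVertex g s) := Fintype.ofEquiv _ (equivSum g s).symm

instance : DecidableEq (TwoStarVertex g s) := (equivSum g s).decidableEq

theorem sum_eq {M : Type*} [AddCommMonoid M] (F : TwoStarVertex g s → M) :
    ∑ x, F x = F .root + (∑ j, F (.head j) + ∑ q : Fin g × Fin s, F (.leaf q.1 q.2)) := by
  rw [← (equivSum g s).symm.sum_comp, Fintype.sum_sum_type, Fintype.sum_sum_type]
  simp [equivSum]

theorem card_eq : Fintype.card (TwoStarVertex g s) = 1 + (g + g * s) := by
  rw [Fintype.card_congr (equivSum g s)]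
  simp

end TwoStarVertex

open TwoStarVertex

theorem twoStar_adj {g s : ℕ} {x y : TwoStarVertex g s} :
    (twoStar g s).Adj x y ↔ x.IsParent y ∨ y.IsParent x := by
  rw [twoStar, SimpleGraph.fromRel_adj, and_iff_right_iff_imp]
  rintro h rfl
  cases x <;> simp [IsParent] at h

section Placement

variable {V : Type*} {g s : ℕ}

open scoped Classical in
/-- The number of group heads that are placed in `T`. -/
noncomputable def headsIn (ν : TwoStarVertex g s ≃ V) (T : Finset V) : ℕ :=
  ∑ j : Fin g, if ν (.head j) ∈ T then 1 else 0

open scoped Classical in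
/-- The number of leaves that are placed in `T`. -/
noncomputable def leavesIn (ν : TwoStarVertex g s ≃ V) (T : Finset V) : ℕ :=
  ∑ q : Fin g × Fin s, if ν (.leaf q.1 q.2) ∈ T then 1 else 0

open scoped Classical in
/-- The number of leaves that are separated by `T` from their group heads. -/
noncomputable def separated (ν : TwoStarVertex g s ≃ V) (T : Finset V) : ℕ :=
  ∑ q : Fin g × Fin s,
    if (ν (.head q.1) ∈ T ↔ ν (.leaf q.1 q.2) ∈ T) then 0 else 1

variable {ν : TwoStarVertex g s ≃ V} {T : Finset V}

theorem card_eq_headsIn_add_leavesIn (h : ν .root ∉ T) : T.card = headsIn ν T + leavesIn ν T := by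
  classical
  have h1 : T.card = ∑ x : TwoStarVertex g s, if ν x ∈ T then 1 else 0 := by
    rw [← Finset.card_filter, ← Finset.card_map ν.symm.toEmbedding]
    congr 1
    ext x
    simp
  rw [h1, sum_eq]
  simp [headsIn, leavesIn, h]

theorem sum_head_mem [DecidableEq V] :
    (∑ q : Fin g × Fin s, if ν (.head q.1) ∈ T then 1 else 0) = headsIn ν T * s := by
  rw [Fintype.sum_prod_type, headsIn, Finset.sum_mul]
  refine Finset.sum_congr rfl fun j _ => ?_
  split_ifs <;> simp

theorem headsIn_mul_le : headsIn ν T * s ≤ leavesIn ν T + separated ν T := by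
  classical
  rw [← sum_head_mem, leavesIn, separated, ← Finset.sum_add_distrib]
  refine Finset.sum_le_sum fun q _ => ?_
  split_ifs <;> first | omega | tauto

theorem leavesIn_le : leavesIn ν T ≤ headsIn ν T * s + separated ν T := by
  classical
  rw [← sum_head_mem, leavesIn, separated, ← Finset.sum_add_distrib]
  refine Finset.sum_le_sum fun q _ => ?_
  split_ifs <;> first | omega | tauto

/-- The load that the edge to a branch has to carry at least, if the branch has `m` vertices, `h`
of them group heads: all the demand `D` of the group heads, and the demand of the leaves that are
missing in the branch or exceed the need of its group heads. -/
def minLoad (D s m h : ℕ) : ℕ := D * h + ((h * (s + 1) - m) + (m - h * (s + 1)))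

theorem minLoad_le (D : ℕ) (h : ν .root ∉ T) :
    minLoad D s T.card (headsIn ν T) ≤ D * headsIn ν T + separated ν T := by
  have h1 := card_eq_headsIn_add_leavesIn h
  have h2 := headsIn_mul_le (ν := ν) (T := T)
  have h3 := leavesIn_le (ν := ν) (T := T)
  rw [minLoad, mul_add]
  omega

/-- If all connections between groups and leaves cross the boundary of `T` in the same direction,
then there are no more of them than necessary. -/
theorem minLoad_eq (D : ℕ) (h : ν .root ∉ T)
    (hT : ¬ ∃ q q' : Fin g × Fin s, ν (.head q.1) ∈ T ∧ ν (.leaf q.1 q.2) ∉ T ∧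
      ν (.head q'.1) ∉ T ∧ ν (.leaf q'.1 q'.2) ∈ T) :
    minLoad D s T.card (headsIn ν T) = D * headsIn ν T + separated ν T := by
  classical
  have h1 := card_eq_headsIn_add_leavesIn h
  have h2 := headsIn_mul_le (ν := ν) (T := T)
  have h3 := leavesIn_le (ν := ν) (T := T)
  have h4 : leavesIn ν T + separated ν T ≤ headsIn ν T * s ∨
      headsIn ν T * s + separated ν T ≤ leavesIn ν T := by
    by_cases hq : ∃ q : Fin g × Fin s, ν (.head q.1) ∈ T ∧ ν (.leaf q.1 q.2) ∉ T
    · left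
      obtain ⟨q, hq1, hq2⟩ := hq
      rw [← sum_head_mem, leavesIn, separated, ← Finset.sum_add_distrib]
      refine Finset.sum_le_sum fun q' _ => ?_
      have := fun a b => hT ⟨q, q', hq1, hq2, a, b⟩
      split_ifs <;> first | omega | tauto
    · right
      rw [← sum_head_mem, leavesIn, separated, ← Finset.sum_add_distrib]
      refine Finset.sum_le_sum fun q' _ => ?_
      have := fun a b => hq ⟨q', a, b⟩
      split_ifs <;> first | omega | tauto
  rw [minLoad, mul_add]
  omega

theorem card_inter_eq_headsIn [DecidableEq V] {H : Finset V} (hH : ∀ j, ν (.head j) ∈ H)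
    (hg : H.card = g) : (H ∩ T).card = headsIn ν T := by
  classical
  let i : Fin g ↪ V := ⟨fun j => ν (.head j), fun j j' h => by simpa using ν.injective h⟩
  have h1 : Finset.univ.map i = H := by
    refine Finset.eq_of_subset_of_card_le ?_ (by simp [hg])
    intro x hx
    obtain ⟨j, -, rfl⟩ := Finset.mem_map.1 hx
    exact hH j
  rw [← h1, ← Finset.filter_mem_eq_inter, Finset.filter_map, Finset.card_map, headsIn,
    Finset.card_filter]
  refine Finset.sum_congr rfl fun j _ => ?_
  by_cases hj : ν (.head j) ∈ T
  · rw [if_pos hj]; exact if_pos hj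
  · rw [if_neg hj]; exact if_neg hj

theorem exists_placement [Fintype V] (hV : Fintype.card V = 1 + (g + g * s)) {ρ : V} {H : Finset V}
    (hρ : ρ ∉ H) (hg : H.card = g) :
    ∃ ν : TwoStarVertex g s ≃ V, ν .root = ρ ∧ ∀ j, ν (.head j) ∈ H := by
  classical
  let eH : Fin g ≃ H := (Fintype.equivFinOfCardEq (by simpa using hg)).symm
  let R : Finset V := Finset.univ \ insert ρ H
  have hR : R.card = g * s := by
    rw [Finset.card_sdiff_of_subset (Finset.subset_univ _), Finset.card_insert_of_notMem hρ, hg,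
      Finset.card_univ, hV]
    omega
  let eR : Fin g × Fin s ≃ R := Fintype.equivOfCardEq (by simp [hR])
  have hRρ : ∀ q, (eR q : V) ≠ ρ ∧ (eR q : V) ∉ H := by
    intro q
    have := (eR q).2
    simp only [R, Finset.mem_sdiff, Finset.mem_insert, not_or] at this
    exact this.2
  let F : TwoStarVertex g s → V
    | .root => ρ
    | .head j => eH j
    | .leaf j i => eR (j, i)
  have hF : Function.Injective F := by
    intro x y h
    cases x with
    | root => cases y with
      | root => rfl
      | head j =>
        have h : ρ = eH j := h
        exact absurd (h ▸ (eH j).2 : ρ ∈ H) hρ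
      | leaf j i => exact absurd h.symm (hRρ _).1
    | head j => cases y with
      | root =>
        have h : (eH j : V) = ρ := h
        exact absurd (h ▸ (eH j).2 : ρ ∈ H) hρ
      | head j' => exact congrArg _ (eH.injective (Subtype.ext h))
      | leaf j' i =>
        have h : (eH j : V) = eR (j', i) := h
        exact absurd (h ▸ (eH j).2 : (eR (j', i) : V) ∈ H) (hRρ _).2
    | leaf j i => cases y with
      | root => exact absurd h (hRρ _).1
      | head j' =>
        have h : (eR (j, i) : V) = eH j' := h
        exact absurd (h ▸ (eH j').2 : (eR (j, i) : V) ∈ H) (hRρ _).2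
      | leaf j' i' =>
        have := eR.injective (Subtype.ext h)
        simp only [Prod.mk.injEq] at this
        rw [this.1, this.2]
  refine ⟨Equiv.ofBijective F ((Fintype.bijective_iff_injective_and_card F).2
    ⟨hF, by rw [card_eq, hV]⟩), rfl, fun j => (eH j).2⟩

theorem sum_le_sum_of_pair {ι : Type*} [Fintype ι] [DecidableEq ι] {f f' : ι → ℕ} {q q' : ι}
    (hne : q ≠ q') (h : ∀ r, r ≠ q → r ≠ q' → f' r = f r) {d : ℕ}
    (hle : f' q + f' q' + d ≤ f q + f q') : ∑ r, f' r + d ≤ ∑ r, f r := by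
  have key : ∀ f : ι → ℕ, ∑ r, f r = f q + (f q' + ∑ r ∈ (Finset.univ.erase q).erase q', f r) := by
    intro f
    rw [Finset.add_sum_erase _ _ (by simp [hne.symm]), Finset.add_sum_erase _ _ (by simp)]
  have h' : ∑ r ∈ (Finset.univ.erase q).erase q', f' r =
      ∑ r ∈ (Finset.univ.erase q).erase q', f r := Finset.sum_congr rfl fun r hr =>
    h r (Finset.ne_of_mem_erase (Finset.mem_of_mem_erase hr)) (Finset.ne_of_mem_erase hr)
  rw [key f, key f', h']
  omega

/-- Exchanging two leaves whose connections cross the boundary of `T` in opposite directions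
shortens both connections: no set that is comparable to `T` or disjoint from `T` separates more
leaves from their heads than before, and `T` itself separates fewer. -/
theorem separated_swap [DecidableEq V] {T' : Finset V} {q q' : Fin g × Fin s}
    (h1 : ν (.head q.1) ∈ T) (h2 : ν (.leaf q.1 q.2) ∉ T) (h3 : ν (.head q'.1) ∉ T)
    (h4 : ν (.leaf q'.1 q'.2) ∈ T) :
    separated ((Equiv.swap (.leaf q.1 q.2) (.leaf q'.1 q'.2)).trans ν) T + 1 ≤ separated ν T ∧
      (T ⊆ T' ∨ T' ⊆ T ∨ Disjoint T T' →
        separated ((Equiv.swap (.leaf q.1 q.2) (.leaf q'.1 q'.2)).trans ν) T' ≤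
          separated ν T') := by
  classical
  have hne : q ≠ q' := by rintro rfl; exact h3 h1
  set ν' := (Equiv.swap (.leaf q.1 q.2) (.leaf q'.1 q'.2)).trans ν with hν'
  have e1 : ∀ j, ν' (.head j) = ν (.head j) := by
    intro j
    simp only [hν', Equiv.trans_apply]
    rw [Equiv.swap_apply_of_ne_of_ne] <;> simp
  have e2 : ν' (.leaf q.1 q.2) = ν (.leaf q'.1 q'.2) := by simp [hν']
  have e3 : ν' (.leaf q'.1 q'.2) = ν (.leaf q.1 q.2) := by simp [hν']
  have e4 : ∀ r : Fin g × Fin s, r ≠ q → r ≠ q' → ν' (.leaf r.1 r.2) = ν (.leaf r.1 r.2) := by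
    intro r hr hr'
    simp only [hν', Equiv.trans_apply]
    rw [Equiv.swap_apply_of_ne_of_ne]
    · intro h
      simp only [TwoStarVertex.leaf.injEq] at h
      exact hr (Prod.ext h.1 h.2)
    · intro h
      simp only [TwoStarVertex.leaf.injEq] at h
      exact hr' (Prod.ext h.1 h.2)
  constructor
  · refine sum_le_sum_of_pair hne (fun r hr hr' => by rw [e1, e4 r hr hr']) ?_
    simp [e1, e2, e3, h1, h2, h3, h4]
  · intro hT
    refine sum_le_sum_of_pair (d := 0) hne (fun r hr hr' => by rw [e1, e4 r hr hr']) ?_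
    simp only [e1, e2, e3]
    have a1 : T ⊆ T' ∨ T' ⊆ T ∨ Disjoint T T' →
      ((ν (.head q.1) ∈ T' ∧ ν (.leaf q'.1 q'.2) ∈ T') ∨
      (ν (.leaf q.1 q.2) ∉ T' ∧ ν (.head q'.1) ∉ T') ∨
      (ν (.head q.1) ∉ T' ∧ ν (.leaf q'.1 q'.2) ∉ T')) := by
      rintro (h | h | h)
      · exact Or.inl ⟨h h1, h h4⟩
      · exact Or.inr (Or.inl ⟨fun h' => h2 (h h'), fun h' => h3 (h h')⟩)
      · exact Or.inr (Or.inr ⟨Finset.disjoint_left.1 h h1, Finset.disjoint_left.1 h h4⟩)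
    rcases a1 hT with ⟨x, y⟩ | ⟨x, y⟩ | ⟨x, y⟩
    · by_cases z : ν (.leaf q.1 q.2) ∈ T' <;> by_cases w : ν (.head q'.1) ∈ T' <;>
        simp [x, y, z, w]
    · by_cases z : ν (.head q.1) ∈ T' <;> by_cases w : ν (.leaf q'.1 q'.2) ∈ T' <;>
        simp [x, y, z, w]
    · by_cases z : ν (.leaf q.1 q.2) ∈ T' <;> by_cases w : ν (.head q'.1) ∈ T' <;>
        simp [x, y, z, w]

/-- For given places of the root and of the group heads, the leaves can be distributed among the
groups such that all edges have the least possible load at the same time. -/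
theorem exists_optimal_placement [Fintype V] [DecidableEq V] {G : SimpleGraph V} (hG : G.IsTree)
    (hV : Fintype.card V = 1 + (g + g * s)) {ρ : V} {H : Finset V} (hρ : ρ ∉ H) (hg : H.card = g)
    (D : ℕ) :
    ∃ ν : TwoStarVertex g s ≃ V, ν .root = ρ ∧ (∀ j, ν (.head j) ∈ H) ∧
      ∀ a b, (a, b) ∈ arcs G ρ ρ →
        D * headsIn ν (side G a b) + separated ν (side G a b) =
          minLoad D s (side G a b).card (H ∩ side G a b).card := by
  obtain ⟨ν₀, h₀⟩ := exists_placement hV hρ hg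
  -- a placement for which the number of separated leaves, summed over all branches, is minimal
  obtain ⟨ν, ⟨hν1, hν2⟩, hmin⟩ := (measure fun ν : TwoStarVertex g s ≃ V =>
    ∑ p ∈ arcs G ρ ρ, separated ν (side G p.1 p.2)).wf.has_min
    {ν | ν .root = ρ ∧ ∀ j, ν (.head j) ∈ H} ⟨ν₀, h₀⟩
  refine ⟨ν, hν1, hν2, fun a b hab => ?_⟩
  obtain ⟨h, -, -, hab'⟩ := mem_arcs.1 hab
  rw [card_inter_eq_headsIn hν2 hg]
  refine (minLoad_eq D (by rwa [hν1]) ?_).symm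
  rintro ⟨q, q', h1, h2, h3, h4⟩
  -- otherwise exchanging two leaves would lower this number
  refine hmin ((Equiv.swap (.leaf q.1 q.2) (.leaf q'.1 q'.2)).trans ν) ⟨?_, fun j => ?_⟩ ?_
  · rw [Equiv.trans_apply, Equiv.swap_apply_of_ne_of_ne (by simp) (by simp), hν1]
  · rw [Equiv.trans_apply, Equiv.swap_apply_of_ne_of_ne (by simp) (by simp)]
    exact hν2 j
  · change ∑ p ∈ arcs G ρ ρ, separated
      ((Equiv.swap (.leaf q.1 q.2) (.leaf q'.1 q'.2)).trans ν) (side G p.1 p.2) <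
      ∑ p ∈ arcs G ρ ρ, separated ν (side G p.1 p.2)
    refine Finset.sum_lt_sum ?_ ⟨(a, b), hab, (separated_swap (T' := ∅) h1 h2 h3 h4).1⟩
    rintro ⟨a', b'⟩ hp
    obtain ⟨h', -, -, hp'⟩ := mem_arcs.1 hp
    exact (separated_swap h1 h2 h3 h4).2 (side_laminar hG h h' hab' hp')

end Placement

end VNE

/-! ### Costs and loads of embeddings of a 2-star in a tree -/

namespace VNE

open TwoStarVertex

open scoped Classical in
/-- The capacity of the edge between `a` and `b`, and `0` if there is no such edge. -/
noncomputable def PhysicalNetwork.capAt {V : Type*} (G : PhysicalNetwork V) (a b : V) : ℕ :=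
  if h : G.graph.Adj a b then G.capacity ⟨s(a, b), h⟩ else 0

open scoped Classical in
/-- The cost of the edge between `a` and `b`, and `0` if there is no such edge. -/
noncomputable def PhysicalNetwork.costAt {V : Type*} (G : PhysicalNetwork V) (a b : V) : ℚ≥0 :=
  if h : G.graph.Adj a b then G.cost ⟨s(a, b), h⟩ else 0

section TwoStarInTree

variable {V : Type*} {S : VirtualNetwork V} {G : PhysicalNetwork V} {g s D : ℕ} {a b : V}

/-- A virtual network that is a 2-star, by the isomorphism `φ`, with demand `D` on the edges at the
root and demand `1` on the edges at the leaves. -/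
structure VirtualNetwork.IsTwoStarVia (S : VirtualNetwork V) (φ : twoStar g s ≃g S.graph)
    (D : ℕ) : Prop where
  demand_head : ∀ (j : Fin g) (e : S.graph.edgeSet),
    (e : Sym2 V) = s(φ .root, φ (.head j)) → S.demand e = D
  demand_leaf : ∀ (j : Fin g) (i : Fin s) (e : S.graph.edgeSet),
    (e : Sym2 V) = s(φ (.head j), φ (.leaf j i)) → S.demand e = 1

theorem sum_virtualEdges (φ : twoStar g s ≃g S.graph) [Fintype S.graph.edgeSet] {M : Type*}
    [AddCommMonoid M] (F : S.graph.edgeSet → M) :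
    ∑ e, F e =
      ∑ j : Fin g, F ⟨s(φ .root, φ (.head j)), φ.map_adj_iff.2 (twoStar_adj.2 (.inl trivial))⟩ +
      ∑ q : Fin g × Fin s, F ⟨s(φ (.head q.1), φ (.leaf q.1 q.2)),
        φ.map_adj_iff.2 (twoStar_adj.2 (.inl rfl))⟩ := by
  let k : Fin g ⊕ Fin g × Fin s → S.graph.edgeSet := Sum.elim
    (fun j => ⟨s(φ .root, φ (.head j)), φ.map_adj_iff.2 (twoStar_adj.2 (.inl trivial))⟩)
    (fun q => ⟨s(φ (.head q.1), φ (.leaf q.1 q.2)), φ.map_adj_iff.2 (twoStar_adj.2 (.inl rfl))⟩)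
  have hk : Function.Bijective k := by
    constructor
    · rintro (j | q) (j' | q') h
      all_goals
        have h := Subtype.ext_iff.1 h
        simp only [k, Sum.elim_inl, Sum.elim_inr, Sym2.eq_iff, φ.injective.eq_iff] at h
        simp only [reduceCtorEq, TwoStarVertex.head.injEq, TwoStarVertex.leaf.injEq, true_and,
          false_and, and_false, or_false, and_self] at h
      · rw [h]
      · rw [Prod.ext h.2.1 h.2.2]
    · rintro ⟨e, he⟩
      induction e using Sym2.ind with
      | _ u v =>
        obtain ⟨x, rfl⟩ := φ.surjective u
        obtain ⟨y, rfl⟩ := φ.surjective v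
        have h : (twoStar g s).Adj x y := φ.map_adj_iff.1 he
        rw [twoStar_adj] at h
        cases x <;> cases y <;> simp only [IsParent, or_self, or_false, false_or] at h
        · exact ⟨.inl _, rfl⟩
        · exact ⟨.inl _, Subtype.ext Sym2.eq_swap⟩
        · subst h; exact ⟨.inr (_, _), rfl⟩
        · subst h; exact ⟨.inr (_, _), Subtype.ext Sym2.eq_swap⟩
  rw [← Fintype.sum_bijective k hk _ F fun _ => rfl, Fintype.sum_sum_type]
  rfl

/-- In a tree, a bijection of the vertices extends to an embedding. -/
theorem exists_embedding (hG : G.IsTree) (node : V ≃ V) :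
    ∃ f : Embedding S.graph G.graph, f.node = node := by
  have h : ∀ e : S.graph.edgeSet, ∃ P : PathIn G.graph,
      s(P.source, P.target) = Sym2.map node (e : Sym2 V) := by
    rintro ⟨e, he⟩
    induction e using Sym2.ind with
    | _ i j =>
      obtain ⟨p, hp, -⟩ := SimpleGraph.IsTree.existsUnique_path hG (node i) (node j)
      exact ⟨⟨node i, node j, ⟨p, hp⟩⟩, rfl⟩
  choose r hr using h
  exact ⟨⟨node, r, hr⟩, rfl⟩

variable [Fintype V]

theorem uses_iff (hG : G.IsTree) (f : Embedding S.graph G.graph) (x : S.graph.edgeSet) {i j : V}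
    (hx : (x : Sym2 V) = s(i, j)) (h : G.graph.Adj a b) :
    (f.route x).Uses ⟨s(a, b), h⟩ ↔
      ¬ (f.node i ∈ side G.graph a b ↔ f.node j ∈ side G.graph a b) := by
  have he := f.route_ends x
  rw [hx, Sym2.map_mk] at he
  rw [PathIn.Uses, mem_edges_iff_separated (SimpleGraph.IsTree.isAcyclic hG) h _ (f.route x).path.2]
  rcases Sym2.eq_iff.1 he with ⟨h1, h2⟩ | ⟨h1, h2⟩
  · rw [h1, h2]
  · rw [h1, h2]; tauto

open scoped Classical in
/-- The load of an edge: the demand of the group heads in the branch that starts with it, and one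
unit for each leaf that the edge separates from its head. -/
theorem load_eq (hG : G.IsTree) {φ : twoStar g s ≃g S.graph} (hφ : S.IsTwoStarVia φ D)
    (f : Embedding S.graph G.graph) (h : G.graph.Adj a b)
    (hρ : f.node (φ .root) ∉ side G.graph a b) [Fintype S.graph.edgeSet] :
    ∑ x : S.graph.edgeSet with (f.route x).Uses ⟨s(a, b), h⟩, S.demand x =
      D * headsIn (φ.toEquiv.trans f.node) (side G.graph a b) +
        separated (φ.toEquiv.trans f.node) (side G.graph a b) := by
  rw [Finset.sum_filter, sum_virtualEdges φ, headsIn, separated, Finset.mul_sum]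
  congr 1
  · refine Finset.sum_congr rfl fun j _ => ?_
    have h1 := uses_iff hG f ⟨s(φ .root, φ (.head j)),
      φ.map_adj_iff.2 (twoStar_adj.2 (.inl trivial))⟩ rfl h
    simp only [hρ, false_iff, not_not] at h1
    rw [hφ.demand_head j _ rfl]
    by_cases hj : f.node (φ (.head j)) ∈ side G.graph a b
    · rw [if_pos (h1.2 hj)]
      exact ((congrArg (D * ·) (if_pos hj)).trans (mul_one D)).symm
    · rw [if_neg (fun h' => hj (h1.1 h'))]
      exact ((congrArg (D * ·) (if_neg hj)).trans (mul_zero D)).symm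
  · refine Finset.sum_congr rfl fun q _ => ?_
    have h1 := uses_iff hG f ⟨s(φ (.head q.1), φ (.leaf q.1 q.2)),
      φ.map_adj_iff.2 (twoStar_adj.2 (.inl rfl))⟩ rfl h
    rw [hφ.demand_leaf q.1 q.2 _ rfl]
    by_cases hj : f.node (φ (.head q.1)) ∈ side G.graph a b ↔
        f.node (φ (.leaf q.1 q.2)) ∈ side G.graph a b
    · rw [if_neg (fun h' => h1.1 h' hj)]
      exact (if_pos hj).symm
    · rw [if_pos (h1.2 hj)]
      exact (if_neg hj).symm

/-- The cost of an embedding, edge by edge of the physical network. -/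
theorem embeddingCost_eq (hG : G.IsTree) {φ : twoStar g s ≃g S.graph} (hφ : S.IsTwoStarVia φ D)
    (f : Embedding S.graph G.graph) :
    embeddingCost S G f = ∑ p ∈ arcs G.graph (f.node (φ .root)) (f.node (φ .root)),
      G.costAt p.1 p.2 *
        ((D * headsIn (φ.toEquiv.trans f.node) (side G.graph p.1 p.2) +
          separated (φ.toEquiv.trans f.node) (side G.graph p.1 p.2) : ℕ) : ℚ≥0) := by
  classical
  have h1 : embeddingCost S G f = ∑ e : G.graph.edgeSet,
      G.cost e * ((∑ x : S.graph.edgeSet with (f.route x).Uses e, S.demand x : ℕ) : ℚ≥0) := by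
    simp only [embeddingCost, PhysicalNetwork.length, Finset.sum_filter, Finset.mul_sum,
      Nat.cast_sum]
    rw [Finset.sum_comm]
    refine Finset.sum_congr rfl fun e _ => Finset.sum_congr rfl fun x _ => ?_
    split_ifs <;> simp [mul_comm]
  rw [h1]
  refine sum_edgeSet_eq_sum_arcs hG _ _ (fun a b => G.costAt a b *
    ((D * headsIn (φ.toEquiv.trans f.node) (side G.graph a b) +
          separated (φ.toEquiv.trans f.node) (side G.graph a b) : ℕ) : ℚ≥0)) fun a b h hρ => ?_
  rw [← load_eq hG hφ f h hρ, PhysicalNetwork.costAt, dif_pos h]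

theorem respectsCapacities_iff (hG : G.IsTree) {φ : twoStar g s ≃g S.graph}
    (hφ : S.IsTwoStarVia φ D) (f : Embedding S.graph G.graph) :
    RespectsCapacities S G f ↔
      ∀ a b, (a, b) ∈ arcs G.graph (f.node (φ .root)) (f.node (φ .root)) →
        D * headsIn (φ.toEquiv.trans f.node) (side G.graph a b) +
          separated (φ.toEquiv.trans f.node) (side G.graph a b) ≤ G.capAt a b := by
  classical
  constructor
  · intro hf a b hab
    obtain ⟨h, -, -, hρ⟩ := mem_arcs.1 hab
    rw [← load_eq hG hφ f h hρ, PhysicalNetwork.capAt, dif_pos h]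
    exact hf _
  · rintro hf ⟨e, he⟩
    induction e using Sym2.ind with
    | _ a b =>
      have h : G.graph.Adj a b := he
      by_cases hρ : f.node (φ .root) ∈ side G.graph a b
      · have hρ' : f.node (φ .root) ∉ side G.graph b a := by
          rw [mem_side_swap hG h]; simpa using hρ
        have h' := hf b a (mem_arcs.2 ⟨h.symm, by simp [side_self (SimpleGraph.IsTree.connected hG)],
          by simp [side_self (SimpleGraph.IsTree.connected hG)], hρ'⟩)
        rw [← load_eq hG hφ f h.symm hρ', PhysicalNetwork.capAt, dif_pos h.symm] at h'
        have e : (⟨s(a, b), he⟩ : G.graph.edgeSet) = ⟨s(b, a), h.symm⟩ := Subtype.ext Sym2.eq_swap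
        rw [e]
        exact h'
      · have h' := hf a b (mem_arcs.2 ⟨h, by simp [side_self (SimpleGraph.IsTree.connected hG)],
          by simp [side_self (SimpleGraph.IsTree.connected hG)], hρ⟩)
        rw [← load_eq hG hφ f h hρ, PhysicalNetwork.capAt, dif_pos h] at h'
        exact h'

/-- The least possible load of the edge from `a` to `b` for group heads at the places in `H`. -/
noncomputable def arcLoad [DecidableEq V] (G : PhysicalNetwork V) (D s : ℕ) (H : Finset V)
    (a b : V) : ℕ :=
  minLoad D s (side G.graph a b).card (H ∩ side G.graph a b).card

/-- An embedding cannot be better than the least loads for its places of the root and of the group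
heads. -/
theorem exists_arcLoad_le [DecidableEq V] (hG : G.IsTree) {φ : twoStar g s ≃g S.graph}
    (hφ : S.IsTwoStarVia φ D) (f : Embedding S.graph G.graph) (hf : RespectsCapacities S G f) :
    ∃ (ρ : V) (H : Finset V), ρ ∉ H ∧ H.card = g ∧
      (∀ a b, (a, b) ∈ arcs G.graph ρ ρ → arcLoad G D s H a b ≤ G.capAt a b) ∧
      ∑ p ∈ arcs G.graph ρ ρ, G.costAt p.1 p.2 * (arcLoad G D s H p.1 p.2 : ℚ≥0) ≤
        embeddingCost S G f := by
  set ν := φ.toEquiv.trans f.node with hν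
  let i : Fin g ↪ V := ⟨fun j => ν (.head j), fun j j' h => by simpa using ν.injective h⟩
  have hle : ∀ a b, (a, b) ∈ arcs G.graph (ν .root) (ν .root) →
      arcLoad G D s (Finset.univ.map i) a b ≤
        D * headsIn ν (side G.graph a b) + separated ν (side G.graph a b) := by
    intro a b hab
    rw [arcLoad, card_inter_eq_headsIn (ν := ν) (fun j => Finset.mem_map.2 ⟨j, by simp, rfl⟩)
      (by simp)]
    exact minLoad_le D (mem_arcs.1 hab).2.2.2
  refine ⟨ν .root, Finset.univ.map i, ?_, by simp, fun a b hab => ?_, ?_⟩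
  · intro h
    obtain ⟨j, -, hj⟩ := Finset.mem_map.1 h
    have hj : ν (.head j) = ν .root := hj
    simpa using ν.injective hj
  · exact (hle a b hab).trans ((respectsCapacities_iff hG hφ f).1 hf a b hab)
  · rw [embeddingCost_eq hG hφ]
    refine Finset.sum_le_sum fun p hp => ?_
    have := hle p.1 p.2 hp
    gcongr

/-- The least loads are attained by an embedding. -/
theorem exists_embedding_arcLoad [DecidableEq V] (hG : G.IsTree) {φ : twoStar g s ≃g S.graph}
    (hφ : S.IsTwoStarVia φ D) {ρ : V} {H : Finset V} (hρ : ρ ∉ H) (hg : H.card = g)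
    (hcap : ∀ a b, (a, b) ∈ arcs G.graph ρ ρ → arcLoad G D s H a b ≤ G.capAt a b) :
    ∃ f : Embedding S.graph G.graph, RespectsCapacities S G f ∧
      embeddingCost S G f =
        ∑ p ∈ arcs G.graph ρ ρ, G.costAt p.1 p.2 * (arcLoad G D s H p.1 p.2 : ℚ≥0) := by
  have hV : Fintype.card V = 1 + (g + g * s) := by
    rw [← Fintype.card_congr φ.toEquiv, card_eq]
  obtain ⟨ν, hν, -, hload⟩ := exists_optimal_placement (G := G.graph) hG hV hρ hg D
  obtain ⟨f, hf⟩ := exists_embedding (S := S) hG (φ.toEquiv.symm.trans ν)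
  have hfν : φ.toEquiv.trans f.node = ν := by
    ext x
    simp only [hf, Equiv.trans_apply]
    exact congrArg ν (φ.symm_apply_apply x)
  have hroot : f.node (φ .root) = ρ := by
    rw [← hν, ← hfν]; rfl
  refine ⟨f, (respectsCapacities_iff hG hφ f).2 fun a b hab => ?_, ?_⟩
  · rw [hroot] at hab
    rw [hfν, hload a b hab]
    exact hcap a b hab
  · rw [embeddingCost_eq hG hφ, hroot, hfν]
    refine Finset.sum_congr rfl fun p hp => ?_
    rw [hload p.1 p.2 hp, arcLoad]

end TwoStarInTree

end VNE

/-! ### The recursion over the branches of a tree -/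

namespace VNE

/-- The number `x` is the smaller one of `B` and the least `y` with `P y`. -/
structure MinVal (B : ℕ) (P : ℕ → Prop) (x : ℕ) : Prop where
  le_bound : x ≤ B
  le_of : ∀ y, P y → x ≤ y
  attained : x < B → P x

theorem MinVal.congr {B x : ℕ} {P R : ℕ → Prop} (h : MinVal B P x) (hPR : ∀ y, P y ↔ R y) :
    MinVal B R x :=
  ⟨h.1, fun y hy => h.2 y ((hPR y).2 hy), fun hx => (hPR x).1 (h.3 hx)⟩

/-- Minima of sums with two independent summands, for every split `i` of a resource. -/
theorem MinVal.conv {B q h : ℕ} {P R : ℕ → ℕ → Prop} {x z w : ℕ → ℕ}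
    (hx : ∀ i ≤ h, MinVal B (P i) (x i)) (hz : ∀ i ≤ h, MinVal B (R i) (z i))
    (hq : MinVal B (fun y => ∃ i ≤ h, y = x i + w i + z i) q) :
    MinVal B (fun y => ∃ i ≤ h, ∃ a b, P i a ∧ R i b ∧ y = a + w i + b) q := by
  refine ⟨hq.1, ?_, fun hB => ?_⟩
  · rintro y ⟨i, hi, a, b, ha, hb, rfl⟩
    have h1 := hq.2 _ ⟨i, hi, rfl⟩
    have h2 := (hx i hi).2 a ha
    have h3 := (hz i hi).2 b hb
    omega
  · obtain ⟨i, hi, hqi⟩ := hq.3 hB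
    exact ⟨i, hi, x i, z i, (hx i hi).3 (by omega), (hz i hi).3 (by omega), hqi⟩

section Recursion

variable {n : ℕ} {G : SimpleGraph (Fin n)} {u v c x : Fin n} {j h k : ℕ} {w : Fin n → Fin n → ℕ → ℕ}

open scoped Classical in
/-- The vertex `v` with the branches of its children (in the branch `side G u v`) of number less
than `j`. -/
noncomputable def branchUpTo (G : SimpleGraph (Fin n)) (u v : Fin n) (j : ℕ) : Finset (Fin n) :=
  Finset.univ.filter fun x => x = v ∨ ∃ c ∈ children G u v, (c : ℕ) < j ∧ x ∈ side G v c

open scoped Classical in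
/-- The arcs of `branchUpTo G u v j`. -/
noncomputable def arcsUpTo (G : SimpleGraph (Fin n)) (u v : Fin n) (j : ℕ) :
    Finset (Fin n × Fin n) :=
  Finset.univ.filter fun p =>
    ∃ c ∈ children G u v, (c : ℕ) < j ∧ (p = (v, c) ∨ p ∈ arcs G v c)

/-- The total weight of the arcs in `A` when the group heads are at the places in `H`; the weight of
an arc depends on the number of group heads in its branch. -/
noncomputable def totalWeight (G : SimpleGraph (Fin n)) (w : Fin n → Fin n → ℕ → ℕ)
    (A : Finset (Fin n × Fin n)) (H : Finset (Fin n)) : ℕ :=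
  ∑ p ∈ A, w p.1 p.2 (H ∩ side G p.1 p.2).card

/-- `y` is the total weight for some choice of `h` group heads in `branchUpTo G u v j`. The case
`u = v` is that of the root of the tree, which is no group head. -/
def IsWeight (G : SimpleGraph (Fin n)) (w : Fin n → Fin n → ℕ → ℕ) (u v : Fin n) (j h y : ℕ) :
    Prop :=
  ∃ H ⊆ branchUpTo G u v j, H.card = h ∧ (u = v → v ∉ H) ∧
    y = totalWeight G w (arcsUpTo G u v j) H

theorem mem_branchUpTo : x ∈ branchUpTo G u v j ↔
    x = v ∨ ∃ c ∈ children G u v, (c : ℕ) < j ∧ x ∈ side G v c := by simp [branchUpTo]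

theorem mem_arcsUpTo {p : Fin n × Fin n} : p ∈ arcsUpTo G u v j ↔
    ∃ c ∈ children G u v, (c : ℕ) < j ∧ (p = (v, c) ∨ p ∈ arcs G v c) := by simp [arcsUpTo]

theorem branchUpTo_zero : branchUpTo G u v 0 = {v} := by
  ext x; simp [mem_branchUpTo]

theorem arcsUpTo_zero : arcsUpTo G u v 0 = ∅ := by
  ext x; simp [mem_arcsUpTo]

theorem branchUpTo_self (hG : G.IsAcyclic) (huv : u = v ∨ G.Adj u v) :
    branchUpTo G u v n = side G u v := by
  ext x
  rw [mem_branchUpTo, mem_side_iff hG huv]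
  simp

theorem arcsUpTo_self (hG : G.IsAcyclic) (huv : u = v ∨ G.Adj u v) :
    arcsUpTo G u v n = arcs G u v := by
  ext ⟨a, b⟩
  rw [mem_arcsUpTo, mem_arcs_iff hG huv]
  simp

theorem branchUpTo_succ_of_notMem (hc : c ∉ children G u v) :
    branchUpTo G u v (c + 1) = branchUpTo G u v c := by
  ext x
  simp only [mem_branchUpTo]
  refine or_congr Iff.rfl (exists_congr fun c' => and_congr_right fun hc' => ?_)
  have : (c' : ℕ) ≠ c := fun h => hc (Fin.ext h ▸ hc')
  have : (c' : ℕ) < c + 1 ↔ (c' : ℕ) < c := by omega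
  rw [this]

theorem arcsUpTo_succ_of_notMem (hc : c ∉ children G u v) :
    arcsUpTo G u v (c + 1) = arcsUpTo G u v c := by
  ext x
  simp only [mem_arcsUpTo]
  refine exists_congr fun c' => and_congr_right fun hc' => ?_
  have : (c' : ℕ) ≠ c := fun h => hc (Fin.ext h ▸ hc')
  have : (c' : ℕ) < c + 1 ↔ (c' : ℕ) < c := by omega
  rw [this]

theorem branchUpTo_succ (hc : c ∈ children G u v) :
    branchUpTo G u v (c + 1) = branchUpTo G u v c ∪ side G v c := by
  ext x
  simp only [Finset.mem_union, mem_branchUpTo]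
  constructor
  · rintro (h | ⟨c', hc', hlt, hx⟩)
    · exact Or.inl (Or.inl h)
    · by_cases h : c' = c
      · subst h; exact Or.inr hx
      · refine Or.inl (Or.inr ⟨c', hc', ?_, hx⟩)
        have : (c' : ℕ) ≠ c := fun h' => h (Fin.ext h')
        omega
  · rintro ((h | ⟨c', hc', hlt, hx⟩) | hx)
    · exact Or.inl h
    · exact Or.inr ⟨c', hc', by omega, hx⟩
    · exact Or.inr ⟨c, hc, by omega, hx⟩

theorem arcsUpTo_succ (hc : c ∈ children G u v) :
    arcsUpTo G u v (c + 1) = arcsUpTo G u v c ∪ insert (v, c) (arcs G v c) := by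
  ext p
  simp only [Finset.mem_union, Finset.mem_insert, mem_arcsUpTo]
  constructor
  · rintro ⟨c', hc', hlt, hx⟩
    by_cases h : c' = c
    · subst h; exact Or.inr hx
    · refine Or.inl ⟨c', hc', ?_, hx⟩
      have : (c' : ℕ) ≠ c := fun h' => h (Fin.ext h')
      omega
  · rintro (⟨c', hc', hlt, hx⟩ | hx)
    · exact ⟨c', hc', by omega, hx⟩
    · exact ⟨c, hc, by omega, hx⟩

theorem disjoint_branchUpTo (hG : G.IsAcyclic) (hc : c ∈ children G u v) :
    Disjoint (branchUpTo G u v c) (side G v c) := by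
  have hvc := (mem_children.1 hc).1
  rw [Finset.disjoint_left]
  intro x hx hxc
  rcases mem_branchUpTo.1 hx with rfl | ⟨c', hc', hlt, hx'⟩
  · exact notMem_side hG hvc hxc
  · have : c' ≠ c := by rintro rfl; omega
    exact Finset.disjoint_left.1 (disjoint_sides hG (mem_children.1 hc').1 hvc this) hx' hxc

theorem side_subset_of_mem_arcsUpTo (hG : G.IsAcyclic) {p : Fin n × Fin n}
    (hp : p ∈ arcsUpTo G u v j) : side G p.1 p.2 ⊆ branchUpTo G u v j := by
  obtain ⟨c, hc, hlt, h⟩ := mem_arcsUpTo.1 hp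
  have h1 : side G p.1 p.2 ⊆ side G v c := by
    rcases h with rfl | h
    · exact subset_rfl
    · exact side_subset_of_mem_arcs hG (Or.inr (mem_children.1 hc).1) h
  exact fun x hx => mem_branchUpTo.2 (Or.inr ⟨c, hc, hlt, h1 hx⟩)

theorem totalWeight_congr {A : Finset (Fin n × Fin n)} {H H' : Finset (Fin n)}
    (h : ∀ p ∈ A, H ∩ side G p.1 p.2 = H' ∩ side G p.1 p.2) :
    totalWeight G w A H = totalWeight G w A H' :=
  Finset.sum_congr rfl fun p hp => by rw [h p hp]

/-- The weight of a choice of group heads is the sum of the weights of the two parts of the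
choice, and of the weight of the arc to the branch of the last child. -/
theorem totalWeight_succ (hG : G.IsAcyclic) (hc : c ∈ children G u v)
    {H₁ H₂ : Finset (Fin n)} (h₁ : H₁ ⊆ branchUpTo G u v c) (h₂ : H₂ ⊆ side G v c) :
    totalWeight G w (arcsUpTo G u v (c + 1)) (H₁ ∪ H₂) =
      totalWeight G w (arcsUpTo G u v c) H₁ + w v c H₂.card + totalWeight G w (arcs G v c) H₂ := by
  have hvc := (mem_children.1 hc).1
  have hd := disjoint_branchUpTo hG hc
  have hd1 : Disjoint (arcsUpTo G u v c) (insert (v, c) (arcs G v c)) := by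
    rw [Finset.disjoint_left]
    intro p hp hp'
    have h1 : p.2 ∈ branchUpTo G u v c := side_subset_of_mem_arcsUpTo hG hp self_mem_side
    have h2 : p.2 ∈ side G v c := by
      rcases Finset.mem_insert.1 hp' with rfl | h
      · exact self_mem_side
      · exact (mem_arcs.1 h).2.2.1
    exact Finset.disjoint_left.1 hd h1 h2
  have hd2 : (v, c) ∉ arcs G v c := fun h => notMem_side hG hvc (mem_arcs.1 h).2.1
  rw [arcsUpTo_succ hc, totalWeight, Finset.sum_union hd1, Finset.sum_insert hd2, add_assoc]
  congr 1
  · refine totalWeight_congr fun p hp => ?_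
    have hp' := side_subset_of_mem_arcsUpTo hG hp
    ext x
    simp only [Finset.mem_inter, Finset.mem_union]
    constructor
    · rintro ⟨hx | hx, hxp⟩
      · exact ⟨hx, hxp⟩
      · exact absurd (h₂ hx) (Finset.disjoint_left.1 hd (hp' hxp))
    · rintro ⟨hx, hxp⟩
      exact ⟨Or.inl hx, hxp⟩
  · congr 1
    · congr 2
      ext x
      simp only [Finset.mem_inter, Finset.mem_union]
      constructor
      · rintro ⟨hx | hx, hxp⟩
        · exact absurd hxp (Finset.disjoint_left.1 hd (h₁ hx))
        · exact hx
      · exact fun hx => ⟨Or.inr hx, h₂ hx⟩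
    · refine totalWeight_congr fun p hp => ?_
      have hp' := side_subset_of_mem_arcs hG (Or.inr hvc) hp
      ext x
      simp only [Finset.mem_inter, Finset.mem_union]
      constructor
      · rintro ⟨hx | hx, hxp⟩
        · exact absurd (hp' hxp) (Finset.disjoint_left.1 hd (h₁ hx))
        · exact ⟨hx, hxp⟩
      · rintro ⟨hx, hxp⟩
        exact ⟨Or.inr hx, hxp⟩

/-- To choose `h` group heads among the first branches, choose `i` of them in the branch of the last
child and `h - i` of them in the rest. -/
theorem isWeight_succ (hG : G.IsAcyclic) (hc : c ∈ children G u v) (y : ℕ) :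
    IsWeight G w u v (c + 1) h y ↔ ∃ i ≤ h, ∃ a b, IsWeight G w u v c (h - i) a ∧
      IsWeight G w v c n i b ∧ y = a + w v c i + b := by
  have hvc := (mem_children.1 hc).1
  have hd := disjoint_branchUpTo hG hc
  have hne : v ≠ c := fun h => G.loopless.irrefl _ (h ▸ hvc)
  simp only [IsWeight, branchUpTo_self hG (Or.inr hvc), arcsUpTo_self hG (Or.inr hvc)]
  constructor
  · rintro ⟨H, hH, rfl, hv, rfl⟩
    rw [branchUpTo_succ hc] at hH
    have h0 : H = (H ∩ branchUpTo G u v c) ∪ (H ∩ side G v c) := by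
      rw [← Finset.inter_union_distrib_left, Finset.inter_eq_left.2 hH]
    have hcard : H.card = (H ∩ branchUpTo G u v c).card + (H ∩ side G v c).card := by
      conv_lhs => rw [h0]
      exact Finset.card_union_of_disjoint
        (hd.mono Finset.inter_subset_right Finset.inter_subset_right)
    refine ⟨(H ∩ side G v c).card, by omega, _, _,
      ⟨H ∩ branchUpTo G u v c, Finset.inter_subset_right, by omega,
        fun h h' => hv h (Finset.mem_inter.1 h').1, rfl⟩,
      ⟨H ∩ side G v c, Finset.inter_subset_right, rfl, fun h => absurd h hne, rfl⟩, ?_⟩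
    rw [← totalWeight_succ hG hc Finset.inter_subset_right Finset.inter_subset_right, ← h0]
  · rintro ⟨i, hi, a, b, ⟨H₁, hH₁, hc₁, hv, rfl⟩, ⟨H₂, hH₂, rfl, -, rfl⟩, rfl⟩
    refine ⟨H₁ ∪ H₂, ?_, ?_, fun h h' => ?_, (totalWeight_succ hG hc hH₁ hH₂).symm⟩
    · rw [branchUpTo_succ hc]
      exact Finset.union_subset_union hH₁ hH₂
    · rw [Finset.card_union_of_disjoint (hd.mono hH₁ hH₂)]
      omega
    · rcases Finset.mem_union.1 h' with h' | h'
      · exact hv h h'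
      · exact notMem_side hG hvc (hH₂ h')

theorem isWeight_succ_of_notMem (hc : c ∉ children G u v) (y : ℕ) :
    IsWeight G w u v (c + 1) h y ↔ IsWeight G w u v c h y := by
  simp only [IsWeight, branchUpTo_succ_of_notMem hc, arcsUpTo_succ_of_notMem hc]

theorem isWeight_zero (y : ℕ) :
    IsWeight G w u v 0 h y ↔ (h = 0 ∨ h = 1 ∧ u ≠ v) ∧ y = 0 := by
  simp only [IsWeight, branchUpTo_zero, arcsUpTo_zero, totalWeight, Finset.sum_empty]
  constructor
  · rintro ⟨H, hH, rfl, hv, rfl⟩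
    refine ⟨?_, rfl⟩
    rcases Finset.subset_singleton_iff.1 hH with rfl | rfl
    · simp
    · right
      refine ⟨rfl, fun h => hv h (by simp)⟩
  · rintro ⟨rfl | ⟨rfl, hne⟩, rfl⟩
    · exact ⟨∅, by simp, rfl, by simp, rfl⟩
    · exact ⟨{v}, subset_rfl, rfl, fun h => absurd h hne, rfl⟩

theorem isWeight_root (hG : G.IsTree) (ρ : Fin n) (y : ℕ) :
    IsWeight G w ρ ρ n h y ↔
      ∃ H : Finset (Fin n), ρ ∉ H ∧ H.card = h ∧ y = totalWeight G w (arcs G ρ ρ) H := by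
  simp only [IsWeight, branchUpTo_self hG.isAcyclic (Or.inl rfl),
    arcsUpTo_self hG.isAcyclic (Or.inl rfl), side_self hG.1, Finset.subset_univ, true_and,
    forall_const]
  exact exists_congr fun H => by tauto

theorem card_side_child_lt (hG : G.IsAcyclic) (huv : u = v ∨ G.Adj u v)
    (hc : c ∈ children G u v) : (side G v c).card < (side G u v).card :=
  Finset.card_lt_card ((Finset.ssubset_iff_of_subset (side_child_subset hG huv hc)).2
    ⟨v, self_mem_side, notMem_side hG (mem_children.1 hc).1⟩)

/-- A table with the recursive equations of the sizes of branches holds these sizes. The number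
`k` of the round has to be at least the size of the branch. -/
theorem table_eq_card (hG : G.IsAcyclic) {B : ℕ} (hB : n ≤ B) {Z : ℕ → Fin n → Fin n → ℕ → ℕ}
    (h0 : ∀ k < n, ∀ u v, Z (k + 1) u v 0 = 1)
    (h1 : ∀ k < n, ∀ u v c, c ∉ children G u v → Z (k + 1) u v (c + 1) = Z (k + 1) u v c)
    (h2 : ∀ k < n, ∀ u v c, c ∈ children G u v →
      Z (k + 1) u v (c + 1) = min (Z (k + 1) u v c + Z k v c n) B)
    {k : ℕ} (hk : k ≤ n) {u v : Fin n} (huv : u = v ∨ G.Adj u v) (hs : (side G u v).card ≤ k)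
    {j : ℕ} (hj : j ≤ n) : Z k u v j = (branchUpTo G u v j).card := by
  induction k generalizing u v j with
  | zero =>
    have : v ∈ side G u v := self_mem_side
    rw [Nat.le_zero, Finset.card_eq_zero] at hs
    simp [hs] at this
  | succ k ih =>
    induction j with
    | zero => rw [h0 k hk, branchUpTo_zero, Finset.card_singleton]
    | succ j ihj =>
      have ihj := ihj (by omega)
      obtain ⟨c, rfl⟩ : ∃ c : Fin n, (c : ℕ) = j := ⟨⟨j, hj⟩, rfl⟩
      by_cases hc : c ∈ children G u v
      · have hvc := (mem_children.1 hc).1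
        have h3 := ih (by omega) (Or.inr hvc)
          (by have := card_side_child_lt hG huv hc; omega) le_rfl
        rw [branchUpTo_self hG (Or.inr hvc)] at h3
        rw [h2 k hk u v c hc, ihj, h3,
          ← Finset.card_union_of_disjoint (disjoint_branchUpTo hG hc), ← branchUpTo_succ hc]
        exact min_eq_left ((card_finset_fin_le _).trans hB)
      · rw [h1 k hk u v c hc, ihj, branchUpTo_succ_of_notMem hc]

/-- A table with the recursive equations of the least weights holds these weights. -/
theorem table_minVal (hG : G.IsAcyclic) {B : ℕ} {Q : ℕ → Fin n → Fin n → ℕ → ℕ → ℕ}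
    (h0 : ∀ k < n, ∀ u v, ∀ h ≤ n,
      Q (k + 1) u v 0 h = if h = 0 ∨ h = 1 ∧ u ≠ v then 0 else B)
    (h1 : ∀ k < n, ∀ u v c, c ∉ children G u v → ∀ h ≤ n,
      Q (k + 1) u v (c + 1) h = Q (k + 1) u v c h)
    (h2 : ∀ k < n, ∀ u v c, c ∈ children G u v → ∀ h ≤ n, MinVal B
      (fun y => ∃ i ≤ h, y = Q (k + 1) u v c (h - i) + w v c i + Q k v c n i)
      (Q (k + 1) u v (c + 1) h))
    {k : ℕ} (hk : k ≤ n) {u v : Fin n} (huv : u = v ∨ G.Adj u v) (hs : (side G u v).card ≤ k)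
    {j : ℕ} (hj : j ≤ n) {h : ℕ} (hh : h ≤ n) :
    MinVal B (IsWeight G w u v j h) (Q k u v j h) := by
  induction k generalizing u v j h with
  | zero =>
    have : v ∈ side G u v := self_mem_side
    rw [Nat.le_zero, Finset.card_eq_zero] at hs
    simp [hs] at this
  | succ k ih =>
    induction j generalizing h with
    | zero =>
      rw [h0 k hk u v h hh]
      refine MinVal.congr ?_ fun y => (isWeight_zero y).symm
      split_ifs with h'
      · exact ⟨Nat.zero_le _, fun _ _ => Nat.zero_le _, fun _ => ⟨h', rfl⟩⟩
      · exact ⟨le_rfl, fun y hy => absurd hy.1 h', fun h => absurd h (lt_irrefl _)⟩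
    | succ j ihj =>
      obtain ⟨c, rfl⟩ : ∃ c : Fin n, (c : ℕ) = j := ⟨⟨j, hj⟩, rfl⟩
      by_cases hc : c ∈ children G u v
      · have hvc := (mem_children.1 hc).1
        refine MinVal.congr ?_ fun y => (isWeight_succ hG hc y).symm
        refine MinVal.conv (P := fun i => IsWeight G w u v c (h - i))
          (R := fun i => IsWeight G w v c n i) (w := w v c)
          (fun i hi => ihj (by omega) (by omega))
          (fun i hi => ih (by omega) (Or.inr hvc)
            (by have := card_side_child_lt hG huv hc; omega) le_rfl (by omega))
          (h2 k hk u v c hc h hh)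
      · rw [h1 k hk u v c hc h hh]
        exact (ihj (by omega) hh).congr fun y => (isWeight_succ_of_notMem hc y).symm

end Recursion

end VNE

/-! ### The program -/

namespace RAM.Expr

instance : Add Expr := ⟨.add⟩
instance : Sub Expr := ⟨.sub⟩
instance : Mul Expr := ⟨.mul⟩
instance : Div Expr := ⟨.div⟩
instance (k : ℕ) : OfNat Expr k := ⟨.lit k⟩

variable (σ : Mem) (a b x y : Expr)

theorem eval_add : (x + y).eval σ = x.eval σ + y.eval σ := rfl
theorem eval_sub : (x - y).eval σ = x.eval σ - y.eval σ := rfl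
theorem eval_mul : (x * y).eval σ = x.eval σ * y.eval σ := rfl
theorem eval_div : (x / y).eval σ = x.eval σ / y.eval σ := rfl
theorem eval_zero : (0 : Expr).eval σ = 0 := rfl
theorem eval_one : (1 : Expr).eval σ = 1 := rfl
theorem eval_two : (2 : Expr).eval σ = 2 := rfl
theorem eval_three : (3 : Expr).eval σ = 3 := rfl
theorem eval_four : (4 : Expr).eval σ = 4 := rfl
theorem eval_lit (k : ℕ) : (Expr.lit k).eval σ = k := rfl

/-- The remainder. -/
def modE : Expr := x - x / y * y

theorem eval_modE : (modE x y).eval σ = x.eval σ % y.eval σ := by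
  simp only [modE, eval_sub, eval_mul, eval_div]
  have := Nat.div_add_mod' (x.eval σ) (y.eval σ)
  omega

/-- "If `a ≤ b` then `x` else `y`". -/
def condLe : Expr := (1 - (a - b)) * x + (1 - (1 - (a - b))) * y

theorem eval_condLe : (condLe a b x y).eval σ =
    if a.eval σ ≤ b.eval σ then x.eval σ else y.eval σ := by
  simp only [condLe, eval_add, eval_sub, eval_mul, eval_one]
  split_ifs with h
  · rw [Nat.sub_eq_zero_of_le h]; simp
  · have : 1 - (a.eval σ - b.eval σ) = 0 := by omega
    rw [this]; simp

/-- "If `a = b` then `x` else `y`". -/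
def condEq : Expr := condLe (a - b + (b - a)) 0 x y

theorem eval_condEq : (condEq a b x y).eval σ =
    if a.eval σ = b.eval σ then x.eval σ else y.eval σ := by
  simp only [condEq, eval_condLe, eval_add, eval_sub, eval_zero]
  congr 1
  simp only [eq_iff_iff]
  omega

theorem eval_ctr_view (τ : Mem) (k i : ℕ) : Expr.ctr.eval (τ.view k i) = i := by
  simp [Expr.ctr, Expr.eval, Mem.view]

theorem eval_read_view_of_lt {τ : Mem} {k i r : ℕ} (h : r < k) (h2 : r ≠ 2) :
    (Expr.read r x).eval (τ.view k i) = τ r (x.eval (τ.view k i)) := by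
  simp [Expr.eval, Mem.view, h, h2]

theorem eval_read_view_self {τ : Mem} {k i : ℕ} (h2 : k ≠ 2) :
    (Expr.read k x).eval (τ.view k i) =
      if x.eval (τ.view k i) < i then τ k (x.eval (τ.view k i)) else 0 := by
  simp [Expr.eval, Mem.view, h2]

end RAM.Expr

namespace VNE

open RAM RAM.Expr

theorem digit_div {a b M : ℕ} (h : b < M) : (a * M + b) / M = a := by
  rw [mul_comm, Nat.mul_add_div (by omega), Nat.div_eq_of_lt h, add_zero]

theorem digit_mod {a b M : ℕ} (h : b < M) : (a * M + b) % M = b := by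
  rw [mul_comm, Nat.mul_add_mod, Nat.mod_eq_of_lt h]

theorem digit_lt {a a' b b' M : ℕ} (h : a < a') (hb : b < M) : a * M + b < a' * M + b' := by
  have : (a + 1) * M ≤ a' * M := Nat.mul_le_mul_right _ h
  rw [add_mul] at this
  omega

/-- The index of the cell with coordinates `u, v, h`. -/
abbrev idx3 (n u v h : ℕ) : ℕ := (u * (n + 1) + v) * (n + 1) + h

/-- The index of the cell with coordinates `k, u, v, j`. -/
abbrev idx4 (n k u v j : ℕ) : ℕ := idx3 n k u v * (n + 1) + j

/-- The index of the cell with coordinates `k, u, v, j, h, i`. -/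
abbrev idx6 (n k u v j h i : ℕ) : ℕ := (idx4 n k u v j * (n + 1) + h) * (n + 1) + i

section Program

-- the position of the code of the networks in the input
variable (off : ℕ)

/-- The number of vertices. -/
def nE : Expr := .read 0 (.lit off)

/-- The common bound on all numbers, which also stands for an infinite cost. -/
def bE : Expr := .read 3 0

/-- The adjacency bit of entry `x` of the first matrix. -/
def adjSE (x : Expr) : Expr := .read 0 (.lit (off + 1) + 2 * x)

/-- The demand in entry `x` of the first matrix. -/
def demE (x : Expr) : Expr := .read 0 (.lit (off + 2) + 2 * x)

/-- The `r`-th number of entry `x` of the second matrix: the adjacency bit, the capacity, and the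
numerator and the denominator of the cost. -/
def pnE (r : ℕ) (x : Expr) : Expr := .read 0 (.lit (off + 1 + r) + 2 * (nE off * nE off) + 4 * x)

/-- The base of the numbers that serve as indices of tables of more than one dimension. -/
def baseE : Expr := nE off + 1

/-- The index of the cell with the coordinates `x` and `y`, where `x` is itself an index. -/
def pairE (x y : Expr) : Expr := x * baseE off + y

/-- The counter without its last `i` digits. -/
def upperE : ℕ → Expr
  | 0 => .ctr
  | i + 1 => upperE i / baseE off

/-- Digit `i` of the counter. -/
def digitE (i : ℕ) : Expr := modE (upperE off i) (baseE off)

/-- "If the vertex `c` is a child of `v` in the branch at `u`, then `x` else `y`". -/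
def condChild (u v c x y : Expr) : Expr :=
  condEq (pnE off 0 (v * nE off + c)) 1 (condEq c u y x) y

/-- Prefix sums of the adjacency bits of the virtual network. -/
def degreeStage : Expr := condEq .ctr 0 0 (.read 4 (.ctr - 1) + adjSE off (.ctr - 1))

/-- The numbers of vertices of degree one, among the first vertices. -/
def pendantStage : Expr :=
  condEq .ctr 0 0 (.read 5 (.ctr - 1) +
    condEq (.read 4 ((.ctr - 1) * nE off + nE off) - .read 4 ((.ctr - 1) * nE off)) 1 1 0)

/-- Prefix sums of the demands. -/
def demandStage : Expr := condEq .ctr 0 0 (.read 6 (.ctr - 1) + demE off (.ctr - 1))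

/-- Prefix products of the denominators of the costs. -/
def denStage : Expr :=
  condEq .ctr 0 1 (.read 7 (.ctr - 1) * (pnE off 3 (.ctr - 1) + (1 - pnE off 3 (.ctr - 1))))

/-- The number `g` of groups. The vertices of degree other than one are the root and the heads,
except that the root has degree one if there is a single group; then the difference below is `0`,
and the result is `1`. -/
def groupsStage : Expr := nE off - 1 - .read 5 (nE off) + (1 - (nE off - 1 - .read 5 (nE off)))

/-- The number `s` of leaves of a group: there are `1 + g * (s + 1)` vertices. -/
def leavesStage : Expr := (nE off - 1) / .read 8 0 - 1

/-- The demand `D` of the edges at the root: the sum over the adjacency matrix, in which every edge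
occurs twice, is `2 * g * (D + s)`. -/
def rootDemandStage : Expr := .read 6 (nE off * nE off) / (2 * .read 8 0) - .read 9 0

/-- The sizes of branches: the cell with coordinates `k, u, v, j` holds the size of
`branchUpTo G u v j`, if the branch `side G u v` has at most `k` vertices. The cells for `k + 1` refer
to cells for `k`, so that the branches need not be sorted by inclusion. -/
def sizeStage : Expr :=
  condEq (digitE off 0) 0 1 (condChild off (digitE off 2) (digitE off 1) (digitE off 0 - 1)
    (.read 11 (.ctr - 1) + .read 11 (pairE off (pairE off (pairE off (upperE off 3 - 1)
      (digitE off 1)) (digitE off 0 - 1)) (nE off)))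
    (.read 11 (.ctr - 1)))

/-- The least load of the arc from `u` to `v` with `h` group heads in its branch, where `u`, `v`
and `h` are the coordinates of the current cell. -/
def loadE : Expr :=
  let m : Expr := .read 11 (pairE off (pairE off (pairE off (nE off) (upperE off 2)) (digitE off 1))
    (nE off))
  let t : Expr := digitE off 0 * (.read 9 0 + 1)
  .read 10 0 * digitE off 0 + ((t - m) + (m - t))

/-- The costs of the least loads of arcs, multiplied by the common denominator, and infinite if the
load exceeds the capacity. -/
def weightStage : Expr :=
  let x : Expr := upperE off 2 * nE off + digitE off 1
  condLe (loadE off) (pnE off 1 x)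
    (pnE off 2 x * (.read 7 (nE off * nE off) / pnE off 3 x) * loadE off) bE

/-- The candidate for the weight of a branch that assigns `i` group heads to the last child, where
`k`, `u`, `v`, `j`, `h`, `i` are the coordinates of the current cell. -/
def candidateE : Expr :=
  .read 13 (pairE off (pairE off (pairE off (upperE off 3) (digitE off 2 - 1))
      (digitE off 1 - digitE off 0)) (nE off)) +
    .read 12 (pairE off (pairE off (digitE off 3) (digitE off 2 - 1)) (digitE off 0)) +
    .read 13 (pairE off (pairE off (pairE off (pairE off (pairE off (upperE off 5 - 1)
      (digitE off 3)) (digitE off 2 - 1)) (nE off)) (digitE off 0)) (nE off))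

/-- The least weights of branches: the cell with coordinates `k, u, v, j, h, i` is for
`branchUpTo G u v j` with `h` group heads, at most `i` of them in the branch of the last child. -/
def branchStage : Expr :=
  condEq (digitE off 2) 0
    (condEq (digitE off 1) 0 0 (condEq (digitE off 1) 1
      (condEq (digitE off 4) (digitE off 3) bE 0) bE))
    (condChild off (digitE off 4) (digitE off 3) (digitE off 2 - 1)
      (condEq (digitE off 0) 0 (candidateE off)
        (condLe (digitE off 0) (digitE off 1) (minE (.read 13 (.ctr - 1)) (candidateE off))
          (.read 13 (.ctr - 1))))
      (.read 13 (pairE off (pairE off (pairE off (upperE off 3) (digitE off 2 - 1)) (digitE off 1))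
        (nE off))))

/-- The least weights over the first choices of the root: cell `x` is for the roots less than `x`. -/
def rootStage : Expr :=
  condEq .ctr 0 bE (minE (.read 14 (.ctr - 1))
    (.read 13 (pairE off (pairE off (pairE off (pairE off (pairE off (nE off) (.ctr - 1))
      (.ctr - 1)) (nE off)) (.read 8 0)) (nE off))))

/-- The stages that compute the minimal cost; they fill the arrays from `4` to `14`, in this order.
The arrays before these hold the input, its length, the loop counter, and the bounds. -/
def minCostStages : List Expr :=
  [degreeStage off, pendantStage off, demandStage off, denStage off, groupsStage off,
    leavesStage off, rootDemandStage off, sizeStage off, weightStage off, branchStage off,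
    rootStage off]

/-- The output of the optimization problem. -/
def costStage : Expr :=
  condEq .ctr 0 (condLe bE (.read 14 (nE off)) 1 3)
    (condEq .ctr 1 (condLe bE (.read 14 (nE off)) 0 1)
      (condEq .ctr 2 (.read 14 (nE off)) (.read 7 (nE off * nE off))))

/-- The output of the decision problem, whose input starts with the sign, the numerator and the
denominator of the desired cost. -/
def decisionStage : Expr :=
  condEq .ctr 0 1 (condLe bE (.read 14 (nE off)) 0 (condEq (.read 0 0) 1 0
    (condLe (.read 14 (nE off) * .read 0 2) (.read 0 1 * .read 7 (nE off * nE off)) 1 0)))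

/-- The memory `τ` holds the tables that are computed by the first stages for networks with `n`
vertices. -/
structure Computed (n B : ℕ) (τ : Mem) : Prop where
  n_eq : τ 0 off = n
  bound_eq : τ 3 0 = B
  table_eq : ∀ (m : ℕ) (hm : m < (minCostStages off).length), ∀ i < (n + 1) ^ 6,
    τ (4 + m) i = min (((minCostStages off)[m]).eval (τ.view (4 + m) i)) B

variable {off} {n B : ℕ} {τ : Mem} (h : Computed off n B τ)

theorem eval_adjSE {k i : ℕ} (hk : 0 < k) (x : Expr) :
    (adjSE off x).eval (τ.view k i) = τ 0 (off + 1 + 2 * x.eval (τ.view k i)) := by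
  rw [adjSE, eval_read_view_of_lt _ hk (by norm_num)]; rfl

theorem eval_demE {k i : ℕ} (hk : 0 < k) (x : Expr) :
    (demE off x).eval (τ.view k i) = τ 0 (off + 2 + 2 * x.eval (τ.view k i)) := by
  rw [demE, eval_read_view_of_lt _ hk (by norm_num)]; rfl

theorem lt_pow_six {i m : ℕ} (hm : m ≤ 6) (hi : i < (n + 1) ^ m) : i < (n + 1) ^ 6 :=
  lt_of_lt_of_le hi (Nat.pow_le_pow_right (by omega) hm)

theorem sq_lt {x : ℕ} (hx : x ≤ n * n) : x < (n + 1) ^ 6 :=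
  lt_pow_six (m := 2) (by norm_num) (by nlinarith)

include h

theorem Computed.eval_nE {k i : ℕ} (hk : 0 < k) : (nE off).eval (τ.view k i) = n := by
  rw [nE, eval_read_view_of_lt _ hk (by norm_num), eval_lit, h.n_eq]

theorem Computed.eval_bE {k i : ℕ} (hk : 3 < k) : bE.eval (τ.view k i) = B := by
  rw [bE, eval_read_view_of_lt _ hk (by norm_num), eval_zero, h.bound_eq]

theorem Computed.eval_baseE {k i : ℕ} (hk : 0 < k) : (baseE off).eval (τ.view k i) = n + 1 := by
  rw [baseE, eval_add, h.eval_nE hk, eval_one]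

theorem Computed.eval_pairE {k i : ℕ} (hk : 0 < k) (x y : Expr) :
    (pairE off x y).eval (τ.view k i) =
      x.eval (τ.view k i) * (n + 1) + y.eval (τ.view k i) := by
  rw [pairE, eval_add, eval_mul, h.eval_baseE hk]

theorem Computed.eval_upperE_succ {k i : ℕ} (hk : 0 < k) (d : ℕ) :
    (upperE off (d + 1)).eval (τ.view k i) = (upperE off d).eval (τ.view k i) / (n + 1) := by
  rw [upperE, eval_div, h.eval_baseE hk]

theorem Computed.eval_digitE {k i : ℕ} (hk : 0 < k) (d : ℕ) :
    (digitE off d).eval (τ.view k i) = (upperE off d).eval (τ.view k i) % (n + 1) := by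
  rw [digitE, eval_modE, h.eval_baseE hk]

theorem Computed.eval_pnE {k i : ℕ} (hk : 0 < k) (r : ℕ) (x : Expr) :
    (pnE off r x).eval (τ.view k i) =
      τ 0 (off + 1 + r + 2 * (n * n) + 4 * x.eval (τ.view k i)) := by
  rw [pnE, eval_read_view_of_lt _ hk (by norm_num)]
  simp only [eval_add, eval_mul, eval_lit, eval_two, eval_four, h.eval_nE hk]

theorem Computed.eval_condChild {k i : ℕ} (hk : 0 < k) (u v c x y : Expr) :
    (condChild off u v c x y).eval (τ.view k i) =
      if τ 0 (off + 1 + 2 * (n * n) + 4 * (v.eval (τ.view k i) * n + c.eval (τ.view k i))) = 1 ∧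
        c.eval (τ.view k i) ≠ u.eval (τ.view k i)
      then x.eval (τ.view k i) else y.eval (τ.view k i) := by
  simp only [condChild, eval_condEq, h.eval_pnE hk, eval_add, eval_mul, eval_one, h.eval_nE hk,
    add_zero]
  split_ifs <;> simp_all

theorem Computed.degree_zero : τ 4 0 = 0 := by
  rw [h.table_eq 0 (by simp [minCostStages]) 0 (by positivity)]
  simp [minCostStages, degreeStage, eval_condEq, eval_ctr_view, eval_zero]

theorem Computed.degree_succ {x : ℕ} (hx : x < n * n) :
    τ 4 (x + 1) = min (τ 4 x + τ 0 (off + 1 + 2 * x)) B := by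
  rw [h.table_eq 0 (by simp [minCostStages]) (x + 1) (sq_lt hx)]
  simp [minCostStages, degreeStage, eval_condEq, eval_ctr_view, eval_zero, eval_add, eval_sub,
    eval_one, eval_adjSE, eval_read_view_self]

theorem Computed.pendant_zero : τ 5 0 = 0 := by
  rw [h.table_eq 1 (by simp [minCostStages]) 0 (by positivity)]
  simp [minCostStages, pendantStage, eval_condEq, eval_ctr_view, eval_zero]

theorem Computed.pendant_succ {x : ℕ} (hx : x < n) :
    τ 5 (x + 1) = min (τ 5 x + if τ 4 (x * n + n) - τ 4 (x * n) = 1 then 1 else 0) B := by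
  rw [h.table_eq 1 (by simp [minCostStages]) (x + 1) (sq_lt (by nlinarith))]
  simp [minCostStages, pendantStage, eval_condEq, eval_ctr_view, eval_zero, eval_add, eval_sub,
    eval_one, eval_mul, eval_read_view_self, eval_read_view_of_lt, h.eval_nE]

theorem Computed.demand_zero : τ 6 0 = 0 := by
  rw [h.table_eq 2 (by simp [minCostStages]) 0 (by positivity)]
  simp [minCostStages, demandStage, eval_condEq, eval_ctr_view, eval_zero]

theorem Computed.demand_succ {x : ℕ} (hx : x < n * n) :
    τ 6 (x + 1) = min (τ 6 x + τ 0 (off + 2 + 2 * x)) B := by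
  rw [h.table_eq 2 (by simp [minCostStages]) (x + 1) (sq_lt hx)]
  simp [minCostStages, demandStage, eval_condEq, eval_ctr_view, eval_zero, eval_add, eval_sub,
    eval_one, eval_demE, eval_read_view_self]

theorem Computed.den_zero : τ 7 0 = min 1 B := by
  rw [h.table_eq 3 (by simp [minCostStages]) 0 (by positivity)]
  simp [minCostStages, denStage, eval_condEq, eval_ctr_view, eval_zero, eval_one]

theorem Computed.den_succ {x : ℕ} (hx : x < n * n) :
    τ 7 (x + 1) = min (τ 7 x * max 1 (τ 0 (off + 1 + 3 + 2 * (n * n) + 4 * x))) B := by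
  rw [h.table_eq 3 (by simp [minCostStages]) (x + 1) (sq_lt hx)]
  have e : ∀ d : ℕ, d + (1 - d) = max 1 d := fun d => by omega
  simp [minCostStages, denStage, eval_condEq, eval_ctr_view, eval_zero, eval_add, eval_sub,
    eval_one, eval_mul, h.eval_pnE, eval_read_view_self, e]

theorem Computed.groups_eq : τ 8 0 = min (max 1 (n - 1 - τ 5 n)) B := by
  rw [h.table_eq 4 (by simp [minCostStages]) 0 (by positivity)]
  have e : ∀ d : ℕ, d + (1 - d) = max 1 d := fun d => by omega
  simp [minCostStages, groupsStage, eval_add, eval_sub, eval_one, h.eval_nE,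
    eval_read_view_of_lt, e]

theorem Computed.leaves_eq : τ 9 0 = min ((n - 1) / τ 8 0 - 1) B := by
  rw [h.table_eq 5 (by simp [minCostStages]) 0 (by positivity)]
  simp [minCostStages, leavesStage, eval_sub, eval_one, eval_div, h.eval_nE,
    eval_read_view_of_lt, eval_zero]

theorem Computed.rootDemand_eq : τ 10 0 = min (τ 6 (n * n) / (2 * τ 8 0) - τ 9 0) B := by
  rw [h.table_eq 6 (by simp [minCostStages]) 0 (by positivity)]
  simp [minCostStages, rootDemandStage, eval_sub, eval_mul, eval_two, eval_div, h.eval_nE,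
    eval_read_view_of_lt, eval_zero]

end Program

end VNE

/-! ### The recursive equations of the tables -/

namespace VNE

open RAM RAM.Expr

section Program

variable {off : ℕ} {n B : ℕ} {τ : Mem} (h : Computed off n B τ)

theorem pair_lt_pow {x y m : ℕ} (hx : x < (n + 1) ^ m) (hy : y ≤ n) :
    x * (n + 1) + y < (n + 1) ^ (m + 1) := by
  have := digit_lt (M := n + 1) (b' := 0) hx (Nat.lt_succ_of_le hy)
  rwa [add_zero, ← pow_succ] at this

theorem idx3_lt {u v j : ℕ} (hu : u ≤ n) (hv : v ≤ n) (hj : j ≤ n) :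
    idx3 n u v j < (n + 1) ^ 3 :=
  pair_lt_pow (pair_lt_pow (m := 1) (by rw [pow_one]; omega) hv) hj

theorem idx4_lt {k u v j : ℕ} (hk : k ≤ n) (hu : u ≤ n) (hv : v ≤ n) (hj : j ≤ n) :
    idx4 n k u v j < (n + 1) ^ 4 :=
  pair_lt_pow (idx3_lt hk hu hv) hj

theorem idx6_lt {k u v j i l : ℕ} (hk : k ≤ n) (hu : u ≤ n) (hv : v ≤ n) (hj : j ≤ n)
    (hi : i ≤ n) (hl : l ≤ n) : idx6 n k u v j i l < (n + 1) ^ 6 :=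
  pair_lt_pow (pair_lt_pow (idx4_lt hk hu hv hj) hi) hl

theorem idx4_lt_idx4 {k u v j u' v' j' : ℕ} (hu : u ≤ n) (hv : v ≤ n) (hj : j ≤ n) :
    idx4 n k u v j < idx4 n (k + 1) u' v' j' :=
  digit_lt (digit_lt (digit_lt k.lt_succ_self (by omega)) (by omega)) (by omega)

include h

theorem Computed.size_table {i : ℕ} (hi : i < (n + 1) ^ 6) :
    τ 11 i = min ((sizeStage off).eval (τ.view 11 i)) B :=
  h.table_eq 7 (by simp [minCostStages]) i hi

theorem Computed.weight_table {i : ℕ} (hi : i < (n + 1) ^ 6) :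
    τ 12 i = min ((weightStage off).eval (τ.view 12 i)) B :=
  h.table_eq 8 (by simp [minCostStages]) i hi

theorem Computed.branch_table {i : ℕ} (hi : i < (n + 1) ^ 6) :
    τ 13 i = min ((branchStage off).eval (τ.view 13 i)) B :=
  h.table_eq 9 (by simp [minCostStages]) i hi

theorem Computed.root_table {i : ℕ} (hi : i < (n + 1) ^ 6) :
    τ 14 i = min ((rootStage off).eval (τ.view 14 i)) B :=
  h.table_eq 10 (by simp [minCostStages]) i hi

theorem Computed.size_zero {k u v : ℕ} (hk : k < n) (hu : u < n) (hv : v < n) :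
    τ 11 (idx4 n (k + 1) u v 0) = min 1 B := by
  rw [h.size_table (lt_pow_six (by norm_num) (idx4_lt hk hu.le hv.le (Nat.zero_le n)))]
  simp only [sizeStage, eval_condEq, h.eval_digitE (show 0 < 11 by norm_num), upperE,
    eval_ctr_view, eval_zero, eval_one, digit_mod (Nat.succ_pos n), if_true]

theorem Computed.size_succ {k u v c : ℕ} (hk : k < n) (hu : u < n) (hv : v < n) (hc : c < n) :
    τ 11 (idx4 n (k + 1) u v (c + 1)) =
      min (if τ 0 (off + 1 + 2 * (n * n) + 4 * (v * n + c)) = 1 ∧ c ≠ u then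
        τ 11 (idx4 n (k + 1) u v c) + τ 11 (idx4 n k v c n) else τ 11 (idx4 n (k + 1) u v c)) B := by
  have h0 : 0 < 11 := by norm_num
  have h2 : 11 ≠ 2 := by norm_num
  have e1 : idx4 n (k + 1) u v (c + 1) - 1 = idx4 n (k + 1) u v c := rfl
  have l1 : idx4 n (k + 1) u v c < idx4 n (k + 1) u v (c + 1) := Nat.lt_succ_self _
  have l2 : ((k * (n + 1) + v) * (n + 1) + c) * (n + 1) + n < idx4 n (k + 1) u v (c + 1) :=
    idx4_lt_idx4 hv.le hc.le le_rfl
  have hc' : c + 1 < n + 1 := by omega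
  have hu' : u < n + 1 := by omega
  have hv' : v < n + 1 := by omega
  rw [h.size_table (i := idx4 n (k + 1) u v (c + 1))
    (lt_pow_six (by norm_num) (idx4_lt hk hu.le hv.le hc))]
  simp only [sizeStage, eval_condEq, h.eval_condChild h0, h.eval_digitE h0,
    h.eval_upperE_succ h0, h.eval_pairE h0, h.eval_nE h0, eval_add, eval_sub, eval_zero, eval_one,
    eval_read_view_self _ h2, show upperE off 0 = .ctr from rfl, eval_ctr_view, e1,
    digit_div hc', digit_mod hc', digit_div hu', digit_mod hu', digit_div hv', digit_mod hv',
    Nat.add_sub_cancel, Nat.succ_ne_zero, if_false, l1, l2, if_true]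

theorem Computed.weight_eq {u v x : ℕ} (hu : u < n) (hv : v < n) (hx : x ≤ n) :
    τ 12 (idx3 n u v x) =
      min (if minLoad (τ 10 0) (τ 9 0) (τ 11 (idx4 n n u v n)) x ≤
          τ 0 (off + 1 + 1 + 2 * (n * n) + 4 * (u * n + v)) then
        τ 0 (off + 1 + 2 + 2 * (n * n) + 4 * (u * n + v)) *
          (τ 7 (n * n) / τ 0 (off + 1 + 3 + 2 * (n * n) + 4 * (u * n + v))) *
          minLoad (τ 10 0) (τ 9 0) (τ 11 (idx4 n n u v n)) x else B) B := by
  have h0 : 0 < 12 := by norm_num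
  have h3 : 3 < 12 := by norm_num
  have hu' : u < n + 1 := by omega
  have hv' : v < n + 1 := by omega
  have hx' : x < n + 1 := by omega
  rw [h.weight_table (lt_pow_six (by norm_num) (idx3_lt hu.le hv.le hx))]
  simp only [weightStage, loadE, minLoad, eval_condLe, h.eval_digitE h0,
    h.eval_upperE_succ h0, h.eval_pairE h0, h.eval_nE h0, eval_add, eval_sub, eval_mul, eval_div,
    eval_zero, eval_one, h.eval_pnE h0, h.eval_bE h3,
    eval_read_view_of_lt _ (show 11 < 12 by norm_num) (show 11 ≠ 2 by norm_num),
    eval_read_view_of_lt _ (show 10 < 12 by norm_num) (show 10 ≠ 2 by norm_num),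
    eval_read_view_of_lt _ (show 9 < 12 by norm_num) (show 9 ≠ 2 by norm_num),
    eval_read_view_of_lt _ (show 7 < 12 by norm_num) (show 7 ≠ 2 by norm_num),
    show upperE off 0 = .ctr from rfl, eval_ctr_view,
    digit_mod hv', digit_div hv', digit_div hx', digit_mod hx']
  rfl

theorem Computed.branch_zero {k u v x i : ℕ} (hk : k < n) (hu : u < n) (hv : v < n) (hx : x ≤ n)
    (hi : i ≤ n) :
    τ 13 (idx6 n (k + 1) u v 0 x i) = if x = 0 ∨ x = 1 ∧ u ≠ v then 0 else B := by
  have h0 : 0 < 13 := by norm_num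
  have h3 : 3 < 13 := by norm_num
  have hu' : u < n + 1 := by omega
  have hv' : v < n + 1 := by omega
  have hx' : x < n + 1 := by omega
  have hi' : i < n + 1 := by omega
  rw [h.branch_table (idx6_lt hk hu.le hv.le (Nat.zero_le n) hx hi)]
  simp only [branchStage, eval_condEq, h.eval_digitE h0, h.eval_upperE_succ h0, h.eval_bE h3,
    eval_zero, eval_one, show upperE off 0 = .ctr from rfl, eval_ctr_view,
    digit_mod hu', digit_div hv', digit_mod hv', digit_div hx', digit_mod hx',
    digit_div hi', digit_div (Nat.succ_pos n), digit_mod (Nat.succ_pos n), if_true]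
  split_ifs <;> simp_all

theorem Computed.branch_of_not_child {k u v c x i : ℕ} (hk : k < n) (hu : u < n) (hv : v < n)
    (hc : c < n) (hx : x ≤ n) (hi : i ≤ n)
    (hnc : ¬ (τ 0 (off + 1 + 2 * (n * n) + 4 * (v * n + c)) = 1 ∧ c ≠ u)) :
    τ 13 (idx6 n (k + 1) u v (c + 1) x i) = min (τ 13 (idx6 n (k + 1) u v c x n)) B := by
  have h0 : 0 < 13 := by norm_num
  have h2 : 13 ≠ 2 := by norm_num
  have hu' : u < n + 1 := by omega
  have hv' : v < n + 1 := by omega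
  have hx' : x < n + 1 := by omega
  have hi' : i < n + 1 := by omega
  have hc' : c + 1 < n + 1 := by omega
  have l1 : idx6 n (k + 1) u v c x n < idx6 n (k + 1) u v (c + 1) x i :=
    digit_lt (digit_lt (Nat.lt_succ_self _) hx') (Nat.lt_succ_self _)
  rw [h.branch_table (i := idx6 n (k + 1) u v (c + 1) x _) (idx6_lt hk hu.le hv.le hc hx hi)]
  simp only [branchStage, eval_condEq, h.eval_condChild h0, h.eval_digitE h0,
    h.eval_upperE_succ h0, h.eval_pairE h0, h.eval_nE h0, eval_sub, eval_zero, eval_one,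
    show upperE off 0 = .ctr from rfl, eval_ctr_view, eval_read_view_self _ h2,
    digit_mod hu', digit_div hv', digit_mod hv', digit_div hx', digit_mod hx',
    digit_div hi', digit_mod hi', digit_div hc', digit_mod hc',
    Nat.add_sub_cancel, Nat.succ_ne_zero, if_false, if_neg hnc, l1, if_true]

theorem Computed.eval_candidateE {k u v c x i : ℕ} (hu : u < n) (hv : v < n)
    (hc : c < n) (hx : x ≤ n) (hi : i ≤ n) :
    (candidateE off).eval (τ.view 13 (idx6 n (k + 1) u v (c + 1) x i)) =
      τ 13 (idx6 n (k + 1) u v c (x - i) n) + τ 12 (idx3 n v c i) + τ 13 (idx6 n k v c n i n) := by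
  have h0 : 0 < 13 := by norm_num
  have h2 : 13 ≠ 2 := by norm_num
  have hu' : u < n + 1 := by omega
  have hv' : v < n + 1 := by omega
  have hx' : x < n + 1 := by omega
  have hi' : i < n + 1 := by omega
  have hc' : c + 1 < n + 1 := by omega
  have l1 : idx6 n (k + 1) u v c (x - i) n < idx6 n (k + 1) u v (c + 1) x i :=
    digit_lt (digit_lt (Nat.lt_succ_self _) (by omega)) (Nat.lt_succ_self _)
  have l2 : idx6 n k v c n i n < idx6 n (k + 1) u v (c + 1) x i :=
    digit_lt (digit_lt (idx4_lt_idx4 hv.le hc.le le_rfl) hi') (Nat.lt_succ_self _)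
  simp only [candidateE, h.eval_digitE h0, h.eval_upperE_succ h0, h.eval_pairE h0, h.eval_nE h0,
    eval_add, eval_sub, eval_one,
    show upperE off 0 = .ctr from rfl, eval_ctr_view, eval_read_view_self _ h2,
    eval_read_view_of_lt _ (show 12 < 13 by norm_num) (show 12 ≠ 2 by norm_num),
    digit_div hu', digit_div hv', digit_mod hv', digit_div hx', digit_mod hx',
    digit_div hi', digit_mod hi', digit_div hc', digit_mod hc',
    Nat.add_sub_cancel, l1, l2, if_true]

theorem Computed.branch_of_child_zero {k u v c x : ℕ} (hk : k < n) (hu : u < n) (hv : v < n)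
    (hc : c < n) (hx : x ≤ n)
    (hch : τ 0 (off + 1 + 2 * (n * n) + 4 * (v * n + c)) = 1 ∧ c ≠ u) :
    τ 13 (idx6 n (k + 1) u v (c + 1) x 0) =
      min (τ 13 (idx6 n (k + 1) u v c x n) + τ 12 (idx3 n v c 0) + τ 13 (idx6 n k v c n 0 n)) B := by
  have h0 : 0 < 13 := by norm_num
  have hu' : u < n + 1 := by omega
  have hv' : v < n + 1 := by omega
  have hx' : x < n + 1 := by omega
  have hc' : c + 1 < n + 1 := by omega
  rw [h.branch_table (i := idx6 n (k + 1) u v (c + 1) x 0)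
    (idx6_lt hk hu.le hv.le hc hx (Nat.zero_le n))]
  simp only [branchStage, eval_condEq, h.eval_condChild h0, h.eval_digitE h0,
    h.eval_upperE_succ h0, eval_sub, eval_zero, eval_one,
    h.eval_candidateE hu hv hc hx (Nat.zero_le n), Nat.sub_zero,
    show upperE off 0 = .ctr from rfl, eval_ctr_view,
    digit_mod hu', digit_div hv', digit_mod hv', digit_div hx', digit_mod hx',
    digit_div (Nat.succ_pos n), digit_mod (Nat.succ_pos n), digit_div hc', digit_mod hc',
    Nat.add_sub_cancel, Nat.succ_ne_zero, if_false, if_pos hch, if_true]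

theorem Computed.branch_of_child_succ {k u v c x i : ℕ} (hk : k < n) (hu : u < n) (hv : v < n)
    (hc : c < n) (hx : x ≤ n) (hi : i < n)
    (hch : τ 0 (off + 1 + 2 * (n * n) + 4 * (v * n + c)) = 1 ∧ c ≠ u) :
    τ 13 (idx6 n (k + 1) u v (c + 1) x (i + 1)) =
      min (if i + 1 ≤ x then min (τ 13 (idx6 n (k + 1) u v (c + 1) x i))
        (τ 13 (idx6 n (k + 1) u v c (x - (i + 1)) n) + τ 12 (idx3 n v c (i + 1)) +
          τ 13 (idx6 n k v c n (i + 1) n))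
        else τ 13 (idx6 n (k + 1) u v (c + 1) x i)) B := by
  have h0 : 0 < 13 := by norm_num
  have h2 : 13 ≠ 2 := by norm_num
  have hu' : u < n + 1 := by omega
  have hv' : v < n + 1 := by omega
  have hx' : x < n + 1 := by omega
  have hi' : i + 1 < n + 1 := by omega
  have hc' : c + 1 < n + 1 := by omega
  have e1 : idx6 n (k + 1) u v (c + 1) x (i + 1) - 1 = idx6 n (k + 1) u v (c + 1) x i := rfl
  have l1 : idx6 n (k + 1) u v (c + 1) x i < idx6 n (k + 1) u v (c + 1) x (i + 1) :=
    Nat.lt_succ_self _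
  rw [h.branch_table (i := idx6 n (k + 1) u v (c + 1) x _) (idx6_lt hk hu.le hv.le hc hx hi)]
  simp only [branchStage, eval_condEq, eval_condLe, eval_minE, h.eval_condChild h0,
    h.eval_digitE h0, h.eval_upperE_succ h0, eval_sub, eval_zero, eval_one,
    h.eval_candidateE hu hv hc hx hi, eval_read_view_self _ h2,
    show upperE off 0 = .ctr from rfl, eval_ctr_view, e1, l1,
    digit_mod hu', digit_div hv', digit_mod hv', digit_div hx', digit_mod hx',
    digit_div hi', digit_mod hi', digit_div hc', digit_mod hc',
    Nat.add_sub_cancel, Nat.succ_ne_zero, if_false, if_pos hch, if_true]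

theorem Computed.root_zero : τ 14 0 = B := by
  rw [h.root_table (by positivity)]
  simp [rootStage, eval_condEq, eval_ctr_view, eval_zero, h.eval_bE]

theorem Computed.root_succ {ρ : ℕ} (hρ : ρ < n) :
    τ 14 (ρ + 1) = min (min (τ 14 ρ) (τ 13 (idx6 n n ρ ρ n (τ 8 0) n))) B := by
  have h0 : 0 < 14 := by norm_num
  rw [h.root_table (sq_lt (by nlinarith))]
  simp only [rootStage, eval_condEq, eval_minE, eval_ctr_view, eval_zero, eval_one, eval_sub,
    Nat.succ_ne_zero, if_false, h.eval_pairE h0, h.eval_nE h0,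
    eval_read_view_self _ (show 14 ≠ 2 by norm_num), Nat.add_sub_cancel, Nat.lt_succ_self, if_true,
    eval_read_view_of_lt _ (show 13 < 14 by norm_num) (show 13 ≠ 2 by norm_num),
    eval_read_view_of_lt _ (show 8 < 14 by norm_num) (show 8 ≠ 2 by norm_num)]

end Program

end VNE

/-! ### Reading the instance -/

namespace VNE

open RAM TwoStarVertex

theorem getD_flatMap {α : Type*} {K : ℕ} {f : α → List ℕ} (hf : ∀ a, (f a).length = K)
    (l : List α) (i : ℕ) (hi : i < l.length) {r : ℕ} (hr : r < K) :
    (l.flatMap f).getD (i * K + r) 0 = (f l[i]).getD r 0 := by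
  induction l generalizing i with
  | nil => simp at hi
  | cons a l ih =>
    rw [List.flatMap_cons]
    rcases i with _ | i
    · rw [List.getD_append _ _ _ _ (by rw [hf]; omega)]
      simp
    · have e : (i + 1) * K + r = K + (i * K + r) := by ring
      rw [List.getD_append_right _ _ _ _ (by rw [hf, e]; omega), hf, e, Nat.add_sub_cancel_left,
        ih i (by simpa using hi)]
      simp

theorem getD_listMatrix {n K : ℕ} {m : Fin n → Fin n → List ℕ} (hm : ∀ i j, (m i j).length = K)
    (i j : Fin n) {r : ℕ} (hr : r < K) :
    (listMatrix m).getD (K * (i * n + j) + r) 0 = (m i j).getD r 0 := by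
  have hj : (j : ℕ) * K + r < n * K := by
    have : ((j : ℕ) + 1) * K ≤ n * K := Nat.mul_le_mul_right _ j.2
    rw [add_mul] at this
    omega
  have e : K * (i * n + j) + r = i * (n * K) + (j * K + r) := by ring
  rw [e, listMatrix, getD_flatMap (fun a => length_flatMap_finRange (hm a)) _ i (by simp) hj,
    getD_flatMap (hm _) _ j (by simp) hr]
  simp

theorem length_listMatrix {n K : ℕ} {m : Fin n → Fin n → List ℕ}
    (hm : ∀ i j, (m i j).length = K) : (listMatrix m).length = n * (n * K) :=
  length_flatMap_finRange fun a => length_flatMap_finRange (hm a)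

open scoped Classical in
/-- The demand of the edge between `i` and `j`, and `0` if there is no such edge. -/
noncomputable def VirtualNetwork.demandAt {V : Type*} (S : VirtualNetwork V) (i j : V) : ℕ :=
  if h : S.graph.Adj i j then S.demand ⟨s(i, j), h⟩ else 0

open scoped Classical in
/-- The array `inp` holds, from position `off` on, the code of the networks `S` and `G`. -/
structure HoldsCode {n : ℕ} (S : VirtualNetwork (Fin n)) (G : PhysicalNetwork (Fin n)) (off : ℕ)
    (inp : ℕ → ℕ) : Prop where
  adjS : ∀ i j : Fin n, inp (off + 1 + 2 * (i * n + j)) = if S.graph.Adj i j then 1 else 0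
  demand : ∀ i j : Fin n, inp (off + 2 + 2 * (i * n + j)) = S.demandAt i j
  adjG : ∀ i j : Fin n, inp (off + 1 + 2 * (n * n) + 4 * (i * n + j)) =
    if G.graph.Adj i j then 1 else 0
  cap : ∀ i j : Fin n, inp (off + 1 + 1 + 2 * (n * n) + 4 * (i * n + j)) = G.capAt i j
  num : ∀ i j : Fin n, G.graph.Adj i j →
    inp (off + 1 + 2 + 2 * (n * n) + 4 * (i * n + j)) = (G.costAt i j).num
  den : ∀ i j : Fin n, G.graph.Adj i j →
    inp (off + 1 + 3 + 2 * (n * n) + 4 * (i * n + j)) = (G.costAt i j).den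

theorem holdsCode {n : ℕ} (S : VirtualNetwork (Fin n)) (G : PhysicalNetwork (Fin n)) {off : ℕ}
    {inp : ℕ → ℕ} (h : ∀ x, inp (off + x) = (networksCode S G).getD x 0) :
    HoldsCode S G off inp := by
  have hS : ∀ (i j : Fin n) (r : ℕ), r < 2 →
      inp (off + 1 + r + 2 * (i * n + j)) = (vnEntry S i j).getD r 0 := by
    intro i j r hr
    rw [show off + 1 + r + 2 * (i * n + j) = off + (2 * (i * n + j) + r + 1) by ring, h,
      networksCode, List.getD_cons_succ, List.getD_append, getD_listMatrix (length_vnEntry S) i j hr]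
    rw [length_listMatrix (length_vnEntry S)]
    have : (i * n + j : ℕ) < n * n := by
      simpa using digit_lt (M := n) (b' := 0) i.2 j.2
    nlinarith
  have hG : ∀ (i j : Fin n) (r : ℕ), r < 4 →
      inp (off + 1 + r + 2 * (n * n) + 4 * (i * n + j)) = (pnEntry G i j).getD r 0 := by
    intro i j r hr
    rw [show off + 1 + r + 2 * (n * n) + 4 * (i * n + j)
        = off + (n * (n * 2) + (4 * (i * n + j) + r) + 1) by ring, h,
      networksCode, List.getD_cons_succ, List.getD_append_right _ _ _ _
        (by rw [length_listMatrix (length_vnEntry S)]; omega),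
      length_listMatrix (length_vnEntry S), Nat.add_sub_cancel_left,
      getD_listMatrix (length_pnEntry G) i j hr]
  refine ⟨fun i j => ?_, fun i j => ?_, fun i j => ?_, fun i j => ?_, fun i j hij => ?_,
    fun i j hij => ?_⟩
  · refine (hS i j 0 (by norm_num)).trans ?_
    unfold vnEntry
    split_ifs <;> rfl
  · refine (hS i j 1 (by norm_num)).trans ?_
    unfold vnEntry VirtualNetwork.demandAt
    split_ifs <;> rfl
  · refine (hG i j 0 (by norm_num)).trans ?_
    unfold pnEntry
    split_ifs <;> rfl
  · refine (hG i j 1 (by norm_num)).trans ?_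
    unfold pnEntry PhysicalNetwork.capAt
    split_ifs <;> rfl
  · refine (hG i j 2 (by norm_num)).trans ?_
    rw [pnEntry, PhysicalNetwork.costAt, dif_pos hij, dif_pos hij]; rfl
  · refine (hG i j 3 (by norm_num)).trans ?_
    rw [pnEntry, PhysicalNetwork.costAt, dif_pos hij, dif_pos hij]; rfl

theorem prefix_sum {A f : ℕ → ℕ} {N B : ℕ} (h0 : A 0 = 0)
    (h1 : ∀ x < N, A (x + 1) = min (A x + f x) B) (hB : ∑ y ∈ Finset.range N, f y ≤ B) :
    ∀ x ≤ N, A x = ∑ y ∈ Finset.range x, f y := by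
  intro x hx
  induction x with
  | zero => simpa using h0
  | succ x ih =>
    rw [h1 x hx, ih (by omega), ← Finset.sum_range_succ]
    exact min_eq_left ((Finset.sum_le_sum_of_subset (by simpa using hx)).trans hB)

theorem prefix_prod {A f : ℕ → ℕ} {N B : ℕ} (h0 : A 0 = 1)
    (h1 : ∀ x < N, A (x + 1) = min (A x * f x) B) (hf : ∀ x < N, 0 < f x)
    (hB : ∏ y ∈ Finset.range N, f y ≤ B) :
    ∀ x ≤ N, A x = ∏ y ∈ Finset.range x, f y := by
  intro x hx
  induction x with
  | zero => simpa using h0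
  | succ x ih =>
    rw [h1 x hx, ih (by omega), ← Finset.prod_range_succ]
    refine min_eq_left (le_trans (Nat.le_of_dvd ?_ ?_) hB)
    · exact Finset.prod_pos fun y hy => hf y (by simpa using hy)
    · exact Finset.prod_dvd_prod_of_subset _ _ _ (by simpa using hx)

theorem sum_range_mul_self {n : ℕ} (f : ℕ → ℕ) :
    ∑ x ∈ Finset.range (n * n), f x = ∑ i : Fin n, ∑ j : Fin n, f (i * n + j) := by
  rw [Finset.sum_range, ← Fintype.sum_prod_type', ← finProdFinEquiv.sum_comp]
  refine Finset.sum_congr rfl fun p _ => ?_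
  congr 1
  simp only [finProdFinEquiv_apply_val]
  ring

section Parameters

variable {n g s D : ℕ} {S : VirtualNetwork (Fin n)} {φ : twoStar g s ≃g S.graph}

theorem card_group (j : Fin g) : (Finset.univ.filter fun q : Fin g × Fin s => j = q.1).card = s := by
  have e : (Finset.univ.filter fun q : Fin g × Fin s => j = q.1) = {j} ×ˢ Finset.univ := by
    ext ⟨j', i⟩; simp [eq_comm]
  rw [e, Finset.card_product]
  simp

open scoped Classical in
theorem degree_eq (φ : twoStar g s ≃g S.graph) (x : TwoStarVertex g s) :
    (∑ j, if S.graph.Adj (φ x) j then 1 else 0) =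
      match x with
      | .root => g
      | .head _ => s + 1
      | .leaf _ _ => 1 := by
  rw [← φ.toEquiv.sum_comp]
  have e : ∀ y, S.graph.Adj (φ x) (φ.toEquiv y) ↔ x.IsParent y ∨ y.IsParent x := fun y =>
    φ.map_adj_iff.trans twoStar_adj
  simp only [e]
  rw [sum_eq]
  cases x with
  | root => simp [IsParent]
  | head j => simp [IsParent, card_group, add_comm]
  | leaf j i => simp [IsParent]

open scoped Classical in
theorem sum_pendant (φ : twoStar g s ≃g S.graph) (hs : 1 ≤ s) :
    (∑ i, if (∑ j, if S.graph.Adj i j then 1 else 0) = 1 then 1 else 0) =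
      (if g = 1 then 1 else 0) + g * s := by
  rw [← φ.toEquiv.sum_comp, sum_eq]
  have e : ∀ x, (∑ j, if S.graph.Adj (φ.toEquiv x) j then 1 else 0) = _ := degree_eq φ
  simp only [e]
  have : s ≠ 0 := by omega
  simp [this]

theorem demandAt_eq (hφ : S.IsTwoStarVia φ D) (x : TwoStarVertex g s) :
    ∑ j, S.demandAt (φ x) j =
      match x with
      | .root => g * D
      | .head _ => D + s
      | .leaf _ _ => 1 := by
  classical
  have e : ∀ x y, S.demandAt (φ x) (φ y) =
      match x, y with
      | .root, .head _ => D
      | .head _, .root => D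
      | .head j, .leaf j' _ => if j = j' then 1 else 0
      | .leaf j _, .head j' => if j = j' then 1 else 0
      | _, _ => 0 := by
    intro x y
    have ha : S.graph.Adj (φ x) (φ y) ↔ x.IsParent y ∨ y.IsParent x :=
      φ.map_adj_iff.trans twoStar_adj
    cases x <;> cases y <;> simp only [IsParent, or_self, or_false, false_or] at ha <;>
      simp only [VirtualNetwork.demandAt, ha, dif_neg, not_false_eq_true]
    · exact (dif_pos trivial).trans (hφ.demand_head _ _ rfl)
    · exact (dif_pos trivial).trans (hφ.demand_head _ _ Sym2.eq_swap)
    · split_ifs with h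
      · subst h; exact hφ.demand_leaf _ _ _ rfl
      · rfl
    · split_ifs with h h' h'
      · subst h; exact hφ.demand_leaf _ _ _ Sym2.eq_swap
      · exact absurd h.symm h'
      · exact absurd h'.symm h
      · rfl
  rw [← φ.toEquiv.sum_comp]
  have e' : ∀ y, S.demandAt (φ x) (φ.toEquiv y) = _ := fun y => e x y
  simp only [e']
  rw [sum_eq]
  cases x with
  | root => simp
  | head j => simp [card_group]
  | leaf j i => simp

theorem sum_demandAt (hφ : S.IsTwoStarVia φ D) :
    ∑ i, ∑ j, S.demandAt i j = 2 * g * (D + s) := by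
  rw [← φ.toEquiv.sum_comp, sum_eq]
  have e : ∀ x, ∑ j, S.demandAt (φ.toEquiv x) j = _ := demandAt_eq hφ
  simp only [e]
  simp
  ring

end Parameters

end VNE

/-! ### Correctness of the program -/

namespace VNE

open RAM TwoStarVertex

theorem MinVal.or {B a b : ℕ} {P R : ℕ → Prop} (ha : MinVal B P a) (hb : MinVal B R b) :
    MinVal B (fun y => P y ∨ R y) (min a b) := by
  refine ⟨(min_le_left _ _).trans ha.1, ?_, fun h => ?_⟩
  · rintro y (hy | hy)
    · exact (min_le_left _ _).trans (ha.2 y hy)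
    · exact (min_le_right _ _).trans (hb.2 y hy)
  · rcases min_choice a b with h' | h' <;> rw [h'] at h ⊢
    · exact Or.inl (ha.3 h)
    · exact Or.inr (hb.3 h)

theorem minVal_eq {B t : ℕ} : MinVal B (fun y => y = t) (min t B) :=
  ⟨min_le_right _ _, fun _ h => h ▸ min_le_left _ _, fun h => by
    omega⟩

section Tables

variable {off n B : ℕ} {τ : Mem} {S : VirtualNetwork (Fin n)} {G : PhysicalNetwork (Fin n)}
  (h : Computed off n B τ) (hin : HoldsCode S G off (τ 0))

include hin in
theorem HoldsCode.isChild_iff (u v c : Fin n) :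
    (τ 0 (off + 1 + 2 * (n * n) + 4 * (v * n + c)) = 1 ∧ (c : ℕ) ≠ u) ↔
      c ∈ children G.graph u v := by
  rw [mem_children, hin.adjG v c]
  simp [Fin.ext_iff]

include h hin

theorem Computed.size_eq (hG : G.IsTree) (hB : n ≤ B) {u v : Fin n}
    (huv : u = v ∨ G.graph.Adj u v) :
    τ 11 (idx4 n n u v n) = (side G.graph u v).card := by
  have hA := SimpleGraph.IsTree.isAcyclic hG
  rw [← branchUpTo_self hA huv]
  refine table_eq_card hA hB (Z := fun k u v j => τ 11 (idx4 n k u v j)) ?_ ?_ ?_ le_rfl huv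
    (card_finset_fin_le _) le_rfl
  · intro k hk u v
    rw [h.size_zero hk u.2 v.2]
    exact min_eq_left (by omega)
  · intro k hk u v c hc
    rw [h.size_succ hk u.2 v.2 c.2, if_neg (fun h' => hc ((hin.isChild_iff u v c).1 h'))]
    refine min_eq_left ?_
    rw [h.size_table (lt_pow_six (by norm_num) (idx4_lt hk u.2.le v.2.le c.2.le))]
    exact min_le_right _ _
  · intro k hk u v c hc
    rw [h.size_succ hk u.2 v.2 c.2, if_pos ((hin.isChild_iff u v c).2 hc)]

theorem Computed.branch_minVal (hG : G.IsTree) {u v : Fin n} (huv : u = v ∨ G.graph.Adj u v)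
    {x : ℕ} (hx : x ≤ n) :
    MinVal B (IsWeight G.graph (fun a b i => τ 12 (idx3 n a b i)) u v n x)
      (τ 13 (idx6 n n u v n x n)) := by
  refine table_minVal (SimpleGraph.IsTree.isAcyclic hG)
    (Q := fun k u v j x => τ 13 (idx6 n k u v j x n)) ?_ ?_ ?_ le_rfl huv
    (card_finset_fin_le _) le_rfl hx
  · intro k hk u v x hx
    rw [h.branch_zero hk u.2 v.2 hx le_rfl]
    simp only [ne_eq, Fin.ext_iff]
  · intro k hk u v c hc x hx
    rw [h.branch_of_not_child hk u.2 v.2 c.2 hx le_rfl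
      (fun h' => hc ((hin.isChild_iff u v c).1 h'))]
    refine min_eq_left ?_
    rw [h.branch_table (idx6_lt hk u.2.le v.2.le c.2.le hx le_rfl)]
    exact min_le_right _ _
  · intro k hk u v c hc x hx
    have hch := (hin.isChild_iff u v c).2 hc
    have key : ∀ i ≤ n, MinVal B (fun y => ∃ l ≤ i, l ≤ x ∧
        y = τ 13 (idx6 n (k + 1) u v c (x - l) n) + τ 12 (idx3 n v c l) +
          τ 13 (idx6 n k v c n l n)) (τ 13 (idx6 n (k + 1) u v (c + 1) x i)) := by
      intro i hi
      induction i with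
      | zero =>
        rw [h.branch_of_child_zero hk u.2 v.2 c.2 hx hch]
        refine minVal_eq.congr fun y => ?_
        simp
      | succ i ih =>
        have ih := ih (by omega)
        rw [h.branch_of_child_succ hk u.2 v.2 c.2 hx hi hch]
        split_ifs with hix
        · rw [min_assoc]
          refine (ih.or minVal_eq).congr fun y => ?_
          constructor
          · rintro (⟨l, hl, hlx, rfl⟩ | rfl)
            · exact ⟨l, by omega, hlx, rfl⟩
            · exact ⟨i + 1, le_rfl, hix, rfl⟩
          · rintro ⟨l, hl, hlx, rfl⟩
            rcases Nat.lt_or_ge l (i + 1) with hl' | hl'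
            · exact Or.inl ⟨l, by omega, hlx, rfl⟩
            · obtain rfl : l = i + 1 := by omega
              exact Or.inr rfl
        · rw [min_eq_left ih.1]
          refine ih.congr fun y => exists_congr fun l => ?_
          constructor <;> rintro ⟨h1, h2, h3⟩ <;> exact ⟨by omega, h2, h3⟩
    refine (key n le_rfl).congr fun y => exists_congr fun l => ?_
    constructor
    · rintro ⟨_, h2, h3⟩; exact ⟨h2, h3⟩
    · rintro ⟨h2, h3⟩; exact ⟨by omega, h2, h3⟩

theorem Computed.root_minVal (hG : G.IsTree) (hg : τ 8 0 ≤ n) :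
    MinVal B (fun y => ∃ (ρ : Fin n) (H : Finset (Fin n)), ρ ∉ H ∧ H.card = τ 8 0 ∧
      y = totalWeight G.graph (fun a b i => τ 12 (idx3 n a b i)) (arcs G.graph ρ ρ) H)
      (τ 14 n) := by
  have key : ∀ x ≤ n, MinVal B (fun y => ∃ ρ : Fin n, (ρ : ℕ) < x ∧
      IsWeight G.graph (fun a b i => τ 12 (idx3 n a b i)) ρ ρ n (τ 8 0) y) (τ 14 x) := by
    intro x hx
    induction x with
    | zero =>
      rw [h.root_zero]
      refine ⟨le_rfl, ?_, fun h => absurd h (lt_irrefl _)⟩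
      rintro y ⟨ρ, hρ, -⟩
      omega
    | succ x ih =>
      have ih := ih (by omega)
      rw [h.root_succ hx, min_eq_left ((min_le_left _ _).trans ih.1)]
      refine (ih.or (h.branch_minVal hin hG (u := ⟨x, hx⟩) (v := ⟨x, hx⟩) (Or.inl rfl) hg)).congr
        fun y => ?_
      constructor
      · rintro (⟨ρ, hρ, hy⟩ | hy)
        · exact ⟨ρ, by omega, hy⟩
        · exact ⟨⟨x, hx⟩, Nat.lt_succ_self x, hy⟩
      · rintro ⟨ρ, hρ, hy⟩
        rcases Nat.lt_or_ge (ρ : ℕ) x with hlt | hge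
        · exact Or.inl ⟨ρ, hlt, hy⟩
        · obtain rfl : ρ = ⟨x, hx⟩ := Fin.ext (by simp only; omega)
          exact Or.inr hy
  refine (key n le_rfl).congr fun y => exists_congr fun ρ => ?_
  rw [isWeight_root hG]
  simp

end Tables

section Parameters

variable {off n W : ℕ} {τ : Mem} {S : VirtualNetwork (Fin n)} {G : PhysicalNetwork (Fin n)}
  {g s D : ℕ} {φ : twoStar g s ≃g S.graph}
  (h : Computed off n (W ^ 6) τ) (hin : HoldsCode S G off (τ 0)) (hW : n < W)
  (hcell : ∀ x, τ 0 x ≤ W)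

theorem mul_le_pow {a b W i j k : ℕ} (ha : a ≤ W ^ i) (hb : b ≤ W ^ j) (hW : 0 < W)
    (hk : i + j ≤ k) : a * b ≤ W ^ k := by
  refine (Nat.mul_le_mul ha hb).trans ?_
  rw [← pow_add]
  exact Nat.pow_le_pow_right hW hk

theorem card_eq_of_iso (φ : twoStar g s ≃g S.graph) : n = 1 + (g + g * s) := by
  rw [← card_eq (g := g) (s := s), Fintype.card_congr φ.toEquiv, Fintype.card_fin]

include hW hcell in
/-- A sum over the matrix entries is small, since each of them is. -/
theorem sum_entries_le (p : ℕ → ℕ) :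
    ∑ x ∈ Finset.range (n * n), τ 0 (p x) ≤ W ^ 6 := by
  have h1 : n * n ≤ W ^ 2 := by rw [pow_two]; exact Nat.mul_le_mul hW.le hW.le
  refine (Finset.sum_le_card_nsmul _ _ W fun x _ => hcell _).trans ?_
  rw [Finset.card_range, smul_eq_mul]
  exact mul_le_pow (j := 1) h1 (by simp) (by omega) (by norm_num)

include h hin hW hcell in
theorem Computed.groups (φ : twoStar g s ≃g S.graph) (hg : 1 ≤ g) (hs : 1 ≤ s) : τ 8 0 = g := by
  classical
  have hn := card_eq_of_iso φ
  have hWB : W ≤ W ^ 6 := Nat.le_self_pow (by norm_num) _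
  have h4 := prefix_sum h.degree_zero (fun x hx => h.degree_succ hx)
    (sum_entries_le hW hcell fun x => off + 1 + 2 * x)
  have hdeg : ∀ i : Fin n, τ 4 (i * n + n) - τ 4 (i * n) =
      ∑ j, if S.graph.Adj i j then 1 else 0 := by
    intro i
    have hi : (i * n + n : ℕ) ≤ n * n := by
      have : ((i : ℕ) + 1) * n ≤ n * n := Nat.mul_le_mul_right _ i.2
      rwa [add_mul, one_mul] at this
    rw [h4 _ hi, h4 _ (by omega), Finset.sum_range_add, Nat.add_sub_cancel_left, Finset.sum_range]
    exact Finset.sum_congr rfl fun j _ => hin.adjS i j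
  have h5 := prefix_sum (N := n) h.pendant_zero (fun x hx => h.pendant_succ hx)
    ((Finset.sum_le_card_nsmul _ _ 1 fun x _ => by split_ifs <;> simp).trans
      (by simpa using hW.le.trans hWB)) n le_rfl
  rw [Finset.sum_range] at h5
  simp only [hdeg] at h5
  rw [sum_pendant φ hs] at h5
  have h6 : max 1 (n - 1 - τ 5 n) = g := by
    rw [h5]
    split_ifs <;> omega
  rw [h.groups_eq, h6]
  refine min_eq_left (le_trans ?_ hWB)
  omega

include h hin hW hcell in
theorem Computed.leaves (φ : twoStar g s ≃g S.graph) (hg : 1 ≤ g) (hs : 1 ≤ s) : τ 9 0 = s := by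
  have hn := card_eq_of_iso φ
  have hWB : W ≤ W ^ 6 := Nat.le_self_pow (by norm_num) _
  rw [h.leaves_eq, h.groups hin hW hcell φ hg hs]
  have e : (n - 1) / g - 1 = s := by
    rw [show n - 1 = g * (s + 1) by rw [hn, mul_add]; omega, Nat.mul_div_cancel_left _ (by omega)]
    simp
  rw [e]
  have : s ≤ g * s := Nat.le_mul_of_pos_left _ hg
  exact min_eq_left (by omega)

include h hin hW hcell in
theorem Computed.rootDemand (hφ : S.IsTwoStarVia φ D) (hg : 1 ≤ g) (hs : 1 ≤ s) : τ 10 0 = D := by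
  have h6 := prefix_sum h.demand_zero (fun x hx => h.demand_succ hx)
    (sum_entries_le hW hcell fun x => off + 2 + 2 * x) _ le_rfl
  have hle := sum_entries_le hW hcell fun x => off + 2 + 2 * x
  rw [sum_range_mul_self] at h6 hle
  simp only [hin.demand] at h6 hle
  rw [sum_demandAt hφ] at h6 hle
  rw [h.rootDemand_eq, h.groups hin hW hcell φ hg hs, h.leaves hin hW hcell φ hg hs, h6,
    Nat.mul_div_cancel_left _ (by omega), Nat.add_sub_cancel]
  refine min_eq_left (le_trans ?_ hle)
  nlinarith

variable (hL : ∏ x ∈ Finset.range (n * n),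
  max 1 (τ 0 (off + 1 + 3 + 2 * (n * n) + 4 * x)) ≤ W)

include h hin hW hL in
/-- The number in cell `n * n` of array `7` is a common denominator of the costs. -/
theorem Computed.commonDen : 0 < τ 7 (n * n) ∧ τ 7 (n * n) ≤ W ∧
    ∀ a b, G.graph.Adj a b → (G.costAt a b).den ∣ τ 7 (n * n) := by
  have hWB : W ≤ W ^ 6 := Nat.le_self_pow (by norm_num) _
  have h7 := prefix_prod (h.den_zero.trans (min_eq_left (by omega)))
    (fun x hx => h.den_succ hx) (fun x _ => by omega) (hL.trans hWB) _ le_rfl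
  rw [h7]
  refine ⟨Finset.prod_pos fun x _ => by omega, hL, fun a b hab => ?_⟩
  have hx : (a * n + b : ℕ) ∈ Finset.range (n * n) := by
    rw [Finset.mem_range]
    simpa using digit_lt (M := n) (b' := 0) a.2 b.2
  have h1 := Finset.dvd_prod_of_mem
    (fun x => max 1 (τ 0 (off + 1 + 3 + 2 * (n * n) + 4 * x))) hx
  have h2 : 1 ≤ (G.costAt a b).den := (G.costAt a b).den_pos
  simpa only [hin.den a b hab, max_eq_right h2] using h1

include h hin hW hcell hL in
/-- The weight of an arc is its cost for the least load, multiplied by the common denominator, if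
this load respects the capacity, and the bound `W ^ 6` otherwise. -/
theorem Computed.weight_arc (hG : G.IsTree) (hφ : S.IsTwoStarVia φ D) (hg : 1 ≤ g) (hs : 1 ≤ s)
    {H : Finset (Fin n)} {a b : Fin n} (hab : G.graph.Adj a b) :
    (arcLoad G D s H a b ≤ G.capAt a b →
      τ 12 (idx3 n a b (H ∩ side G.graph a b).card) ≤ W ^ 3 ∧
      (τ 12 (idx3 n a b (H ∩ side G.graph a b).card) : ℚ≥0) =
        τ 7 (n * n) * (G.costAt a b * arcLoad G D s H a b)) ∧
    (¬ arcLoad G D s H a b ≤ G.capAt a b →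
      τ 12 (idx3 n a b (H ∩ side G.graph a b).card) = W ^ 6) := by
  have hn := card_eq_of_iso φ
  have hWB : W ≤ W ^ 6 := Nat.le_self_pow (by norm_num) _
  obtain ⟨hL0, hLW, hdvd⟩ := h.commonDen hin hW hL
  have hw := h.weight_eq a.2 b.2 (card_finset_fin_le (H ∩ side G.graph a b))
  rw [h.size_eq hin hG (hW.le.trans hWB) (Or.inr hab),
    h.rootDemand hin hW hcell hφ hg hs, h.leaves hin hW hcell φ hg hs, hin.cap a b,
    hin.num a b hab, hin.den a b hab] at hw
  have hnum := hcell (off + 1 + 2 + 2 * (n * n) + 4 * (a * n + b))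
  rw [hin.num a b hab] at hnum
  have hcap := hcell (off + 1 + 1 + 2 * (n * n) + 4 * (a * n + b))
  rw [hin.cap a b] at hcap
  change _ = min (if arcLoad G D s H a b ≤ G.capAt a b then _ * _ * arcLoad G D s H a b else _) _
    at hw
  constructor
  · intro hle
    have hdiv : τ 7 (n * n) / (G.costAt a b).den ≤ W := (Nat.div_le_self _ _).trans hLW
    have hW3 : (G.costAt a b).num * (τ 7 (n * n) / (G.costAt a b).den) * arcLoad G D s H a b
        ≤ W ^ 3 := by
      rw [pow_succ, pow_two]
      exact Nat.mul_le_mul (Nat.mul_le_mul hnum hdiv) (hle.trans hcap)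
    rw [if_pos hle, min_eq_left (hW3.trans (Nat.pow_le_pow_right (by omega) (by norm_num)))] at hw
    rw [hw]
    refine ⟨hW3, ?_⟩
    obtain ⟨q, hq⟩ := hdvd a b hab
    have hd : 0 < (G.costAt a b).den := (G.costAt a b).den_pos
    have hc : G.costAt a b * ((G.costAt a b).den : ℚ≥0) = ((G.costAt a b).num : ℚ≥0) :=
      NNRat.mul_den_eq_num _
    rw [hq, Nat.mul_div_cancel_left _ hd]
    push_cast
    rw [← hc]
    ring
  · intro hle
    rw [if_neg hle, min_self] at hw
    exact hw

include h hin hW hcell hL in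
/-- The content of cell `n` of array `14` is the minimal cost, multiplied by the common
denominator, or the bound `W ^ 6` if no embedding respects the capacities. -/
theorem Computed.isLeast (hG : G.IsTree) (hφ : S.IsTwoStarVia φ D) (hg : 1 ≤ g) (hs : 1 ≤ s) :
    (¬ τ 14 n < W ^ 6 ∧ ¬ ∃ f, RespectsCapacities S G f) ∨
      (τ 14 n < W ^ 6 ∧
        IsLeast {c | ∃ f, RespectsCapacities S G f ∧ embeddingCost S G f = c}
          ((τ 14 n : ℚ≥0) / (τ 7 (n * n) : ℚ≥0))) := by
  have hn := card_eq_of_iso φ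
  obtain ⟨hL0, hLW, -⟩ := h.commonDen hin hW hL
  have hg' := h.groups hin hW hcell φ hg hs
  have hmin := h.root_minVal hin hG (by omega)
  rw [hg'] at hmin
  have hLpos : (0 : ℚ≥0) < (τ 7 (n * n) : ℚ≥0) := by exact_mod_cast hL0
  have hlow : ∀ f, RespectsCapacities S G f → τ 14 n < W ^ 6 ∧
      (τ 14 n : ℚ≥0) ≤ τ 7 (n * n) * embeddingCost S G f := by
    intro f hf
    obtain ⟨ρ, H, hρ, hHg, hcap, hcost⟩ := exists_arcLoad_le hG hφ f hf
    have hw := fun (p : Fin n × Fin n) (hp : p ∈ arcs G.graph ρ ρ) =>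
      (h.weight_arc hin hW hcell hL hG hφ hg hs (H := H) (mem_arcs.1 hp).1).1 (hcap p.1 p.2 hp)
    have hle := hmin.2 _ ⟨ρ, H, hρ, hHg, rfl⟩
    constructor
    · refine lt_of_le_of_lt (hle.trans (Finset.sum_le_card_nsmul _ _ (W ^ 3)
        fun p hp => (hw p hp).1)) ?_
      have hcard : (arcs G.graph ρ ρ).card ≤ n * n :=
        (Finset.card_le_univ _).trans (by simp)
      rw [smul_eq_mul]
      -- there are less than `W ^ 2` arcs, of weight at most `W ^ 3` each
      calc (arcs G.graph ρ ρ).card * W ^ 3 ≤ n * n * W ^ 3 := Nat.mul_le_mul_right _ hcard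
        _ < W * W * W ^ 3 := by
          have : n * n < W * W := Nat.mul_lt_mul'' hW hW
          exact Nat.mul_lt_mul_of_pos_right this (pow_pos (by omega) 3)
        _ ≤ W ^ 6 := mul_le_pow (i := 2) (j := 3) (by rw [pow_two]) le_rfl (by omega) (by norm_num)
    · calc (τ 14 n : ℚ≥0) ≤ ((totalWeight G.graph (fun a b i => τ 12 (idx3 n a b i))
            (arcs G.graph ρ ρ) H : ℕ) : ℚ≥0) := by exact_mod_cast hle
        _ = τ 7 (n * n) *
            ∑ p ∈ arcs G.graph ρ ρ, G.costAt p.1 p.2 * (arcLoad G D s H p.1 p.2 : ℚ≥0) := by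
          rw [totalWeight, Nat.cast_sum, Finset.mul_sum]
          exact Finset.sum_congr rfl fun p hp => (hw p hp).2
        _ ≤ _ := by gcongr
  by_cases hlt : τ 14 n < W ^ 6
  · right
    refine ⟨hlt, ?_, ?_⟩
    · obtain ⟨ρ, H, hρ, hHg, hy⟩ := hmin.3 hlt
      have hcap : ∀ a b, (a, b) ∈ arcs G.graph ρ ρ → arcLoad G D s H a b ≤ G.capAt a b := by
        intro a b hab
        by_contra hle
        have h1 := (h.weight_arc hin hW hcell hL hG hφ hg hs (H := H) (mem_arcs.1 hab).1).2 hle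
        have h2 := Finset.single_le_sum
          (f := fun p : Fin n × Fin n => τ 12 (idx3 n p.1 p.2 (H ∩ side G.graph p.1 p.2).card))
          (fun _ _ => Nat.zero_le _) hab
        rw [totalWeight] at hy
        simp only at h2
        omega
      obtain ⟨f, hf, hcost⟩ := exists_embedding_arcLoad hG hφ hρ hHg hcap
      refine ⟨f, hf, ?_⟩
      rw [eq_div_iff hLpos.ne', hcost, hy, totalWeight, Nat.cast_sum, mul_comm, Finset.mul_sum]
      exact Finset.sum_congr rfl fun p hp =>
        ((h.weight_arc hin hW hcell hL hG hφ hg hs (mem_arcs.1 hp).1).1 (hcap p.1 p.2 hp)).2.symm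
    · rintro c ⟨f, hf, rfl⟩
      rw [div_le_iff₀' hLpos]
      exact (hlow f hf).2
  · left
    refine ⟨hlt, ?_⟩
    rintro ⟨f, hf⟩
    exact hlt (hlow f hf).1

end Parameters

end VNE

/-! ### The two problems -/

namespace VNE

open RAM RAM.Expr TwoStarVertex

/-- The oversubscription factor matters only in so far as it gives all edges at the root the same
demand. -/
theorem exists_isTwoStarVia {V : Type*} {S : VirtualNetwork V} (h : S.IsOversubscribedTwoStar) :
    ∃ (g s D : ℕ) (φ : twoStar g s ≃g S.graph), 1 ≤ g ∧ 1 ≤ s ∧ S.IsTwoStarVia φ D := by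
  obtain ⟨g, s, o, φ, hg, hs, -, h1, h2⟩ := h
  have hadj : ∀ j, S.graph.Adj (φ .root) (φ (.head j)) := fun j =>
    φ.map_adj_iff.2 (twoStar_adj.2 (.inl trivial))
  refine ⟨g, s, S.demand ⟨s(φ .root, φ (.head ⟨0, hg⟩)), hadj _⟩, φ, hg, hs, ⟨fun j e he => ?_, h2⟩⟩
  have := (h1 j e he).trans (h1 ⟨0, hg⟩ ⟨_, hadj _⟩ rfl).symm
  exact_mod_cast this

/-- The content of the memory after all stages but the last one, which computes the output by the
expression `e`, for an input `l` that has the code of the networks at position `off`. -/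
theorem computed_of_stages {n off : ℕ} {S : VirtualNetwork (Fin n)} {G : PhysicalNetwork (Fin n)}
    (hS : S.IsOversubscribedTwoStar) (hG : G.IsTree) {l : List ℕ} {τ : Mem} {e : Expr}
    (hl : ∀ x, l.getD (off + x) 0 = (networksCode S G).getD x 0) (hnl : n ≤ l.length)
    (h0 : ∀ i, τ 0 i = l.getD i 0) (h3 : τ 3 0 = weight l ^ 6)
    (htab : ∀ (m : ℕ) (hm : m < (minCostStages off ++ [e]).length),
      ∀ i < (l.getD off 0 + 1) ^ 6, τ (4 + m) i =
        min (((minCostStages off ++ [e])[m]).eval (τ.view (4 + m) i)) (weight l ^ 6)) :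
    Computed off n (weight l ^ 6) τ ∧
      (∀ i < 4, τ 15 i = min (e.eval (τ.view 15 i)) (weight l ^ 6)) ∧
      3 ≤ weight l ^ 6 ∧ τ 14 n ≤ weight l ^ 6 ∧ 0 < τ 7 (n * n) ∧ τ 7 (n * n) ≤ weight l ^ 6 ∧
      ((¬ τ 14 n < weight l ^ 6 ∧ ¬ ∃ f, RespectsCapacities S G f) ∨
      (τ 14 n < weight l ^ 6 ∧
        IsLeast {c | ∃ f, RespectsCapacities S G f ∧ embeddingCost S G f = c}
          ((τ 14 n : ℚ≥0) / (τ 7 (n * n) : ℚ≥0)))) := by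
  have hn : l.getD off 0 = n := by simpa [networksCode] using hl 0
  rw [hn] at htab
  have hC : Computed off n (weight l ^ 6) τ := by
    refine ⟨by rw [h0, hn], h3, fun m hm i hi => ?_⟩
    have := htab m (by simp only [List.length_append]; omega) i hi
    rwa [List.getElem_append_left hm] at this
  have hin : HoldsCode S G off (τ 0) := holdsCode S G fun x => by rw [h0, hl]
  have hW : n < weight l := lt_of_le_of_lt hnl (length_le_weight l)
  have hWB : weight l ≤ weight l ^ 6 := Nat.le_self_pow (by norm_num) _
  have hcell : ∀ x, τ 0 x ≤ weight l := fun x => by rw [h0]; exact getD_le_weight l x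
  have hL : ∏ x ∈ Finset.range (n * n), max 1 (τ 0 (off + 1 + 3 + 2 * (n * n) + 4 * x))
      ≤ weight l := by
    simp only [h0]
    refine le_trans (le_of_eq ?_) (prod_getD_le_weight l
      ((Finset.range (n * n)).image fun x => off + 1 + 3 + 2 * (n * n) + 4 * x))
    rw [Finset.prod_image fun x _ y _ (hxy : off + 1 + 3 + 2 * (n * n) + 4 * x =
      off + 1 + 3 + 2 * (n * n) + 4 * y) => by omega]
  obtain ⟨g, s, D, φ, hg, hs, hφ⟩ := exists_isTwoStarVia hS
  have hn' := card_eq_of_iso φ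
  have hgs : 1 ≤ g * s := Nat.mul_pos hg hs
  obtain ⟨hL0, hLW, -⟩ := hC.commonDen hin hW hL
  refine ⟨hC, fun i hi => ?_, by omega, ?_, hL0, hLW.trans hWB,
    hC.isLeast hin hW hcell hL hG hφ hg hs⟩
  · exact htab 11 (by simp [minCostStages]) i
      (lt_pow_six (m := 1) (by norm_num) (by rw [pow_one]; omega))
  · rw [hC.root_table (sq_lt (by nlinarith))]
    exact min_le_right _ _

theorem length_networksCode {n : ℕ} (S : VirtualNetwork (Fin n)) (G : PhysicalNetwork (Fin n)) :
    n ≤ (networksCode S G).length := by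
  rw [networksCode, List.length_cons, List.length_append,
    length_listMatrix (length_vnEntry S), length_listMatrix (length_pnEntry G)]
  nlinarith [Nat.zero_le (n * (n * 4)), sq_nonneg (n : ℤ), Nat.le_mul_self n]

theorem solvable_minCost :
    RAM.SolvableInPolyTime
      (networksEncoding (fun _ S => S.IsOversubscribedTwoStar) (fun _ G => G.IsTree))
      IsMinimalCost := by
  refine solvable_of_stages _ _ 0 (minCostStages 0 ++ [costStage 0]) (fun N => ?_)
    fun N τ h0 h3 htab => ?_
  · exact length_networksCode N.vn N.pn
  · obtain ⟨hC, hout, hB3, h14, hL0, hLB, hopt⟩ := computed_of_stages N.vn_mem N.pn_mem (off := 0)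
      (l := networksEncoding (fun _ S => S.IsOversubscribedTwoStar) (fun _ G => G.IsTree) N)
      (e := costStage 0) (fun x => by rw [zero_add]; rfl) (length_networksCode N.vn N.pn) h0 h3 htab
    generalize weight _ ^ 6 = B at *
    have h15 : 0 < 15 := by norm_num
    simp only [costStage, eval_condEq, eval_condLe, eval_ctr_view, eval_zero, eval_one, eval_two,
      eval_three, hC.eval_bE (show 3 < 15 by norm_num), hC.eval_nE h15, eval_mul,
      eval_read_view_of_lt _ (show 14 < 15 by norm_num) (show 14 ≠ 2 by norm_num),
      eval_read_view_of_lt _ (show 7 < 15 by norm_num) (show 7 ≠ 2 by norm_num)] at hout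
    have o0 := hout 0 (by norm_num)
    have o1 := hout 1 (by norm_num)
    have o2 := hout 2 (by norm_num)
    have o3 := hout 3 (by norm_num)
    simp only [if_true, one_ne_zero, OfNat.ofNat_ne_zero, OfNat.ofNat_ne_one, if_false,
      show (3 : ℕ) ≠ 2 by norm_num] at o0 o1 o2 o3
    change ∃ out : List ℕ, out.length ≤ 3 ∧ τ 15 0 = out.length ∧
      (∀ (i : ℕ) (hi : i < out.length), τ 15 (i + 1) = out[i]) ∧ IsMinimalCost N out
    rcases hopt with ⟨hge, hno⟩ | ⟨hlt, hleast⟩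
    · refine ⟨[0], by simp, ?_, ?_, Or.inl ⟨hno, rfl⟩⟩
      · rw [o0, if_pos (by omega)]
        exact min_eq_left (by omega)
      · intro i hi
        obtain rfl : i = 0 := by simpa using hi
        rw [o1, if_pos (by omega)]
        exact min_eq_left (by omega)
    · refine ⟨[1, τ 14 N.n, τ 7 (N.n * N.n)], by simp, ?_, ?_, Or.inr ⟨_, _, hL0, rfl, hleast⟩⟩
      · rw [o0, if_neg (by omega)]
        exact min_eq_left hB3
      · intro i hi
        have hi : i < 3 := by simpa using hi
        interval_cases i
        · rw [o1, if_neg (by omega)]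
          exact min_eq_left (by omega)
        · rw [o2]
          exact min_eq_left h14
        · rw [o3]
          exact min_eq_left hLB

theorem inP_hasEmbedding :
    RAM.InP (decisionEncoding (fun _ S => S.IsOversubscribedTwoStar) (fun _ G => G.IsTree))
      HasEmbedding := by
  refine solvable_of_stages _ _ 3 (minCostStages 3 ++ [decisionStage 3]) (fun I => ?_)
    fun I τ h0 h3 htab => ?_
  · exact (length_networksCode I.1.vn I.1.pn).trans
      (show _ ≤ (networksCode I.1.vn I.1.pn).length + 1 + 1 + 1 by omega)
  · obtain ⟨N, θ⟩ := I
    have hl : ∀ x, (decisionEncoding (fun _ S => S.IsOversubscribedTwoStar) (fun _ G => G.IsTree)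
        (N, θ)).getD (3 + x) 0 = (networksCode N.vn N.pn).getD x 0 := by
      intro x
      rw [show 3 + x = x + 1 + 1 + 1 by omega]
      rfl
    obtain ⟨hC, hout, hB3, h14, hL0, -, hopt⟩ := computed_of_stages N.vn_mem N.pn_mem (off := 3)
      (l := decisionEncoding (fun _ S => S.IsOversubscribedTwoStar) (fun _ G => G.IsTree) (N, θ))
      (e := decisionStage 3) hl
      ((length_networksCode N.vn N.pn).trans
        (show _ ≤ (networksCode N.vn N.pn).length + 1 + 1 + 1 by omega)) h0 h3 htab
    have t0 : τ 0 0 = if θ < 0 then 1 else 0 := h0 0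
    have t1 : τ 0 1 = θ.num.natAbs := h0 1
    have t2 : τ 0 2 = θ.den := h0 2
    generalize weight _ ^ 6 = B at *
    have h15 : 0 < 15 := by norm_num
    simp only [decisionStage, eval_condEq, eval_condLe, eval_ctr_view, eval_zero, eval_one,
      eval_two, hC.eval_bE (show 3 < 15 by norm_num), hC.eval_nE h15, eval_mul,
      eval_read_view_of_lt _ (show 14 < 15 by norm_num) (show 14 ≠ 2 by norm_num),
      eval_read_view_of_lt _ (show 7 < 15 by norm_num) (show 7 ≠ 2 by norm_num),
      eval_read_view_of_lt _ h15 (show 0 ≠ 2 by norm_num), t0, t1, t2] at hout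
    have o0 := hout 0 (by norm_num)
    have o1 := hout 1 (by norm_num)
    simp only [if_true, one_ne_zero, if_false] at o0 o1
    change ∃ out : List ℕ, out.length ≤ 3 ∧ τ 15 0 = out.length ∧
      (∀ (i : ℕ) (hi : i < out.length), τ 15 (i + 1) = out[i]) ∧
      ((HasEmbedding (N, θ) ∧ out = [1]) ∨ (¬ HasEmbedding (N, θ) ∧ out = [0]))
    have o0' : τ 15 0 = 1 := by rw [o0]; exact min_eq_left (by omega)
    suffices hkey : (HasEmbedding (N, θ) ∧ τ 15 1 = 1) ∨ (¬ HasEmbedding (N, θ) ∧ τ 15 1 = 0) by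
      rcases hkey with ⟨h1, h2⟩ | ⟨h1, h2⟩
      · refine ⟨[1], by simp, o0', fun i hi => ?_, Or.inl ⟨h1, rfl⟩⟩
        obtain rfl : i = 0 := by simpa using hi
        exact h2
      · refine ⟨[0], by simp, o0', fun i hi => ?_, Or.inr ⟨h1, rfl⟩⟩
        obtain rfl : i = 0 := by simpa using hi
        exact h2
    rcases hopt with ⟨hge, hno⟩ | ⟨hlt, hmem, hleast⟩
    · refine Or.inr ⟨fun ⟨f, hf, _⟩ => hno ⟨f, hf⟩, ?_⟩
      rw [o1, if_pos (by omega)]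
      exact min_eq_left (by omega)
    · rw [if_neg (by omega)] at o1
      by_cases hθ : θ < 0
      · refine Or.inr ⟨fun ⟨f, _, hc⟩ => ?_, ?_⟩
        · exact absurd (lt_of_le_of_lt hc hθ) (not_lt.2 (embeddingCost N.vn N.pn f).coe_nonneg)
        · rw [o1, if_pos hθ, if_pos rfl]
          exact min_eq_left (by omega)
      · have hiff : HasEmbedding (N, θ) ↔
            τ 14 N.n * θ.den ≤ θ.num.natAbs * τ 7 (N.n * N.n) := by
          have h1 : HasEmbedding (N, θ) ↔
              (((τ 14 N.n : ℚ≥0) / (τ 7 (N.n * N.n) : ℚ≥0) : ℚ≥0) : ℚ) ≤ θ := by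
            constructor
            · rintro ⟨f, hf, hc⟩
              refine le_trans ?_ hc
              exact_mod_cast hleast ⟨f, hf, rfl⟩
            · intro h
              obtain ⟨f, hf, hc⟩ := hmem
              refine ⟨f, hf, ?_⟩
              rw [hc]
              exact h
          have hθ' : θ = (θ.num.natAbs : ℚ) / (θ.den : ℚ) := by
            conv_lhs => rw [← Rat.num_div_den θ]
            congr 1
            have : ((θ.num.natAbs : ℕ) : ℤ) = θ.num :=
              Int.natAbs_of_nonneg (Rat.num_nonneg.2 (not_lt.1 hθ))
            rw [← Int.cast_natCast, this]
          have hL0' : (0 : ℚ) < (τ 7 (N.n * N.n) : ℚ) := by exact_mod_cast hL0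
          have hden : (0 : ℚ) < (θ.den : ℚ) := by exact_mod_cast θ.den_pos
          rw [h1]
          conv_lhs => rw [hθ']
          push_cast
          rw [div_le_div_iff₀ hL0' hden]
          exact_mod_cast Iff.rfl
        rw [if_neg hθ, if_neg (by norm_num)] at o1
        by_cases hE : HasEmbedding (N, θ)
        · refine Or.inl ⟨hE, ?_⟩
          rw [o1, if_pos (hiff.1 hE)]
          exact min_eq_left (by omega)
        · refine Or.inr ⟨hE, ?_⟩
          rw [o1, if_neg fun h => hE (hiff.2 h)]
          exact min_eq_left (by omega)

end VNE

theorem mainTheorem2 :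
    RAM.InP
      (VNE.decisionEncoding (fun _ S => S.IsOversubscribedTwoStar) (fun _ G => G.IsTree))
      VNE.HasEmbedding ∧
    RAM.SolvableInPolyTime
      (VNE.networksEncoding (fun _ S => S.IsOversubscribedTwoStar) (fun _ G => G.IsTree))
      VNE.IsMinimalCost :=
  ⟨VNE.inP_hasEmbedding, VNE.solvable_minCost⟩
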